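/- Setting. Let $M$ be a connected $n$-dimensional $C^7$ manifold (Hausdorff, second countable), and let $A\subset TM\setminus 0_{TM}$ be open with $\pi(A)=M$ and $\lambda v\in A$ for all $v\in A$, $\lambda>0$. Let $L:A\to\mathbb R$ be a $C^6$ conic pseudo-Finsler metric: $L$ is $C^6$, $L(\lambda v)=\lambda^2L(v)$ for $\lambda>0$, and for every $v\in A$ the fundamental tensor $g_v(u,w)=\frac12\frac{\partial^2}{\partial t\partial s}L(v+tu+sw)|_{t=s=0}$ on $T_{\pi(v)}M$ is nondegenerate. In canonical coordinates $(x,y)$ of $TM$ put $g_{ij}=\frac12L_{y^iy^j}$, $(g^{ij})=(g_{ij})^{-1}$, $C_{ijk}=\frac14L_{y^iy^jy^k}$, $C^i_{jm}=g^{il}C_{ljm}$, $\gamma^i_{jm}=\frac12g^{is}\left(\frac{\partial g_{sj}}{\partial x^m}+\frac{\partial g_{ms}}{\partial x^j}-\frac{\partial g_{jm}}{\partial x^s}\right)$, $N^i_j=\gamma^i_{jm}y^m-C^i_{jm}\gamma^m_{rs}y^ry^s$, $\Gamma^i_{jk}=\gamma^i_{jk}-g^{li}\left(C_{jlr}N^r_k-C_{jkr}N^r_l+C_{lkr}N^r_j\right)$,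 $\frac{\delta}{\delta x^k}=\frac{\partial}{\partial x^k}-N^i_k\frac{\partial}{\partial y^i}$, $R_{j\,\,kl}^{\,\,\,i}=\frac{\delta\Gamma^i_{jl}}{\delta x^k}-\frac{\delta\Gamma^i_{jk}}{\delta x^l}+\Gamma^i_{hk}\Gamma^h_{jl}-\Gamma^i_{hl}\Gamma^h_{jk}$ (sums over repeated indices). These give the Chern connection, $\nabla^V_uW=\left(u(W^m)+u^iW^j\Gamma^m_{ij}(V)\right)\partial_{x^m}$; the covariant derivative along a curve $\gamma$ with reference field $\dot\gamma$, $D^{\dot\gamma}_{\dot\gamma}\zeta=\left(\dot\zeta^m+\zeta^i\dot\gamma^j\Gamma^m_{ij}(\dot\gamma)\right)\partial_{x^m}$; and the Chern curvature $R_v(\xi,\eta)\zeta=\xi^k\eta^l\zeta^jR_{j\,\,kl}^{\,\,\,i}(v)\partial_{x^i}$. A curve $\gamma:[0,\tau]\to M$ ($\tau>0$) is an $L$-geodesic if it is $C^2$, $\dot\gamma(t)\in A$ for all $t$, and $D^{\dot\gamma}_{\dot\gamma}\dot\gamma=0$. Let $P,Q\subset M$ be connected embedded $C^7$ submanifolds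 of dimensions less than $n$. Let $\gamma:[0,\tau]\to M$ be an $L$-geodesic with $\gamma(0)\in P$, $\gamma(\tau)\in Q$ which is perpendicular to $P$ and $Q$, i.e. $g_{\dot\gamma(0)}(u,\dot\gamma(0))=0$ for $u\in T_{\gamma(0)}P$ and $g_{\dot\gamma(\tau)}(u,\dot\gamma(\tau))=0$ for $u\in T_{\gamma(\tau)}Q$. Suppose that $g_{\dot\gamma(0)}$ is nondegenerate on $T_{\gamma(0)}P$ and $g_{\dot\gamma(\tau)}$ is nondegenerate on $T_{\gamma(\tau)}Q$, and that $L\circ\dot\gamma\neq0$ ($L\circ\dot\gamma$ is constant, so it suffices that it is nonzero at one time). For $v=\dot\gamma(0)$ let $\tilde S^P_v(u)={\rm tan}^P_v\big(\nabla^V_uV\big)$ $(u\in T_{\gamma(0)}P)$ be the shape operator, where $V$ is a local $A$-admissible extension of $v$ with $V(q)$ $g_{V(q)}$-orthogonal to $T_qP$ for $q\in P$, and ${\rm tan}^P_v$ is the $g_v$-orthogonal projection to $T_{\gamma(0)}P$; $\tilde S^Q_{\dot\gamma(\tau)}$ is defined likewise. Let $W^{1,2}_{P\times Q}(\gamma^*TM)$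 be the space of $W^{1,2}$ vector fields $V$ along $\gamma$ with $V(0)\in T_{\gamma(0)}P$, $V(\tau)\in T_{\gamma(\tau)}Q$, and on it let $$\mathbf I^\gamma_{P,Q}(V,W)=\int_0^\tau\Big(g_{\dot\gamma}(R_{\dot\gamma}(\dot\gamma,V)\dot\gamma,W)+g_{\dot\gamma}(D^{\dot\gamma}_{\dot\gamma}V,D^{\dot\gamma}_{\dot\gamma}W)\Big)dt+g_{\dot\gamma(0)}(\tilde S^P_{\dot\gamma(0)}(V(0)),W(0))-g_{\dot\gamma(\tau)}(\tilde S^Q_{\dot\gamma(\tau)}(V(\tau)),W(\tau)).$$ Put $\mathrm{tan}_\gamma(X)=\frac{g_{\dot\gamma}(X,\dot\gamma)}{g_{\dot\gamma}(\dot\gamma,\dot\gamma)}\dot\gamma$ and $\mathrm{nor}_\gamma(X)=X-\mathrm{tan}_\gamma(X)$, and let $\mathbf I^{\gamma,\perp}_{P,Q}$ be the restriction of $\mathbf I^\gamma_{P,Q}$ to $W^{1,2}_{P\times Q}(\gamma^*TM)^\perp=\{\mathrm{nor}_\gamma(X): X\in W^{1,2}_{P\times Q}(\gamma^*TM)\}$.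 The Morse index of a form is the maximal dimension (possibly $\infty$) of a linear subspace on which it is negative definite. **Proposition B.** (i) $\mathbf I^\gamma_{P,Q}(\mathrm{nor}_\gamma(V),\mathrm{tan}_\gamma(W))=0$ for all $V,W\in W^{1,2}_{P\times Q}(\gamma^*TM)$. (ii) ${\rm Ker}(\mathbf I^{\gamma,\perp}_{P,Q})={\rm Ker}(\mathbf I^\gamma_{P,Q})$. Moreover, if $g_{\dot\gamma(t)}$ is positive definite for some $t\in[0,\tau]$, then it is so for all $t\in[0,\tau]$, and ${\rm Index}(\mathbf I^{\gamma,\perp}_{P,Q})={\rm Index}(\mathbf I^\gamma_{P,Q})$. -/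

import Mathlib

open Set Filter Topology MeasureTheory Manifold
open scoped ContDiff

noncomputable section

namespace PseudoFinsler

/-! ## Coordinate expressions

Here `ℓ : ℝⁿ × ℝⁿ → ℝ`, `(x, y) ↦ ℓ (x, y)`, is the expression of a Lagrangian in the canonical
coordinates `(x, y)` of a tangent bundle. -/

section Coordinates

variable {n : ℕ}

/-- The `i`-th vector of the standard basis of `ℝⁿ`. -/
def stdVec (i : Fin n) : EuclideanSpace ℝ (Fin n) := EuclideanSpace.single i 1

/-- `∂f/∂xⁱ`. -/
def dx (f : EuclideanSpace ℝ (Fin n) × EuclideanSpace ℝ (Fin n) → ℝ) (i : Fin n)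
    (z : EuclideanSpace ℝ (Fin n) × EuclideanSpace ℝ (Fin n)) : ℝ :=
  fderiv ℝ f z (stdVec i, 0)

/-- `∂f/∂yⁱ`. -/
def dy (f : EuclideanSpace ℝ (Fin n) × EuclideanSpace ℝ (Fin n) → ℝ) (i : Fin n)
    (z : EuclideanSpace ℝ (Fin n) × EuclideanSpace ℝ (Fin n)) : ℝ :=
  fderiv ℝ f z (0, stdVec i)

variable (ℓ : EuclideanSpace ℝ (Fin n) × EuclideanSpace ℝ (Fin n) → ℝ)

/-- The components `g_{ij}` of the fundamental tensor. -/
def gLow (i j : Fin n) (z : EuclideanSpace ℝ (Fin n) × EuclideanSpace ℝ (Fin n)) : ℝ :=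
  (1 / 2) * dy (dy ℓ i) j z

/-- The entries `g^{ij}` of the inverse matrix of `(g_{ij})`. -/
def gUp (i j : Fin n) (z : EuclideanSpace ℝ (Fin n) × EuclideanSpace ℝ (Fin n)) : ℝ :=
  (Matrix.of fun a b : Fin n => gLow ℓ a b z)⁻¹ i j

/-- The components `C_{ijk}` of the Cartan tensor. -/
def cartanLow (i j k : Fin n) (z : EuclideanSpace ℝ (Fin n) × EuclideanSpace ℝ (Fin n)) : ℝ :=
  (1 / 4) * dy (dy (dy ℓ i) j) k z

/-- `C^i_{jm} = ∑ g^{il} C_{ljm}`. -/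
def cartanUp (i j m : Fin n) (z : EuclideanSpace ℝ (Fin n) × EuclideanSpace ℝ (Fin n)) : ℝ :=
  ∑ l, gUp ℓ i l z * cartanLow ℓ l j m z

/-- The formal Christoffel symbols `γ^i_{jm}`. -/
def formalChristoffel (i j m : Fin n)
    (z : EuclideanSpace ℝ (Fin n) × EuclideanSpace ℝ (Fin n)) : ℝ :=
  (1 / 2) * ∑ s, gUp ℓ i s z *
    (dx (gLow ℓ s j) m z + dx (gLow ℓ m s) j z - dx (gLow ℓ j m) s z)

/-- The nonlinear connection `N^i_j`. -/
def nonlinConn (i j : Fin n) (z : EuclideanSpace ℝ (Fin n) × EuclideanSpace ℝ (Fin n)) : ℝ :=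
  (∑ m, formalChristoffel ℓ i j m z * z.2 m) -
    ∑ m, ∑ r, ∑ s, cartanUp ℓ i j m z * formalChristoffel ℓ m r s z * z.2 r * z.2 s

/-- The Christoffel symbols `Γ^i_{jk}` of the Chern connection. -/
def chernGamma (i j k : Fin n) (z : EuclideanSpace ℝ (Fin n) × EuclideanSpace ℝ (Fin n)) : ℝ :=
  formalChristoffel ℓ i j k z -
    ∑ l, ∑ r, gUp ℓ l i z *
      (cartanLow ℓ j l r z * nonlinConn ℓ r k z - cartanLow ℓ j k r z * nonlinConn ℓ r l z +
        cartanLow ℓ l k r z * nonlinConn ℓ r j z)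

/-- The horizontal derivative `δf/δxᵏ = ∂f/∂xᵏ - ∑ N^i_k ∂f/∂yⁱ`. -/
def horDeriv (f : EuclideanSpace ℝ (Fin n) × EuclideanSpace ℝ (Fin n) → ℝ) (k : Fin n)
    (z : EuclideanSpace ℝ (Fin n) × EuclideanSpace ℝ (Fin n)) : ℝ :=
  dx f k z - ∑ i, nonlinConn ℓ i k z * dy f i z

/-- The components `R_j{}^i{}_{kl}` of the Chern curvature tensor. -/
def chernCurvCoeff (i j k l : Fin n)
    (z : EuclideanSpace ℝ (Fin n) × EuclideanSpace ℝ (Fin n)) : ℝ :=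
  horDeriv ℓ (chernGamma ℓ i j l) k z - horDeriv ℓ (chernGamma ℓ i j k) l z +
    (∑ h, chernGamma ℓ i h k z * chernGamma ℓ h j l z) -
    ∑ h, chernGamma ℓ i h l z * chernGamma ℓ h j k z

/-- `∑ uⁱ wʲ Γ^m_{ij}(z) ∂_m`. -/
def chernGammaVec (z : EuclideanSpace ℝ (Fin n) × EuclideanSpace ℝ (Fin n))
    (u w : EuclideanSpace ℝ (Fin n)) : EuclideanSpace ℝ (Fin n) :=
  WithLp.toLp 2 fun m => ∑ i, ∑ j, u i * w j * chernGamma ℓ m i j z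

/-- `R(ξ, η)ζ = ∑ ξᵏ ηˡ ζʲ R_j{}^i{}_{kl}(z) ∂_i`. -/
def chernCurvVec (z : EuclideanSpace ℝ (Fin n) × EuclideanSpace ℝ (Fin n))
    (ξ η ζ : EuclideanSpace ℝ (Fin n)) : EuclideanSpace ℝ (Fin n) :=
  WithLp.toLp 2 fun i => ∑ j, ∑ k, ∑ l, ξ k * η l * ζ j * chernCurvCoeff ℓ i j k l z

end Coordinates

/-! ## Pseudo-Finsler metrics on a manifold -/

section Manifold

variable {n : ℕ} {M : Type*} [TopologicalSpace M] [ChartedSpace (EuclideanSpace ℝ (Fin n)) M]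
  [IsManifold (𝓡 n) 7 M]

instance isManifold_one : IsManifold (𝓡 n) 1 M := IsManifold.of_le (n := 7) (by norm_cast)

/-- The fundamental tensor `g_v(u, w) = ½ ∂²/∂t∂s L(v + t u + s w)` at `t = s = 0`. -/
def fundTensor (L : TangentBundle (𝓡 n) M → ℝ) {p : M} (v u w : TangentSpace (𝓡 n) p) : ℝ :=
  (1 / 2) * deriv (fun t : ℝ => deriv (fun s : ℝ =>
    L (⟨p, v + t • u + s • w⟩ : TangentBundle (𝓡 n) M)) 0) 0

/-- `L` is a `C⁶` conic pseudo-Finsler metric with domain `A ⊆ TM ∖ 0`. -/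
structure IsPseudoFinslerMetric (A : Set (TangentBundle (𝓡 n) M))
    (L : TangentBundle (𝓡 n) M → ℝ) : Prop where
  isOpen : IsOpen A
  ne_zero : ∀ (p : M) (v : TangentSpace (𝓡 n) p), (⟨p, v⟩ : TangentBundle (𝓡 n) M) ∈ A → v ≠ 0
  proj_surj : ∀ p : M, ∃ v : TangentSpace (𝓡 n) p, (⟨p, v⟩ : TangentBundle (𝓡 n) M) ∈ A
  conic : ∀ (p : M) (v : TangentSpace (𝓡 n) p) (c : ℝ), 0 < c →
    (⟨p, v⟩ : TangentBundle (𝓡 n) M) ∈ A → (⟨p, c • v⟩ : TangentBundle (𝓡 n) M) ∈ A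
  contMDiffOn : ContMDiffOn (𝓡 n).tangent 𝓘(ℝ, ℝ) 6 L A
  homogeneous : ∀ (p : M) (v : TangentSpace (𝓡 n) p) (c : ℝ), 0 < c →
    (⟨p, v⟩ : TangentBundle (𝓡 n) M) ∈ A →
    L (⟨p, c • v⟩ : TangentBundle (𝓡 n) M) = c ^ 2 * L (⟨p, v⟩ : TangentBundle (𝓡 n) M)
  nondegenerate : ∀ (p : M) (v : TangentSpace (𝓡 n) p), (⟨p, v⟩ : TangentBundle (𝓡 n) M) ∈ A →
    ∀ u : TangentSpace (𝓡 n) p, (∀ w : TangentSpace (𝓡 n) p, fundTensor L v u w = 0) → u = 0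

/-! ### Local coordinates

Around `p` we use the chart of `M` at `p` and the canonical coordinates `(x, y)` of `TM` attached to
it, i.e. the chart of `TM` over `p`. All the tensorial objects below are independent of the chart. In
Mathlib `TangentSpace (𝓡 n) p` is the model space `ℝⁿ`, a tangent vector at `p` being identified
with its components in the chart at `p`, see `tangentCoord_self`. -/

/-- The position and the components `(x, y)` of a tangent vector, in the chart at `p`. -/
def tangentCoord (p : M) (v : TangentBundle (𝓡 n) M) :
    EuclideanSpace ℝ (Fin n) × EuclideanSpace ℝ (Fin n) :=
  extChartAt (𝓡 n).tangent (⟨p, 0⟩ : TangentBundle (𝓡 n) M) v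

theorem tangentCoord_self (p : M) (v : TangentSpace (𝓡 n) p) :
    tangentCoord p ⟨p, v⟩ = (extChartAt (𝓡 n) p p, v) :=
  Prod.ext rfl
    ((tangentBundleCore (𝓡 n) M).coordChange_self (achart _ p) p (mem_chart_source _ p) v)

/-- The expression of `L` in the canonical coordinates of `TM` attached to the chart at `p`. -/
def localLagrangian (L : TangentBundle (𝓡 n) M → ℝ) (p : M) :
    EuclideanSpace ℝ (Fin n) × EuclideanSpace ℝ (Fin n) → ℝ :=
  fun z => L ((extChartAt (𝓡 n).tangent (⟨p, 0⟩ : TangentBundle (𝓡 n) M)).symm z)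

/-- The Chern curvature `R_v(ξ, η)ζ`, for `v ∈ T_pM`. -/
def chernCurv (L : TangentBundle (𝓡 n) M → ℝ) {p : M} (v ξ η ζ : TangentSpace (𝓡 n) p) :
    TangentSpace (𝓡 n) p :=
  chernCurvVec (localLagrangian L p) (tangentCoord p ⟨p, v⟩) ξ η ζ

/-- The Chern connection `∇^v_u W` at `p` with reference vector `v ∈ T_pM`, for `u ∈ T_pM` and a
vector field `W` defined near `p`. -/
def chernNabla (L : TangentBundle (𝓡 n) M → ℝ) {p : M} (v u : TangentSpace (𝓡 n) p)
    (W : ∀ q : M, TangentSpace (𝓡 n) q) : TangentSpace (𝓡 n) p :=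
  (fderiv ℝ (fun x : EuclideanSpace ℝ (Fin n) =>
      (tangentCoord p ⟨(extChartAt (𝓡 n) p).symm x, W ((extChartAt (𝓡 n) p).symm x)⟩).2)
    (extChartAt (𝓡 n) p p) u : EuclideanSpace ℝ (Fin n)) +
  chernGammaVec (localLagrangian L p) (tangentCoord p ⟨p, v⟩) u (W p)

/-! ### Curves and vector fields along them

A curve `γ : [0, τ] → M` is a function `γ : ℝ → M` of which only the values on `[0, τ]` matter; a
vector field along it is a function on `ℝ` which, in the function spaces below, is required to
vanish outside `[0, τ]`. -/

/-- Vector fields along `γ`. -/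
abbrev FieldAlong (γ : ℝ → M) : Type := ∀ t : ℝ, TangentSpace (𝓡 n) (γ t)

/-- The velocity of `γ : [0, τ] → M`. -/
def velocity (τ : ℝ) (γ : ℝ → M) : FieldAlong (n := n) γ :=
  fun t => mfderivWithin 𝓘(ℝ, ℝ) (𝓡 n) γ (Icc 0 τ) t (1 : ℝ)

/-- The components of the field `ζ` along `γ`, in the chart at `p`. -/
def fieldCoord {γ : ℝ → M} (ζ : FieldAlong (n := n) γ) (p : M) (s : ℝ) :
    EuclideanSpace ℝ (Fin n) :=
  (tangentCoord p ⟨γ s, ζ s⟩).2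

/-- The covariant derivative `D^ξ_{γ̇} ζ` along `γ : [0, τ] → M` with reference field `ξ`, computed
at the time `t` in the chart at `γ t`. -/
def covDeriv (L : TangentBundle (𝓡 n) M → ℝ) (τ : ℝ) (γ : ℝ → M)
    (ξ ζ : FieldAlong (n := n) γ) : FieldAlong (n := n) γ :=
  fun t => (derivWithin (fieldCoord ζ (γ t)) (Icc 0 τ) t : EuclideanSpace ℝ (Fin n)) +
    chernGammaVec (localLagrangian L (γ t)) (tangentCoord (γ t) ⟨γ t, ξ t⟩)
      (ζ t) (velocity τ γ t)

/-- `γ : [0, τ] → M` is an `L`-geodesic: it is `C²`, `A`-admissible, and `D^{γ̇}_{γ̇} γ̇ = 0`. -/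
structure IsGeodesic (A : Set (TangentBundle (𝓡 n) M)) (L : TangentBundle (𝓡 n) M → ℝ)
    (τ : ℝ) (γ : ℝ → M) : Prop where
  contMDiffOn : ContMDiffOn 𝓘(ℝ, ℝ) (𝓡 n) 2 γ (Icc 0 τ)
  admissible : ∀ t ∈ Icc 0 τ, (⟨γ t, velocity τ γ t⟩ : TangentBundle (𝓡 n) M) ∈ A
  parallel : ∀ t ∈ Icc 0 τ, covDeriv L τ γ (velocity τ γ) (velocity τ γ) t = 0

/-- The space `W^{1,2}(γ^*TM)` of vector fields along `γ : [0, τ] → M`, a field being represented by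
its absolutely continuous representative: near each time `t₀`, its components in the chart at
`γ t₀` are the indefinite integral of a square integrable function. -/
def W12 (τ : ℝ) (γ : ℝ → M) : Set (FieldAlong (n := n) γ) :=
  {V | (∀ t, t ∉ Icc 0 τ → V t = 0) ∧
    ∀ t₀ ∈ Icc 0 τ, ∃ f : ℝ → EuclideanSpace ℝ (Fin n), MemLp f 2 volume ∧
      ∀ᶠ s in 𝓝[Icc 0 τ] t₀,
        fieldCoord V (γ t₀) s = fieldCoord V (γ t₀) t₀ + ∫ r in t₀..s, f r}

/-! ### Submanifolds and shape operators

A submanifold `P` of dimension `k` is a subset with a manifold structure for which the inclusion is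
an embedding. -/

section Submanifold

variable (k : ℕ) (P : Set M) [ChartedSpace (EuclideanSpace ℝ (Fin k)) P]

/-- The tangent space `T_pP ⊆ T_pM`. -/
def subTangent (p : P) : Submodule ℝ (TangentSpace (𝓡 n) (p : M)) :=
  LinearMap.range
    (mfderiv (𝓡 k) (𝓡 n) (Subtype.val : P → M) p).toLinearMap

/-- `v ∈ T_pM` belongs to the normal bundle `TP^⊥`: it lies in `A` and is `g_v`-orthogonal to
`T_pP`. -/
def IsNormal (A : Set (TangentBundle (𝓡 n) M)) (L : TangentBundle (𝓡 n) M → ℝ) (p : P)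
    (v : TangentSpace (𝓡 n) (p : M)) : Prop :=
  (⟨(p : M), v⟩ : TangentBundle (𝓡 n) M) ∈ A ∧ ∀ w ∈ subTangent k P p, fundTensor L v v w = 0

/-- `g_v` is nondegenerate on `T_pP`. -/
def NondegenerateOn (L : TangentBundle (𝓡 n) M → ℝ) (p : P)
    (v : TangentSpace (𝓡 n) (p : M)) : Prop :=
  ∀ u ∈ subTangent k P p, (∀ w ∈ subTangent k P p, fundTensor L v u w = 0) → u = 0

/-- `x` is the `g_v`-orthogonal projection `tan^P_v(∇^V_u V)` of `∇^V_u V` to `T_pP`, for some local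
`A`-admissible `C¹` extension `V` of `v` that is normal along `P`. -/
def IsShapeValue (A : Set (TangentBundle (𝓡 n) M)) (L : TangentBundle (𝓡 n) M → ℝ) (p : P)
    (v u x : TangentSpace (𝓡 n) (p : M)) : Prop :=
  x ∈ subTangent k P p ∧
    ∃ V : ∀ q : M, TangentSpace (𝓡 n) q,
      ContMDiffAt (𝓡 n) (𝓡 n).tangent 1 (fun q => (⟨q, V q⟩ : TangentBundle (𝓡 n) M)) (p : M) ∧
      V p = v ∧ (∀ᶠ q in 𝓝 (p : M), (⟨q, V q⟩ : TangentBundle (𝓡 n) M) ∈ A) ∧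
      (∀ᶠ q in 𝓝 p, IsNormal k P A L q (V q)) ∧
      ∀ w ∈ subTangent k P p, fundTensor L v (chernNabla L v u V - x) w = 0

open Classical in
/-- The normal second fundamental form (shape operator) `S̃^P_v(u)`, for `u ∈ T_pP`. If `v ∈ TP^⊥` and
`g_v` is nondegenerate on `T_pP`, then the value exists, is unique and does not depend on the
extension `V`. -/
def shapeOp (A : Set (TangentBundle (𝓡 n) M)) (L : TangentBundle (𝓡 n) M → ℝ) (p : P)
    (v u : TangentSpace (𝓡 n) (p : M)) : TangentSpace (𝓡 n) (p : M) :=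
  if h : ∃ x, IsShapeValue k P A L p v u x then h.choose else 0

end Submanifold

/-! ### The index form -/

section Index

variable (A : Set (TangentBundle (𝓡 n) M)) (L : TangentBundle (𝓡 n) M → ℝ) (τ : ℝ) (γ : ℝ → M)
  (k : ℕ) (P : Set M) [ChartedSpace (EuclideanSpace ℝ (Fin k)) P]
  (l : ℕ) (Q : Set M) [ChartedSpace (EuclideanSpace ℝ (Fin l)) Q]
  (h₀ : γ 0 ∈ P) (h₁ : γ τ ∈ Q)

/-- The space `W^{1,2}_{P×Q}(γ^*TM)`. -/
def W12PQ : Set (FieldAlong (n := n) γ) :=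
  {V | V ∈ W12 τ γ ∧ V 0 ∈ subTangent k P ⟨γ 0, h₀⟩ ∧ V τ ∈ subTangent l Q ⟨γ τ, h₁⟩}

/-- The `(P, Q)`-index form of `γ`. -/
def indexForm (V W : FieldAlong (n := n) γ) : ℝ :=
  (∫ t in (0 : ℝ)..τ,
    (fundTensor L (velocity τ γ t)
        (chernCurv L (velocity τ γ t) (velocity τ γ t) (V t) (velocity τ γ t)) (W t) +
      fundTensor L (velocity τ γ t)
        (covDeriv L τ γ (velocity τ γ) V t) (covDeriv L τ γ (velocity τ γ) W t))) +
  fundTensor L (velocity τ γ 0)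
    (shapeOp k P A L ⟨γ 0, h₀⟩ (velocity τ γ 0) (V 0)) (W 0) -
  fundTensor L (velocity τ γ τ)
    (shapeOp l Q A L ⟨γ τ, h₁⟩ (velocity τ γ τ) (V τ)) (W τ)

/-- The tangential part of a field along `γ`. -/
def tanPart (X : FieldAlong (n := n) γ) : FieldAlong (n := n) γ :=
  fun t => (fundTensor L (velocity τ γ t) (X t) (velocity τ γ t) /
    fundTensor L (velocity τ γ t) (velocity τ γ t) (velocity τ γ t)) • velocity τ γ t

/-- The normal part of a field along `γ`. -/
def norPart (X : FieldAlong (n := n) γ) : FieldAlong (n := n) γ :=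
  fun t => X t - tanPart L τ γ X t

/-- The space `W^{1,2}_{P×Q}(γ^*TM)^⊥` of the normal parts of the elements of
`W^{1,2}_{P×Q}(γ^*TM)`. -/
def W12PQNormal : Set (FieldAlong (n := n) γ) :=
  norPart L τ γ '' W12PQ τ γ k P l Q h₀ h₁

end Index

end Manifold

/-! ## Kernel and Morse index of a form on a linear space `S` of vectors -/

section Forms

variable {X : Type*} [AddCommGroup X] [Module ℝ X]

/-- The kernel of the restriction of `B` to `S`. -/
def formKer (B : X → X → ℝ) (S : Set X) : Set X := {V | V ∈ S ∧ ∀ W ∈ S, B V W = 0}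

/-- The Morse index of the restriction of `B` to `S`: the maximal dimension (possibly `∞`) of a
linear subspace of `S` on which `B` is negative definite. -/
def formIndex (B : X → X → ℝ) (S : Set X) : ℕ∞ :=
  ⨆ (N : Submodule ℝ X) (_ : FiniteDimensional ℝ N) (_ : (N : Set X) ⊆ S)
    (_ : ∀ Y ∈ N, Y ≠ 0 → B Y Y < 0), (Module.finrank ℝ N : ℕ∞)

end Forms

end PseudoFinsler

end

noncomputable section

namespace PseudoFinsler

/-! ## Calculus of coordinate functions -/

section CoordinateCalculus

variable {n : ℕ} {U : Set (EuclideanSpace ℝ (Fin n) × EuclideanSpace ℝ (Fin n))}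
  {f g : EuclideanSpace ℝ (Fin n) × EuclideanSpace ℝ (Fin n) → ℝ}
  {z : EuclideanSpace ℝ (Fin n) × EuclideanSpace ℝ (Fin n)}

/-! Along the geodesic, c = g_γ̇(γ̇, γ̇) = L(γ̇) is a nonzero constant, so a field splits as X = nor
X + hγ̇ with h = g_γ̇(X, γ̇)/c. As γ̇ is parallel, D(hγ̇) = h'γ̇, and d/dt g_γ̇(X, γ̇) = g_γ̇(DX,
γ̇); hence DX is perpendicular to γ̇ whenever X is. The mixed curvature terms vanish because
g_v(R_v(v, X)v, v) = 0 and R_v(v, hv) = 0. Perpendicularity to P and Q forces h to vanish at both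
ends, so the boundary terms only see nor X. This gives (i), and shows that the integrand at (X, X)
is the one at (nor X, nor X) plus c h'².

Kernel: pairing X with tan X gives c∫h'². If this is zero, then h is constant, hence zero, and X is
normal; conversely, (i) extends a kernel relation from normal test fields to all test fields. Index:
if g_γ̇ is positive definite then c > 0, so I(nor X, nor X) ≤ I(X, X), and the linear map nor
carries a negative definite subspace injectively onto a negative definite one. Positive definiteness
propagates because, for nondegenerate forms, it and its failure are both open conditions, and [0, τ]
is connected.

The Finsler input is obtained in canonical coordinates from Euler's identities: ℓ is horizontally
constant (`dx_lagrangian`), Γ contracted with y is N (`sum_chernGamma_mul_snd`), the connection is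
horizontally metric (`horDeriv_gLow_eq`), and commutators of horizontal derivatives kill ℓ, which is
the curvature identity (`sum_chernCurvCoeff_mul_snd_mul_dy`). The analytic input is that W^{1,2}
functions are local integrals of L² functions: they are differentiable almost everywhere, and
constant if ∫h'² = 0. Integrands are compared almost everywhere before integrating, so that
integrability of the index integrand never has to be established. -/

theorem sum_smul_stdVec (y : EuclideanSpace ℝ (Fin n)) : ∑ i, y i • stdVec i = y := by
  ext j
  simp [stdVec, Pi.single_apply]

theorem stdVec_apply (i j : Fin n) : stdVec i j = if j = i then (1 : ℝ) else 0 := by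
  simp [stdVec]

theorem fderiv_stdVec_zero (f : EuclideanSpace ℝ (Fin n) × EuclideanSpace ℝ (Fin n) → ℝ)
    (i : Fin n) (z : EuclideanSpace ℝ (Fin n) × EuclideanSpace ℝ (Fin n)) :
    fderiv ℝ f z (stdVec i, 0) = dx f i z := rfl

theorem fderiv_zero_stdVec (f : EuclideanSpace ℝ (Fin n) × EuclideanSpace ℝ (Fin n) → ℝ)
    (i : Fin n) (z : EuclideanSpace ℝ (Fin n) × EuclideanSpace ℝ (Fin n)) :
    fderiv ℝ f z (0, stdVec i) = dy f i z := rfl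

theorem fderiv_fst_zero (f : EuclideanSpace ℝ (Fin n) × EuclideanSpace ℝ (Fin n) → ℝ)
    (z : EuclideanSpace ℝ (Fin n) × EuclideanSpace ℝ (Fin n)) (u : EuclideanSpace ℝ (Fin n)) :
    fderiv ℝ f z (u, 0) = ∑ i, u i * dx f i z := by
  have : ((u, 0) : EuclideanSpace ℝ (Fin n) × EuclideanSpace ℝ (Fin n)) =
      ∑ i, u i • (stdVec i, 0) := by
    refine Prod.ext ?_ ?_
    · simp [Prod.fst_sum, sum_smul_stdVec]
    · simp [Prod.snd_sum]
  rw [this, map_sum]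
  exact Finset.sum_congr rfl fun i _ => map_smul _ _ _

theorem fderiv_zero_snd (f : EuclideanSpace ℝ (Fin n) × EuclideanSpace ℝ (Fin n) → ℝ)
    (z : EuclideanSpace ℝ (Fin n) × EuclideanSpace ℝ (Fin n)) (u : EuclideanSpace ℝ (Fin n)) :
    fderiv ℝ f z (0, u) = ∑ i, u i * dy f i z := by
  have : ((0, u) : EuclideanSpace ℝ (Fin n) × EuclideanSpace ℝ (Fin n)) =
      ∑ i, u i • (0, stdVec i) := by
    refine Prod.ext ?_ ?_
    · simp [Prod.fst_sum]
    · simp [Prod.snd_sum, sum_smul_stdVec]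
  rw [this, map_sum]
  exact Finset.sum_congr rfl fun i _ => map_smul _ _ _

theorem fderiv_prod_apply (f : EuclideanSpace ℝ (Fin n) × EuclideanSpace ℝ (Fin n) → ℝ)
    (z : EuclideanSpace ℝ (Fin n) × EuclideanSpace ℝ (Fin n)) (u w : EuclideanSpace ℝ (Fin n)) :
    fderiv ℝ f z (u, w) = (∑ i, u i * dx f i z) + ∑ i, w i * dy f i z := by
  rw [← fderiv_fst_zero, ← fderiv_zero_snd, ← map_add]
  simp

theorem contDiffOn_dx {m k : WithTop ℕ∞} (hU : IsOpen U) (hf : ContDiffOn ℝ k f U)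
    (hk : m + 1 ≤ k) (i : Fin n) : ContDiffOn ℝ m (dx f i) U :=
  (hf.fderiv_of_isOpen hU hk).clm_apply contDiffOn_const

theorem contDiffOn_dy {m k : WithTop ℕ∞} (hU : IsOpen U) (hf : ContDiffOn ℝ k f U)
    (hk : m + 1 ≤ k) (i : Fin n) : ContDiffOn ℝ m (dy f i) U :=
  (hf.fderiv_of_isOpen hU hk).clm_apply contDiffOn_const

theorem fderiv_congr_on (hU : IsOpen U) (h : ∀ z ∈ U, f z = g z) (hz : z ∈ U) :
    fderiv ℝ f z = fderiv ℝ g z :=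
  Filter.EventuallyEq.fderiv_eq (Filter.eventuallyEq_of_mem (hU.mem_nhds hz) h)

theorem fderiv_fderiv_comm (hU : IsOpen U) (hf : ContDiffOn ℝ 2 f U) (hz : z ∈ U)
    (a b : EuclideanSpace ℝ (Fin n) × EuclideanSpace ℝ (Fin n)) :
    fderiv ℝ (fun z => fderiv ℝ f z a) z b = fderiv ℝ (fun z => fderiv ℝ f z b) z a := by
  have hd : DifferentiableAt ℝ (fderiv ℝ f) z :=
    ((hf.fderiv_of_isOpen hU (m := 1) (by norm_num)).contDiffAt
      (hU.mem_nhds hz)).differentiableAt (by norm_num)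
  have key := (hf.contDiffAt (hU.mem_nhds hz)).isSymmSndFDerivAt (by simp)
  rw [fderiv_clm_apply hd (differentiableAt_const _),
    fderiv_clm_apply hd (differentiableAt_const _)]
  simpa using key b a

theorem fderiv_sum_mul {a b : Fin n → EuclideanSpace ℝ (Fin n) × EuclideanSpace ℝ (Fin n) → ℝ}
    (ha : ∀ i, DifferentiableAt ℝ (a i) z) (hb : ∀ i, DifferentiableAt ℝ (b i) z)
    (w : EuclideanSpace ℝ (Fin n) × EuclideanSpace ℝ (Fin n)) :
    fderiv ℝ (fun z => ∑ i, a i z * b i z) z w =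
      ∑ i, (fderiv ℝ (a i) z w * b i z + a i z * fderiv ℝ (b i) z w) := by
  rw [fderiv_fun_sum (A := fun i z => a i z * b i z) fun i _ => (ha i).mul (hb i), sum_apply]
  refine Finset.sum_congr rfl fun i _ => ?_
  rw [fderiv_fun_mul (ha i) (hb i)]
  simp
  ring

theorem hasFDerivAt_snd_coord (i : Fin n)
    (z : EuclideanSpace ℝ (Fin n) × EuclideanSpace ℝ (Fin n)) :
    HasFDerivAt (fun z : EuclideanSpace ℝ (Fin n) × EuclideanSpace ℝ (Fin n) => z.2 i)
      ((EuclideanSpace.proj (𝕜 := ℝ) i).comp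
        (ContinuousLinearMap.snd ℝ (EuclideanSpace ℝ (Fin n)) (EuclideanSpace ℝ (Fin n)))) z :=
  ((EuclideanSpace.proj (𝕜 := ℝ) i).comp
        (ContinuousLinearMap.snd ℝ (EuclideanSpace ℝ (Fin n)) (EuclideanSpace ℝ (Fin n)))).hasFDerivAt

theorem fderiv_snd_coord (i : Fin n)
    (z w : EuclideanSpace ℝ (Fin n) × EuclideanSpace ℝ (Fin n)) :
    fderiv ℝ (fun z : EuclideanSpace ℝ (Fin n) × EuclideanSpace ℝ (Fin n) => z.2 i) z w =
      w.2 i := by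
  rw [(hasFDerivAt_snd_coord i z).fderiv]
  rfl

theorem fderiv_sum_mul_coord
    {a : Fin n → EuclideanSpace ℝ (Fin n) × EuclideanSpace ℝ (Fin n) → ℝ}
    (ha : ∀ i, DifferentiableAt ℝ (a i) z)
    (w : EuclideanSpace ℝ (Fin n) × EuclideanSpace ℝ (Fin n)) :
    fderiv ℝ (fun z => ∑ i, a i z * z.2 i) z w =
      ∑ i, (fderiv ℝ (a i) z w * z.2 i + a i z * w.2 i) := by
  rw [fderiv_sum_mul ha fun i => (hasFDerivAt_snd_coord i z).differentiableAt]
  simp only [fderiv_snd_coord]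

theorem contDiff_snd_coord {m : WithTop ℕ∞} (i : Fin n) :
    ContDiff ℝ m (fun z : EuclideanSpace ℝ (Fin n) × EuclideanSpace ℝ (Fin n) => z.2 i) :=
  ((EuclideanSpace.proj (𝕜 := ℝ) i).comp
    (ContinuousLinearMap.snd ℝ (EuclideanSpace ℝ (Fin n)) (EuclideanSpace ℝ (Fin n)))).contDiff

/-- Cramer's rule: an entry of the inverse is a quotient of two determinants, which are polynomials
in the entries. -/
theorem contDiffOn_matrix_inv {m : WithTop ℕ∞} {E : Type*} [NormedAddCommGroup E]
    [NormedSpace ℝ E] {s : Set E} {B : E → Matrix (Fin n) (Fin n) ℝ}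
    (hB : ∀ i j, ContDiffOn ℝ m (fun z => B z i j) s) (hdet : ∀ z ∈ s, (B z).det ≠ 0)
    (i j : Fin n) : ContDiffOn ℝ m (fun z => (B z)⁻¹ i j) s := by
  have hd : ∀ B : E → Matrix (Fin n) (Fin n) ℝ, (∀ i j, ContDiffOn ℝ m (fun z => B z i j) s) →
      ContDiffOn ℝ m (fun z => (B z).det) s := by
    intro B hB
    simp only [Matrix.det_apply]
    exact ContDiffOn.sum fun σ _ => (contDiffOn_prod fun i _ => hB (σ i) i).const_smul _
  have h : ∀ z, (B z)⁻¹ i j =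
      ((B z).det)⁻¹ * ((B z).updateRow j (Pi.single i 1)).det := by
    intro z
    simp [Matrix.inv_def, Ring.inverse_eq_inv', Matrix.adjugate_apply]
  simp only [h]
  refine ((hd B hB).inv hdet).mul (hd _ fun a b => ?_)
  by_cases hab : a = j
  · subst hab
    simpa using contDiffOn_const
  · simpa [Matrix.updateRow_ne hab] using hB a b

end CoordinateCalculus

/-! ## The Chern connection in coordinates -/

section CoordinateFinsler

variable {n : ℕ}

/-- `ℓ` is the coordinate expression of a `C⁶` conic pseudo-Finsler metric with domain `U`. -/
structure IsLocalFinsler (ℓ : EuclideanSpace ℝ (Fin n) × EuclideanSpace ℝ (Fin n) → ℝ)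
    (U : Set (EuclideanSpace ℝ (Fin n) × EuclideanSpace ℝ (Fin n))) : Prop where
  isOpen : IsOpen U
  contDiffOn : ContDiffOn ℝ 6 ℓ U
  homogeneous : ∀ x y, ∀ c : ℝ, 0 < c → (x, y) ∈ U → ℓ (x, c • y) = c ^ 2 * ℓ (x, y)
  det_ne_zero : ∀ z ∈ U, (Matrix.of fun a b : Fin n => gLow ℓ a b z).det ≠ 0

variable {ℓ : EuclideanSpace ℝ (Fin n) × EuclideanSpace ℝ (Fin n) → ℝ}
  {U : Set (EuclideanSpace ℝ (Fin n) × EuclideanSpace ℝ (Fin n))}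
  {z : EuclideanSpace ℝ (Fin n) × EuclideanSpace ℝ (Fin n)}

/-- The horizontal lift of the `k`-th coordinate vector. -/
def horVec (ℓ : EuclideanSpace ℝ (Fin n) × EuclideanSpace ℝ (Fin n) → ℝ) (k : Fin n)
    (z : EuclideanSpace ℝ (Fin n) × EuclideanSpace ℝ (Fin n)) :
    EuclideanSpace ℝ (Fin n) × EuclideanSpace ℝ (Fin n) :=
  (stdVec k, -WithLp.toLp 2 fun i => nonlinConn ℓ i k z)

/-- As a directional derivative, `horDeriv` inherits the product rule and depends only on the germ
of f; identities valid on U may thus be differentiated horizontally. -/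
theorem horDeriv_eq_fderiv (f : EuclideanSpace ℝ (Fin n) × EuclideanSpace ℝ (Fin n) → ℝ)
    (k : Fin n) : horDeriv ℓ f k z = fderiv ℝ f z (horVec ℓ k z) := by
  rw [horVec, fderiv_prod_apply]
  simp [horDeriv, stdVec_apply, sub_eq_add_neg]

theorem nonlinConn_eq (i j : Fin n) : nonlinConn ℓ i j z =
    (∑ m, formalChristoffel ℓ i j m z * z.2 m) -
      ∑ m, cartanUp ℓ i j m z * ∑ r, ∑ s, formalChristoffel ℓ m r s z * z.2 r * z.2 s := by
  simp only [nonlinConn, Finset.mul_sum, mul_assoc]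

namespace IsLocalFinsler

variable (H : IsLocalFinsler ℓ U)

/-! ### Regularity: g is C⁴, and C, γ, N, Γ are C³. -/

section Smoothness

include H

theorem contDiffOn_dy_lagrangian (i : Fin n) : ContDiffOn ℝ 5 (dy ℓ i) U :=
  contDiffOn_dy H.isOpen H.contDiffOn (by norm_num) i

theorem contDiffOn_gLow (i j : Fin n) : ContDiffOn ℝ 4 (gLow ℓ i j) U :=
  contDiffOn_const.mul
    (contDiffOn_dy H.isOpen (H.contDiffOn_dy_lagrangian i) (by norm_num) j)

theorem contDiffOn_cartanLow (i j k : Fin n) : ContDiffOn ℝ 3 (cartanLow ℓ i j k) U :=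
  contDiffOn_const.mul (contDiffOn_dy H.isOpen
    (contDiffOn_dy H.isOpen (H.contDiffOn_dy_lagrangian i) (m := 4) (by norm_num) j)
    (by norm_num) k)

theorem contDiffOn_gUp (i j : Fin n) : ContDiffOn ℝ 4 (gUp ℓ i j) U :=
  contDiffOn_matrix_inv (fun a b => H.contDiffOn_gLow a b) H.det_ne_zero i j

theorem contDiffOn_formalChristoffel (i j m : Fin n) :
    ContDiffOn ℝ 3 (formalChristoffel ℓ i j m) U := by
  have hd : ∀ a b c, ContDiffOn ℝ 3 (dx (gLow ℓ a b) c) U := fun a b c =>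
    contDiffOn_dx H.isOpen (H.contDiffOn_gLow a b) (by norm_num) c
  exact contDiffOn_const.mul (ContDiffOn.sum fun s _ =>
    ((H.contDiffOn_gUp i s).of_le (by norm_num)).mul
      (((hd s j m).add (hd m s j)).sub (hd j m s)))

theorem contDiffOn_cartanUp (i j m : Fin n) : ContDiffOn ℝ 3 (cartanUp ℓ i j m) U :=
  ContDiffOn.sum fun l _ => ((H.contDiffOn_gUp i l).of_le (by norm_num)).mul
    (H.contDiffOn_cartanLow l j m)

theorem contDiffOn_nonlinConn (i j : Fin n) : ContDiffOn ℝ 3 (nonlinConn ℓ i j) U := by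
  refine ContDiffOn.sub (ContDiffOn.sum fun m _ => (H.contDiffOn_formalChristoffel i j m).mul
      (contDiff_snd_coord m).contDiffOn) ?_
  refine ContDiffOn.sum fun m _ => ContDiffOn.sum fun r _ => ContDiffOn.sum fun s _ => ?_
  exact (((H.contDiffOn_cartanUp i j m).mul (H.contDiffOn_formalChristoffel m r s)).mul
    (contDiff_snd_coord r).contDiffOn).mul (contDiff_snd_coord s).contDiffOn

theorem contDiffOn_chernGamma (i j k : Fin n) : ContDiffOn ℝ 3 (chernGamma ℓ i j k) U := by
  refine (H.contDiffOn_formalChristoffel i j k).sub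
    (ContDiffOn.sum fun l _ => ContDiffOn.sum fun r _ => ?_)
  have h : ∀ a b c d e, ContDiffOn ℝ 3
      (fun z => cartanLow ℓ a b c z * nonlinConn ℓ d e z) U := fun a b c d e =>
    (H.contDiffOn_cartanLow a b c).mul (H.contDiffOn_nonlinConn d e)
  exact ((H.contDiffOn_gUp l i).of_le (by norm_num)).mul
    (((h j l r r k).sub (h j k r r l)).add (h l k r r j))

variable (hz : z ∈ U)
include hz

theorem differentiableAt_of_contDiffOn
    {f : EuclideanSpace ℝ (Fin n) × EuclideanSpace ℝ (Fin n) → ℝ} {m : WithTop ℕ∞}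
    (hf : ContDiffOn ℝ m f U) (hm : m ≠ 0) : DifferentiableAt ℝ f z :=
  (hf.contDiffAt (H.isOpen.mem_nhds hz)).differentiableAt hm

theorem differentiableAt_dy_lagrangian (i : Fin n) : DifferentiableAt ℝ (dy ℓ i) z :=
  H.differentiableAt_of_contDiffOn hz (H.contDiffOn_dy_lagrangian i) (by norm_num)

theorem differentiableAt_gLow (i j : Fin n) : DifferentiableAt ℝ (gLow ℓ i j) z :=
  H.differentiableAt_of_contDiffOn hz (H.contDiffOn_gLow i j) (by norm_num)

theorem dy_gLow (i j k : Fin n) : dy (gLow ℓ i j) k z = 2 * cartanLow ℓ i j k z := by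
  have hd : DifferentiableAt ℝ (dy (dy ℓ i) j) z :=
    H.differentiableAt_of_contDiffOn hz (contDiffOn_dy (m := 4) H.isOpen
      (H.contDiffOn_dy_lagrangian i) (by norm_num) j) (by norm_num)
  have : gLow ℓ i j = fun z => (1 / 2) * dy (dy ℓ i) j z := rfl
  rw [this, dy, fderiv_const_mul hd, cartanLow]
  simp only [smul_apply, smul_eq_mul, fderiv_zero_stdVec]
  ring

theorem gLow_symm (i j : Fin n) : gLow ℓ i j z = gLow ℓ j i z := by
  rw [gLow, gLow]
  congr 1
  exact fderiv_fderiv_comm H.isOpen (H.contDiffOn.of_le (by norm_num)) hz _ _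

end Smoothness

/-! ### Symmetries of g and C, and Euler's identities. -/

section Euler

include H
variable (hz : z ∈ U)
include hz

theorem gUp_symm (i j : Fin n) : gUp ℓ i j z = gUp ℓ j i z := by
  have h : (Matrix.of fun a b : Fin n => gLow ℓ a b z).transpose =
      Matrix.of fun a b : Fin n => gLow ℓ a b z := by
    ext a b
    exact H.gLow_symm hz b a
  have := congrFun (congrFun (Matrix.transpose_nonsing_inv
    (Matrix.of fun a b : Fin n => gLow ℓ a b z)) j) i
  rw [h] at this
  exact this

theorem sum_gLow_mul_gUp (i j : Fin n) :
    ∑ s, gLow ℓ i s z * gUp ℓ s j z = if i = j then 1 else 0 := by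
  have := congrFun (congrFun (Matrix.mul_nonsing_inv
    (Matrix.of fun a b : Fin n => gLow ℓ a b z) (H.det_ne_zero z hz).isUnit) i) j
  rw [Matrix.mul_apply, Matrix.one_apply] at this
  exact this

theorem lower_raise (a : Fin n → ℝ) (s : Fin n) :
    ∑ i, gLow ℓ s i z * ∑ t, gUp ℓ i t z * a t = a s := by
  have : ∀ t, ∑ i, gLow ℓ s i z * (gUp ℓ i t z * a t) = (if s = t then 1 else 0) * a t := by
    intro t
    rw [← H.sum_gLow_mul_gUp hz, Finset.sum_mul]
    simp only [mul_assoc]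
  simp only [Finset.mul_sum]
  rw [Finset.sum_comm]
  simp [this]

theorem dx_gLow_symm (i j k : Fin n) : dx (gLow ℓ i j) k z = dx (gLow ℓ j i) k z := by
  rw [dx, dx, fderiv_congr_on H.isOpen (fun w hw => H.gLow_symm hw i j) hz]

theorem dy_gLow_symm (i j k : Fin n) : dy (gLow ℓ i j) k z = dy (gLow ℓ j i) k z := by
  rw [dy, dy, fderiv_congr_on H.isOpen (fun w hw => H.gLow_symm hw i j) hz]

/-- The y-derivative of the symmetry of g. Together with `cartanLow_symm'` it makes C totally
symmetric. -/
theorem cartanLow_symm (i j k : Fin n) : cartanLow ℓ i j k z = cartanLow ℓ j i k z := by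
  have := H.dy_gLow_symm hz i j k
  rw [H.dy_gLow hz, H.dy_gLow hz] at this
  linarith

theorem cartanLow_symm' (i j k : Fin n) : cartanLow ℓ i j k z = cartanLow ℓ i k j z := by
  rw [cartanLow, cartanLow]
  congr 1
  exact fderiv_fderiv_comm H.isOpen ((H.contDiffOn_dy_lagrangian i).of_le (by norm_num)) hz _ _

/-- Differentiate c ↦ ℓ(x, cy) = c²ℓ(x, y) at c = 1. The further contraction identities below are x-
and y-derivatives of this one. -/
theorem euler : ∑ i, dy ℓ i z * z.2 i = 2 * ℓ z := by
  obtain ⟨x, y⟩ := z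
  have h1 : HasDerivAt (fun c : ℝ => ℓ (x, c • y)) (fderiv ℝ ℓ (x, y) (0, y)) 1 := by
    have hf : HasFDerivAt ℓ (fderiv ℝ ℓ (x, y)) (x, (1 : ℝ) • y) := by
      rw [one_smul]
      exact (H.differentiableAt_of_contDiffOn hz H.contDiffOn (by norm_num)).hasFDerivAt
    have hc : HasDerivAt (fun c : ℝ => (x, c • y)) (0, (1 : ℝ) • y) 1 :=
      (hasDerivAt_const _ _).prodMk ((hasDerivAt_id (1 : ℝ)).smul_const y)
    have := hf.comp_hasDerivAt (1 : ℝ) hc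
    rwa [one_smul] at this
  have h2 : HasDerivAt (fun c : ℝ => ℓ (x, c • y)) (2 * ℓ (x, y)) 1 := by
    have h3 : HasDerivAt (fun c : ℝ => c ^ 2 * ℓ (x, y)) (2 * ℓ (x, y)) 1 := by
      simpa using (hasDerivAt_pow 2 (1 : ℝ)).mul_const (ℓ (x, y))
    refine h3.congr_of_eventuallyEq ?_
    filter_upwards [lt_mem_nhds (zero_lt_one (α := ℝ))] with c hc
    exact H.homogeneous x y c hc hz
  rw [← h1.unique h2, fderiv_zero_snd]
  exact Finset.sum_congr rfl fun i _ => mul_comm _ _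

theorem sum_gLow_mul_snd (j : Fin n) : ∑ i, gLow ℓ j i z * z.2 i = (1 / 2) * dy ℓ j z := by
  have h := congrArg (fun T => T (0, stdVec j))
    (fderiv_congr_on H.isOpen (fun w hw => H.euler hw) hz)
  simp only at h
  rw [fderiv_sum_mul_coord fun i => H.differentiableAt_dy_lagrangian hz i,
    fderiv_const_mul (H.differentiableAt_of_contDiffOn hz H.contDiffOn (by norm_num)),
    Finset.sum_add_distrib] at h
  have h1 : ∑ i, dy ℓ i z * stdVec j i = dy ℓ j z := by simp [stdVec_apply]
  have h2 : ∑ i, gLow ℓ j i z * z.2 i =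
      (1 / 2) * ∑ i, fderiv ℝ (dy ℓ i) z (0, stdVec j) * z.2 i := by
    rw [Finset.mul_sum]
    refine Finset.sum_congr rfl fun i _ => ?_
    rw [H.gLow_symm hz, gLow, dy]
    ring
  simp only [smul_apply, smul_eq_mul] at h
  rw [h2]
  rw [h1] at h
  rw [eq_sub_of_add_eq h, dy]
  ring

theorem sum_dx_gLow_mul_snd (j k : Fin n) :
    ∑ i, dx (gLow ℓ j i) k z * z.2 i = (1 / 2) * dx (dy ℓ j) k z := by
  have h := congrArg (fun T => T (stdVec k, 0))
    (fderiv_congr_on H.isOpen (fun w hw => H.sum_gLow_mul_snd hw j) hz)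
  simp only at h
  rw [fderiv_sum_mul_coord fun i => H.differentiableAt_gLow hz j i,
    fderiv_const_mul (H.differentiableAt_dy_lagrangian hz j)] at h
  simpa [dx] using h

theorem sum_dx_gLow_mul_snd_mul_snd (k : Fin n) :
    ∑ j, ∑ i, dx (gLow ℓ j i) k z * z.2 i * z.2 j = dx ℓ k z := by
  have h := congrArg (fun T => T (stdVec k, 0))
    (fderiv_congr_on H.isOpen (fun w hw => H.euler hw) hz)
  simp only at h
  rw [fderiv_sum_mul_coord fun i => H.differentiableAt_dy_lagrangian hz i,
    fderiv_const_mul (H.differentiableAt_of_contDiffOn hz H.contDiffOn (by norm_num))] at h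
  simp only [PiLp.zero_apply, mul_zero, add_zero, smul_apply,
    smul_eq_mul, fderiv_stdVec_zero] at h
  have h1 : ∀ j, ∑ i, dx (gLow ℓ j i) k z * z.2 i * z.2 j =
      (1 / 2) * (dx (dy ℓ j) k z * z.2 j) := fun j => by
    rw [← Finset.sum_mul, H.sum_dx_gLow_mul_snd hz, mul_assoc]
  rw [Finset.sum_congr rfl fun j _ => h1 j, ← Finset.mul_sum, h]
  ring

/-- Differentiating g_{ji}yⁱ = ½ℓ_{yʲ} in yᵏ gives 2C_{jik}yⁱ + g_{jk} = g_{jk}. -/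
theorem sum_cartanLow_mul_snd (j k : Fin n) : ∑ i, cartanLow ℓ j k i z * z.2 i = 0 := by
  have h := congrArg (fun T => T (0, stdVec k))
    (fderiv_congr_on H.isOpen (fun w hw => H.sum_gLow_mul_snd hw j) hz)
  simp only at h
  rw [fderiv_sum_mul_coord fun i => H.differentiableAt_gLow hz j i,
    fderiv_const_mul (H.differentiableAt_dy_lagrangian hz j), Finset.sum_add_distrib] at h
  simp only [fderiv_zero_stdVec, H.dy_gLow hz, smul_apply, smul_eq_mul] at h
  have h1 : ∑ i, gLow ℓ j i z * stdVec k i = gLow ℓ j k z := by simp [stdVec_apply]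
  have h3 : (1 / 2) * dy (dy ℓ j) k z = gLow ℓ j k z := rfl
  rw [h1, h3, add_eq_right] at h
  have h2 : ∑ i, cartanLow ℓ j k i z * z.2 i =
      (1 / 2) * ∑ i, 2 * cartanLow ℓ j i k z * z.2 i := by
    rw [Finset.mul_sum]
    refine Finset.sum_congr rfl fun i _ => ?_
    rw [H.cartanLow_symm' hz]
    ring
  rw [h2, h, mul_zero]

/-- Contraction of an upper index with `∂ℓ/∂y`. -/
theorem sum_dy_mul_raise (a : Fin n → ℝ) :
    ∑ i, dy ℓ i z * ∑ t, gUp ℓ i t z * a t = 2 * ∑ s, z.2 s * a s := by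
  have h : ∀ i, dy ℓ i z = 2 * ∑ s, gLow ℓ i s z * z.2 s := fun i => by
    rw [H.sum_gLow_mul_snd hz]; ring
  simp only [h, mul_assoc, ← Finset.mul_sum]
  congr 1
  simp only [Finset.sum_mul]
  rw [Finset.sum_comm]
  refine Finset.sum_congr rfl fun s _ => ?_
  rw [← H.lower_raise hz a s, Finset.mul_sum]
  refine Finset.sum_congr rfl fun i _ => ?_
  rw [H.gLow_symm hz i s]
  ring

end Euler

/-! ### Contractions of N, Γ and the curvature with y and ∂ℓ/∂y. -/

section Connection

include H
variable (hz : z ∈ U)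
include hz

theorem formalChristoffel_symm (i j k : Fin n) :
    formalChristoffel ℓ i j k z = formalChristoffel ℓ i k j z := by
  rw [formalChristoffel, formalChristoffel]
  congr 1
  refine Finset.sum_congr rfl fun s _ => ?_
  rw [H.dx_gLow_symm hz s j, H.dx_gLow_symm hz k s, H.dx_gLow_symm hz j k]
  ring

theorem sum_dy_mul_formalChristoffel (j m : Fin n) :
    ∑ i, dy ℓ i z * formalChristoffel ℓ i j m z =
      ∑ s, z.2 s * (dx (gLow ℓ s j) m z + dx (gLow ℓ m s) j z - dx (gLow ℓ j m) s z) := by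
  have := H.sum_dy_mul_raise hz
    fun s => dx (gLow ℓ s j) m z + dx (gLow ℓ m s) j z - dx (gLow ℓ j m) s z
  simp only [formalChristoffel, mul_left_comm (dy ℓ _ z), ← Finset.mul_sum]
  rw [this]
  ring

theorem sum_dy_mul_cartanUp (j m : Fin n) : ∑ i, dy ℓ i z * cartanUp ℓ i j m z = 0 := by
  have := H.sum_dy_mul_raise hz fun s => cartanLow ℓ s j m z
  simp only [cartanUp]
  rw [this]
  have h2 : ∀ s, z.2 s * cartanLow ℓ s j m z = cartanLow ℓ j m s z * z.2 s := fun s => by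
    rw [H.cartanLow_symm hz, H.cartanLow_symm' hz, mul_comm]
  simp only [h2, H.sum_cartanLow_mul_snd hz, mul_zero]

/-- The Lagrangian is horizontally constant. -/
theorem dx_lagrangian (k : Fin n) : dx ℓ k z = ∑ i, nonlinConn ℓ i k z * dy ℓ i z := by
  have h1 : ∑ i, nonlinConn ℓ i k z * dy ℓ i z =
      (∑ m, (∑ i, dy ℓ i z * formalChristoffel ℓ i k m z) * z.2 m) -
      ∑ m, (∑ i, dy ℓ i z * cartanUp ℓ i k m z) *
        ∑ r, ∑ s, formalChristoffel ℓ m r s z * z.2 r * z.2 s := by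
    simp only [nonlinConn_eq, sub_mul, Finset.sum_sub_distrib, Finset.sum_mul]
    congr 1
    · rw [Finset.sum_comm]
      exact Finset.sum_congr rfl fun _ _ => Finset.sum_congr rfl fun _ _ => by ring
    · rw [Finset.sum_comm]
      exact Finset.sum_congr rfl fun _ _ => Finset.sum_congr rfl fun _ _ => by
        simp only [Finset.mul_sum, Finset.sum_mul]
        exact Finset.sum_congr rfl fun _ _ => Finset.sum_congr rfl fun _ _ => by ring
  simp only [h1, H.sum_dy_mul_cartanUp hz, H.sum_dy_mul_formalChristoffel hz, zero_mul,
    Finset.sum_const_zero, sub_zero, Finset.sum_mul]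
  -- Contracted with yˢyᵐ, the first and third terms of the formal Christoffel symbol cancel after
  -- exchanging s and m; the middle one is ∂ℓ/∂xᵏ.
  have h2 : ∑ m, ∑ s, z.2 s * dx (gLow ℓ s k) m z * z.2 m =
      ∑ m, ∑ s, z.2 s * dx (gLow ℓ k m) s z * z.2 m := by
    rw [Finset.sum_comm]
    refine Finset.sum_congr rfl fun s _ => Finset.sum_congr rfl fun m _ => ?_
    rw [H.dx_gLow_symm hz s k]
    ring
  simp only [mul_add, mul_sub, add_mul, sub_mul, Finset.sum_add_distrib, Finset.sum_sub_distrib]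
  rw [h2, ← H.sum_dx_gLow_mul_snd_mul_snd hz]
  simp only [add_sub_cancel_left]
  exact Finset.sum_congr rfl fun _ _ => Finset.sum_congr rfl fun _ _ => by ring

/-- The Cartan correction in N is killed by contraction with y. -/
theorem sum_nonlinConn_mul_snd (i : Fin n) : ∑ j, nonlinConn ℓ i j z * z.2 j =
    ∑ r, ∑ s, formalChristoffel ℓ i r s z * z.2 r * z.2 s := by
  have h0 : ∀ m, ∑ j, cartanUp ℓ i j m z * z.2 j = 0 := by
    intro m
    simp only [cartanUp, Finset.sum_mul]
    rw [Finset.sum_comm]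
    refine Finset.sum_eq_zero fun l _ => ?_
    simp only [mul_assoc, ← Finset.mul_sum]
    have : ∀ j, cartanLow ℓ l j m z = cartanLow ℓ l m j z := fun j => H.cartanLow_symm' hz l j m
    simp only [this, H.sum_cartanLow_mul_snd hz, mul_zero]
  simp only [nonlinConn_eq, sub_mul, Finset.sum_sub_distrib]
  have h1 : ∑ j, (∑ m, cartanUp ℓ i j m z *
      ∑ r, ∑ s, formalChristoffel ℓ m r s z * z.2 r * z.2 s) * z.2 j =
      ∑ m, (∑ j, cartanUp ℓ i j m z * z.2 j) *
        ∑ r, ∑ s, formalChristoffel ℓ m r s z * z.2 r * z.2 s := by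
    simp only [Finset.sum_mul (s := Finset.univ (α := Fin n)) (f := fun m => cartanUp ℓ i _ m z * _)]
    rw [Finset.sum_comm]
    refine Finset.sum_congr rfl fun m _ => ?_
    rw [Finset.sum_mul]
    exact Finset.sum_congr rfl fun j _ => by ring
  rw [h1]
  simp only [h0, zero_mul, Finset.sum_const_zero, sub_zero, Finset.sum_mul]
  exact Finset.sum_congr rfl fun _ _ => Finset.sum_congr rfl fun _ _ => by ring

/-- Two of the three Cartan terms of Γ die on contraction with y. In the third, Nʳ_j yʲ =
γʳ_{ab}yᵃyᵇ by `sum_nonlinConn_mul_snd`, which reproduces the correction term in N. -/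
theorem sum_chernGamma_mul_snd (i k : Fin n) :
    ∑ j, chernGamma ℓ i j k z * z.2 j = nonlinConn ℓ i k z := by
  have h0 : ∀ a b, ∑ j, cartanLow ℓ j a b z * z.2 j = 0 := fun a b => by
    rw [← H.sum_cartanLow_mul_snd hz a b]
    exact Finset.sum_congr rfl fun j _ => by rw [H.cartanLow_symm hz, H.cartanLow_symm' hz]
  have h1 : ∑ j, (∑ l, ∑ r, gUp ℓ l i z *
      (cartanLow ℓ j l r z * nonlinConn ℓ r k z - cartanLow ℓ j k r z * nonlinConn ℓ r l z +
        cartanLow ℓ l k r z * nonlinConn ℓ r j z)) * z.2 j =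
      ∑ l, ∑ r, gUp ℓ l i z * ((∑ j, cartanLow ℓ j l r z * z.2 j) * nonlinConn ℓ r k z -
        (∑ j, cartanLow ℓ j k r z * z.2 j) * nonlinConn ℓ r l z +
        cartanLow ℓ l k r z * ∑ j, nonlinConn ℓ r j z * z.2 j) := by
    simp only [Finset.sum_mul, Finset.mul_sum]
    rw [Finset.sum_comm]
    refine Finset.sum_congr rfl fun l _ => ?_
    rw [Finset.sum_comm]
    refine Finset.sum_congr rfl fun r _ => ?_
    rw [← Finset.sum_sub_distrib, ← Finset.sum_add_distrib, Finset.mul_sum]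
    exact Finset.sum_congr rfl fun j _ => by ring
  simp only [chernGamma, sub_mul, Finset.sum_sub_distrib]
  rw [h1, nonlinConn_eq]
  simp only [h0, zero_mul, sub_zero, zero_add, H.sum_nonlinConn_mul_snd hz]
  congr 1
  · exact Finset.sum_congr rfl fun j _ => by rw [H.formalChristoffel_symm hz]
  · simp only [cartanUp, Finset.sum_mul]
    rw [Finset.sum_comm]
    refine Finset.sum_congr rfl fun r _ => Finset.sum_congr rfl fun l _ => ?_
    rw [H.gUp_symm hz]
    ring

theorem horDeriv_gLow (i j k : Fin n) : horDeriv ℓ (gLow ℓ i j) k z =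
    dx (gLow ℓ i j) k z - 2 * ∑ r, cartanLow ℓ i j r z * nonlinConn ℓ r k z := by
  rw [horDeriv, Finset.mul_sum]
  congr 1
  exact Finset.sum_congr rfl fun r _ => by rw [H.dy_gLow hz]; ring

/-- Koszul's formula with δ/δx in place of ∂/∂x: the Cartan terms of Γ are exactly the vertical
parts of the horizontal derivatives of g. -/
theorem sum_gLow_mul_chernGamma (s j k : Fin n) :
    ∑ i, gLow ℓ s i z * chernGamma ℓ i j k z = (1 / 2) * (horDeriv ℓ (gLow ℓ s j) k z +
      horDeriv ℓ (gLow ℓ k s) j z - horDeriv ℓ (gLow ℓ j k) s z) := by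
  have h : ∀ i, chernGamma ℓ i j k z = ∑ t, gUp ℓ i t z *
      ((1 / 2) * (dx (gLow ℓ t j) k z + dx (gLow ℓ k t) j z - dx (gLow ℓ j k) t z) -
        ∑ r, (cartanLow ℓ j t r z * nonlinConn ℓ r k z - cartanLow ℓ j k r z * nonlinConn ℓ r t z +
        cartanLow ℓ t k r z * nonlinConn ℓ r j z)) := by
    intro i
    simp only [mul_sub (gUp ℓ i _ z), Finset.sum_sub_distrib (s := Finset.univ)
      (f := fun t => gUp ℓ i t z * _)]
    rw [chernGamma, formalChristoffel]
    congr 1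
    · rw [Finset.mul_sum]
      exact Finset.sum_congr rfl fun t _ => by ring
    · refine Finset.sum_congr rfl fun t _ => ?_
      rw [← Finset.mul_sum, H.gUp_symm hz]
  simp only [h]
  rw [H.lower_raise hz]
  simp only [H.horDeriv_gLow hz, Finset.sum_add_distrib, Finset.sum_sub_distrib,
    H.cartanLow_symm hz j s, H.cartanLow_symm hz s k]
  ring

theorem horDeriv_gLow_symm (i j k : Fin n) :
    horDeriv ℓ (gLow ℓ i j) k z = horDeriv ℓ (gLow ℓ j i) k z := by
  rw [horDeriv_eq_fderiv, horDeriv_eq_fderiv,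
    fderiv_congr_on H.isOpen (fun w hw => H.gLow_symm hw i j) hz]

/-- The Chern connection is horizontally metric. -/
theorem horDeriv_gLow_eq (i j k : Fin n) : horDeriv ℓ (gLow ℓ i j) k z =
    (∑ h, gLow ℓ j h z * chernGamma ℓ h i k z) + ∑ h, gLow ℓ i h z * chernGamma ℓ h j k z := by
  rw [H.sum_gLow_mul_chernGamma hz, H.sum_gLow_mul_chernGamma hz, H.horDeriv_gLow_symm hz j i,
    H.horDeriv_gLow_symm hz k j, H.horDeriv_gLow_symm hz k i]
  ring

/-- Horizontal derivative of Nⁱ_l = Γⁱ_{jl}yʲ, using δyᵐ/δxᵏ = -Nᵐ_k. -/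
theorem horDeriv_nonlinConn (i l k : Fin n) : horDeriv ℓ (nonlinConn ℓ i l) k z =
    (∑ j, horDeriv ℓ (chernGamma ℓ i j l) k z * z.2 j) -
      ∑ m, chernGamma ℓ i m l z * nonlinConn ℓ m k z := by
  rw [horDeriv_eq_fderiv,
    ← fderiv_congr_on H.isOpen (fun w hw => H.sum_chernGamma_mul_snd hw i l) hz,
    fderiv_sum_mul_coord fun j => H.differentiableAt_of_contDiffOn hz
      (H.contDiffOn_chernGamma i j l) (by norm_num), Finset.sum_add_distrib, sub_eq_add_neg,
    ← Finset.sum_neg_distrib]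
  simp only [horDeriv_eq_fderiv]
  congr 1
  exact Finset.sum_congr rfl fun m _ => by simp [horVec]

/-- The ΓΓ terms become ΓN terms and are absorbed by `horDeriv_nonlinConn`. What remains is the
curvature of the nonlinear connection. -/
theorem sum_chernCurvCoeff_mul_snd (i k l : Fin n) :
    ∑ j, chernCurvCoeff ℓ i j k l z * z.2 j =
      horDeriv ℓ (nonlinConn ℓ i l) k z - horDeriv ℓ (nonlinConn ℓ i k) l z := by
  have h : ∀ k l, ∑ j, (∑ h, chernGamma ℓ i h k z * chernGamma ℓ h j l z) * z.2 j =
      ∑ h, chernGamma ℓ i h k z * nonlinConn ℓ h l z := by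
    intro k l
    simp only [Finset.sum_mul]
    rw [Finset.sum_comm]
    refine Finset.sum_congr rfl fun h _ => ?_
    simp only [mul_assoc, ← Finset.mul_sum, H.sum_chernGamma_mul_snd hz]
  simp only [chernCurvCoeff, sub_mul, add_mul, Finset.sum_sub_distrib, Finset.sum_add_distrib, h,
    H.horDeriv_nonlinConn hz]
  ring

/-- Horizontal derivative of ℓ_{xᵏ} = Nⁱ_k ℓ_{yⁱ}. By equality of mixed partials the right-hand side
is symmetric in k and l, which is what the next lemma exploits. -/
theorem sum_dy_mul_horDeriv_nonlinConn (k l : Fin n) :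
    ∑ i, horDeriv ℓ (nonlinConn ℓ i k) l z * dy ℓ i z =
      dx (dx ℓ k) l z - (∑ j, nonlinConn ℓ j l z * dy (dx ℓ k) j z) -
        (∑ j, nonlinConn ℓ j k z * dx (dy ℓ j) l z) +
          ∑ i, ∑ j, nonlinConn ℓ i k z * nonlinConn ℓ j l z * dy (dy ℓ i) j z := by
  have h : horDeriv ℓ (dx ℓ k) l z =
      (∑ i, horDeriv ℓ (nonlinConn ℓ i k) l z * dy ℓ i z) +
        ∑ i, nonlinConn ℓ i k z * horDeriv ℓ (dy ℓ i) l z := by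
    rw [horDeriv_eq_fderiv, fderiv_congr_on H.isOpen (fun w hw => H.dx_lagrangian hw k) hz,
      fderiv_sum_mul (fun i => H.differentiableAt_of_contDiffOn hz
        (H.contDiffOn_nonlinConn i k) (by norm_num))
        (fun i => H.differentiableAt_dy_lagrangian hz i), Finset.sum_add_distrib]
    simp only [horDeriv_eq_fderiv]
  rw [← sub_eq_of_eq_add h]
  simp only [horDeriv, mul_sub, Finset.sum_sub_distrib, Finset.mul_sum, mul_assoc]
  ring

/-- The commutator of δ/δxᵏ and δ/δxˡ is vertical, its components being the curvature of N up to
sign, and it annihilates ℓ because each horizontal derivative of ℓ is zero. -/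
theorem sum_chernCurvCoeff_mul_snd_mul_dy (k l : Fin n) :
    ∑ i, (∑ j, chernCurvCoeff ℓ i j k l z * z.2 j) * dy ℓ i z = 0 := by
  simp only [H.sum_chernCurvCoeff_mul_snd hz, sub_mul, Finset.sum_sub_distrib,
    H.sum_dy_mul_horDeriv_nonlinConn hz]
  have h1 : dx (dx ℓ k) l z = dx (dx ℓ l) k z :=
    fderiv_fderiv_comm H.isOpen (H.contDiffOn.of_le (by norm_num)) hz _ _
  have h2 : ∀ a b, dy (dx ℓ a) b z = dx (dy ℓ b) a z := fun a b =>
    fderiv_fderiv_comm H.isOpen (H.contDiffOn.of_le (by norm_num)) hz _ _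
  have h3 : ∀ a b, dy (dy ℓ a) b z = dy (dy ℓ b) a z := fun a b =>
    fderiv_fderiv_comm H.isOpen (H.contDiffOn.of_le (by norm_num)) hz _ _
  have h4 : ∑ i, ∑ j, nonlinConn ℓ i l z * nonlinConn ℓ j k z * dy (dy ℓ i) j z =
      ∑ i, ∑ j, nonlinConn ℓ i k z * nonlinConn ℓ j l z * dy (dy ℓ i) j z := by
    rw [Finset.sum_comm]
    exact Finset.sum_congr rfl fun _ _ => Finset.sum_congr rfl fun _ _ => by
      rw [h3]; ring
  simp only [h1, h2, h4]
  ring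

end Connection

end IsLocalFinsler

end CoordinateFinsler

/-! ## The fundamental form in coordinates -/

section LocalForm

variable {n : ℕ}

/-- `∑ g_{ij}(z) uⁱ wʲ`. -/
def localForm (ℓ : EuclideanSpace ℝ (Fin n) × EuclideanSpace ℝ (Fin n) → ℝ)
    (z : EuclideanSpace ℝ (Fin n) × EuclideanSpace ℝ (Fin n)) (u w : EuclideanSpace ℝ (Fin n)) : ℝ :=
  ∑ i, ∑ j, gLow ℓ i j z * u i * w j

variable {ℓ : EuclideanSpace ℝ (Fin n) × EuclideanSpace ℝ (Fin n) → ℝ}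
  {U : Set (EuclideanSpace ℝ (Fin n) × EuclideanSpace ℝ (Fin n))}
  {z : EuclideanSpace ℝ (Fin n) × EuclideanSpace ℝ (Fin n)}

theorem localForm_add_left (u u' w : EuclideanSpace ℝ (Fin n)) :
    localForm ℓ z (u + u') w = localForm ℓ z u w + localForm ℓ z u' w := by
  simp only [localForm, PiLp.add_apply, mul_add, add_mul, Finset.sum_add_distrib]

theorem localForm_smul_left (c : ℝ) (u w : EuclideanSpace ℝ (Fin n)) :
    localForm ℓ z (c • u) w = c * localForm ℓ z u w := by
  simp only [localForm, PiLp.smul_apply, smul_eq_mul, Finset.mul_sum]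
  exact Finset.sum_congr rfl fun _ _ => Finset.sum_congr rfl fun _ _ => by ring

theorem chernGammaVec_add_left (u u' w : EuclideanSpace ℝ (Fin n)) :
    chernGammaVec ℓ z (u + u') w = chernGammaVec ℓ z u w + chernGammaVec ℓ z u' w := by
  ext m
  simp only [chernGammaVec, PiLp.add_apply, add_mul, Finset.sum_add_distrib]

theorem chernGammaVec_smul_left (c : ℝ) (u w : EuclideanSpace ℝ (Fin n)) :
    chernGammaVec ℓ z (c • u) w = c • chernGammaVec ℓ z u w := by
  ext m
  simp only [chernGammaVec, PiLp.smul_apply, smul_eq_mul, Finset.mul_sum]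
  exact Finset.sum_congr rfl fun _ _ => Finset.sum_congr rfl fun _ _ => by ring

theorem chernCurvVec_add_mid (ξ η η' ζ : EuclideanSpace ℝ (Fin n)) :
    chernCurvVec ℓ z ξ (η + η') ζ = chernCurvVec ℓ z ξ η ζ + chernCurvVec ℓ z ξ η' ζ := by
  ext m
  simp only [chernCurvVec, PiLp.add_apply, mul_add, add_mul, Finset.sum_add_distrib]

/-- The curvature coefficients are antisymmetric in k and l. -/
theorem chernCurvVec_smul_self (c : ℝ) (ξ ζ : EuclideanSpace ℝ (Fin n)) :
    chernCurvVec ℓ z ξ (c • ξ) ζ = 0 := by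
  ext i
  have hR : ∀ j k l, chernCurvCoeff ℓ i j k l z = -chernCurvCoeff ℓ i j l k z := fun j k l => by
    simp only [chernCurvCoeff]
    ring
  simp only [chernCurvVec, PiLp.zero_apply, PiLp.smul_apply, smul_eq_mul]
  refine Finset.sum_eq_zero fun j _ => ?_
  have h : ∑ k, ∑ l, ξ k * (c * ξ l) * ζ j * chernCurvCoeff ℓ i j k l z =
      -∑ k, ∑ l, ξ k * (c * ξ l) * ζ j * chernCurvCoeff ℓ i j k l z := by
    conv_lhs => rw [Finset.sum_comm]
    rw [← Finset.sum_neg_distrib]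
    refine Finset.sum_congr rfl fun k _ => ?_
    rw [← Finset.sum_neg_distrib]
    refine Finset.sum_congr rfl fun l _ => ?_
    rw [hR j l k]
    ring
  linarith

namespace IsLocalFinsler

variable (H : IsLocalFinsler ℓ U) (hz : z ∈ U)
include H hz

theorem localForm_symm (u w : EuclideanSpace ℝ (Fin n)) :
    localForm ℓ z u w = localForm ℓ z w u := by
  rw [localForm, Finset.sum_comm, localForm]
  refine Finset.sum_congr rfl fun i _ => Finset.sum_congr rfl fun j _ => ?_
  rw [H.gLow_symm hz]
  ring

theorem localForm_snd (u : EuclideanSpace ℝ (Fin n)) :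
    localForm ℓ z u z.2 = (1 / 2) * ∑ i, u i * dy ℓ i z := by
  rw [localForm, Finset.mul_sum]
  refine Finset.sum_congr rfl fun i _ => ?_
  have h : ∀ j, gLow ℓ i j z * u i * z.2 j = u i * (gLow ℓ i j z * z.2 j) := fun j => by ring
  rw [Finset.sum_congr rfl fun j _ => h j, ← Finset.mul_sum, H.sum_gLow_mul_snd hz]
  ring

theorem localForm_snd_snd : localForm ℓ z z.2 z.2 = ℓ z := by
  have := H.euler hz
  rw [H.localForm_snd hz, Finset.sum_congr rfl fun i _ => mul_comm (z.2 i) (dy ℓ i z), this]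
  ring

/-- Pairing with y is half of contraction with ∂ℓ/∂y, so the coordinate curvature identity applies.
The reference vector stands in both remaining slots. -/
theorem localForm_chernCurvVec (ξ η : EuclideanSpace ℝ (Fin n)) :
    localForm ℓ z (chernCurvVec ℓ z ξ η z.2) z.2 = 0 := by
  rw [H.localForm_snd hz]
  have h : ∑ i, (chernCurvVec ℓ z ξ η z.2) i * dy ℓ i z = ∑ k, ∑ l, ξ k * η l *
      ∑ i, (∑ j, chernCurvCoeff ℓ i j k l z * z.2 j) * dy ℓ i z := by
    simp only [chernCurvVec, Finset.sum_mul, Finset.mul_sum]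
    have : ∀ i, ∑ j, ∑ k, ∑ l, ξ k * η l * z.2 j * chernCurvCoeff ℓ i j k l z * dy ℓ i z =
        ∑ k, ∑ l, ∑ j, ξ k * η l * z.2 j * chernCurvCoeff ℓ i j k l z * dy ℓ i z := by
      intro i
      rw [Finset.sum_comm]
      exact Finset.sum_congr rfl fun k _ => Finset.sum_comm
    rw [Finset.sum_congr rfl fun i _ => this i, Finset.sum_comm]
    refine Finset.sum_congr rfl fun k _ => ?_
    rw [Finset.sum_comm]
    exact Finset.sum_congr rfl fun l _ => Finset.sum_congr rfl fun i _ =>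
      Finset.sum_congr rfl fun j _ => by ring
  rw [h]
  simp only [H.sum_chernCurvCoeff_mul_snd_mul_dy hz, mul_zero, Finset.sum_const_zero]

theorem chernGammaVec_snd_snd_apply (m : Fin n) :
    chernGammaVec ℓ z z.2 z.2 m = ∑ k, z.2 k * nonlinConn ℓ m k z := by
  simp only [chernGammaVec]
  rw [Finset.sum_comm]
  refine Finset.sum_congr rfl fun k _ => ?_
  rw [← H.sum_chernGamma_mul_snd hz, Finset.mul_sum]
  exact Finset.sum_congr rfl fun j _ => by ring

/-- The geodesic spray is horizontal, because Γ(y, y) = N y. Derivatives along geodesics therefore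
only involve δ/δx. -/
theorem fderiv_geodesicSpray (f : EuclideanSpace ℝ (Fin n) × EuclideanSpace ℝ (Fin n) → ℝ) :
    fderiv ℝ f z (z.2, -chernGammaVec ℓ z z.2 z.2) = ∑ k, z.2 k * horDeriv ℓ f k z := by
  rw [fderiv_prod_apply]
  simp only [PiLp.neg_apply, H.chernGammaVec_snd_snd_apply hz, horDeriv, mul_sub,
    Finset.sum_sub_distrib, neg_mul, Finset.sum_neg_distrib, ← sub_eq_add_neg, Finset.mul_sum,
    Finset.sum_mul]
  congr 1
  rw [Finset.sum_comm]
  exact Finset.sum_congr rfl fun _ _ => Finset.sum_congr rfl fun _ _ => by ring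

/-- Horizontal metricity contracted with yᵏ, Vⁱ and yʲ. -/
theorem sum_horDeriv_gLow (V : EuclideanSpace ℝ (Fin n)) :
    ∑ i, ∑ j, (∑ k, z.2 k * horDeriv ℓ (gLow ℓ i j) k z) * V i * z.2 j =
      localForm ℓ z (chernGammaVec ℓ z V z.2) z.2 +
        localForm ℓ z V (chernGammaVec ℓ z z.2 z.2) := by
  have h1 : localForm ℓ z (chernGammaVec ℓ z V z.2) z.2 =
      ∑ i, ∑ j, ∑ k, ∑ h, z.2 k * (gLow ℓ j h z * chernGamma ℓ h i k z) * V i * z.2 j := by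
    simp only [localForm, chernGammaVec, Finset.mul_sum, Finset.sum_mul]
    have : ∀ h, ∑ j, ∑ i, ∑ k, gLow ℓ h j z * (V i * z.2 k * chernGamma ℓ h i k z) * z.2 j =
        ∑ i, ∑ j, ∑ k, gLow ℓ h j z * (V i * z.2 k * chernGamma ℓ h i k z) * z.2 j := fun h =>
      Finset.sum_comm
    rw [Finset.sum_congr rfl fun h _ => this h, Finset.sum_comm]
    refine Finset.sum_congr rfl fun i _ => ?_
    rw [Finset.sum_comm]
    refine Finset.sum_congr rfl fun j _ => ?_
    rw [Finset.sum_comm]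
    refine Finset.sum_congr rfl fun k _ => Finset.sum_congr rfl fun h _ => ?_
    rw [H.gLow_symm hz h j]
    ring
  have h2 : localForm ℓ z V (chernGammaVec ℓ z z.2 z.2) =
      ∑ i, ∑ j, ∑ k, ∑ h, z.2 k * (gLow ℓ i h z * chernGamma ℓ h j k z) * V i * z.2 j := by
    simp only [localForm, chernGammaVec, Finset.mul_sum]
    refine Finset.sum_congr rfl fun i _ => ?_
    rw [Finset.sum_comm]
    refine Finset.sum_congr rfl fun j _ => ?_
    rw [Finset.sum_comm]
    exact Finset.sum_congr rfl fun k _ => Finset.sum_congr rfl fun h _ => by ring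
  rw [h1, h2]
  simp only [H.horDeriv_gLow_eq hz, mul_add, add_mul, Finset.mul_sum, Finset.sum_mul,
    Finset.sum_add_distrib]

end IsLocalFinsler

/-- Along an integral curve of the geodesic spray, `d/dt g(V, ẋ) = g(DV, ẋ)`. -/
theorem IsLocalFinsler.hasDerivWithinAt_localForm (H : IsLocalFinsler ℓ U)
    {c : ℝ → EuclideanSpace ℝ (Fin n) × EuclideanSpace ℝ (Fin n)} {V : ℝ → EuclideanSpace ℝ (Fin n)}
    {V' : EuclideanSpace ℝ (Fin n)} {S : Set ℝ} {t : ℝ} (hc : c t ∈ U)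
    (hcd : HasDerivWithinAt c ((c t).2, -chernGammaVec ℓ (c t) (c t).2 (c t).2) S t)
    (hV : HasDerivWithinAt V V' S t) :
    HasDerivWithinAt (fun s => localForm ℓ (c s) (V s) (c s).2)
      (localForm ℓ (c t) (V' + chernGammaVec ℓ (c t) (V t) (c t).2) (c t).2) S t := by
  have hg : ∀ i j, HasDerivWithinAt (fun s => gLow ℓ i j (c s))
      (∑ k, (c t).2 k * horDeriv ℓ (gLow ℓ i j) k (c t)) S t := fun i j => by
    rw [← H.fderiv_geodesicSpray hc]
    exact (H.differentiableAt_gLow hc i j).hasFDerivAt.comp_hasDerivWithinAt t hcd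
  have hy : ∀ j, HasDerivWithinAt (fun s => (c s).2 j)
      (-chernGammaVec ℓ (c t) (c t).2 (c t).2 j) S t := fun j =>
    (hasFDerivAt_snd_coord j (c t)).comp_hasDerivWithinAt t hcd
  have hv : ∀ i, HasDerivWithinAt (fun s => V s i) (V' i) S t := fun i =>
    (EuclideanSpace.proj (𝕜 := ℝ) i).hasFDerivAt.comp_hasDerivWithinAt t hV
  have h : HasDerivWithinAt (fun s => localForm ℓ (c s) (V s) (c s).2)
      (∑ i, ∑ j, (((∑ k, (c t).2 k * horDeriv ℓ (gLow ℓ i j) k (c t)) * V t i +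
        gLow ℓ i j (c t) * V' i) * (c t).2 j +
        gLow ℓ i j (c t) * V t i * -chernGammaVec ℓ (c t) (c t).2 (c t).2 j)) S t :=
    HasDerivWithinAt.fun_sum fun i _ => HasDerivWithinAt.fun_sum fun j _ =>
      ((hg i j).mul (hv i)).mul (hy j)
  convert h using 1
  -- The derivative of g contributes g(Γ(V, y), y) + g(V, Γ(y, y)). The first term completes V' to
  -- DV; the second cancels the contribution of ẏ = -Γ(y, y).
  have := H.sum_horDeriv_gLow hc (V t)
  simp only [add_mul, Finset.sum_add_distrib, this, mul_neg, Finset.sum_neg_distrib,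
    localForm_add_left]
  simp only [localForm]
  ring

end LocalForm

/-! ## Pseudo-Finsler metrics in charts -/

section Charts

variable {n : ℕ} {M : Type*} [TopologicalSpace M] [ChartedSpace (EuclideanSpace ℝ (Fin n)) M]
  [IsManifold (𝓡 n) 7 M]

theorem tangentCoord_eq (p q : M) (v : TangentSpace (𝓡 n) q) :
    tangentCoord p ⟨q, v⟩ = (extChartAt (𝓡 n) p q, tangentCoordChange (𝓡 n) q p q v) :=
  rfl

theorem tangentCoordChange_cancel {p q : M} (hq : q ∈ (extChartAt (𝓡 n) p).source)
    (v : EuclideanSpace ℝ (Fin n)) :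
    tangentCoordChange (𝓡 n) q p q (tangentCoordChange (𝓡 n) p q q v) = v := by
  rw [tangentCoordChange_comp ⟨⟨hq, mem_extChartAt_source q⟩, hq⟩, tangentCoordChange_self hq]

theorem tangentCoordChange_cancel' {p q : M} (hq : q ∈ (extChartAt (𝓡 n) p).source)
    (v : EuclideanSpace ℝ (Fin n)) :
    tangentCoordChange (𝓡 n) p q q (tangentCoordChange (𝓡 n) q p q v) = v := by
  rw [tangentCoordChange_comp ⟨⟨mem_extChartAt_source q, hq⟩, mem_extChartAt_source q⟩,
    tangentCoordChange_self (mem_extChartAt_source q)]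

theorem mem_tangentChart_source {p : M} {v : TangentBundle (𝓡 n) M} :
    v ∈ (extChartAt (𝓡 n).tangent (⟨p, 0⟩ : TangentBundle (𝓡 n) M)).source ↔
      v.proj ∈ (extChartAt (𝓡 n) p).source := by
  rw [extChartAt_source, extChartAt_source, TangentBundle.mem_chart_source_iff]

theorem localLagrangian_tangentCoord (L : TangentBundle (𝓡 n) M → ℝ) {p q : M}
    (hq : q ∈ (extChartAt (𝓡 n) p).source) (v : TangentSpace (𝓡 n) q) :
    localLagrangian L p (tangentCoord p ⟨q, v⟩) = L ⟨q, v⟩ :=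
  congrArg L (PartialEquiv.left_inv _ (mem_tangentChart_source.2 hq))

/-- The set of coordinates of vectors of `A` in the chart at `p`. -/
def localDomain (A : Set (TangentBundle (𝓡 n) M)) (p : M) :
    Set (EuclideanSpace ℝ (Fin n) × EuclideanSpace ℝ (Fin n)) :=
  (extChartAt (𝓡 n).tangent (⟨p, 0⟩ : TangentBundle (𝓡 n) M)).target ∩
    (extChartAt (𝓡 n).tangent (⟨p, 0⟩ : TangentBundle (𝓡 n) M)).symm ⁻¹' A

theorem tangentCoord_mem_localDomain {A : Set (TangentBundle (𝓡 n) M)} {p q : M}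
    (hq : q ∈ (extChartAt (𝓡 n) p).source) {v : TangentSpace (𝓡 n) q}
    (hv : (⟨q, v⟩ : TangentBundle (𝓡 n) M) ∈ A) : tangentCoord p ⟨q, v⟩ ∈ localDomain A p := by
  refine ⟨PartialEquiv.map_source _ (mem_tangentChart_source.2 hq), ?_⟩
  rw [mem_preimage, tangentCoord, PartialEquiv.left_inv _ (mem_tangentChart_source.2 hq)]
  exact hv

theorem exists_of_mem_localDomain {A : Set (TangentBundle (𝓡 n) M)} {p : M}
    {z : EuclideanSpace ℝ (Fin n) × EuclideanSpace ℝ (Fin n)} (hz : z ∈ localDomain A p) :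
    ∃ (q : M) (v : TangentSpace (𝓡 n) q), q ∈ (extChartAt (𝓡 n) p).source ∧
      (⟨q, v⟩ : TangentBundle (𝓡 n) M) ∈ A ∧ z = tangentCoord p ⟨q, v⟩ :=
  ⟨_, _, mem_tangentChart_source.1 (PartialEquiv.map_target _ hz.1), hz.2,
    (PartialEquiv.right_inv _ hz.1).symm⟩

/-- Passing to the tangent bundle costs one derivative; C⁶ is just what L requires. -/
theorem isManifold_tangentBundle : IsManifold (𝓡 n).tangent 6 (TangentBundle (𝓡 n) M) := by
  have : IsManifold (𝓡 n) (6 + 1) M := IsManifold.of_le (n := 7) (by norm_num)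
  have : IsManifold (𝓡 n) 6 M := IsManifold.of_le (n := 7) (by norm_num)
  have := TangentBundle.contMDiffVectorBundle (I := 𝓡 n) (M := M) (n := 6)
  exact Bundle.TotalSpace.isManifold _ _

variable {A : Set (TangentBundle (𝓡 n) M)} {L : TangentBundle (𝓡 n) M → ℝ}

theorem isOpen_localDomain (hA : IsOpen A) (p : M) : IsOpen (localDomain A p) :=
  (continuousOn_extChartAt_symm _).isOpen_inter_preimage (isOpen_extChartAt_target _) hA

theorem contDiffOn_localLagrangian (hL : ContMDiffOn (𝓡 n).tangent 𝓘(ℝ, ℝ) 6 L A) (p : M) :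
    ContDiffOn ℝ 6 (localLagrangian L p) (localDomain A p) := by
  have := isManifold_tangentBundle (n := n) (M := M)
  have h1 := contMDiffOn_extChartAt_symm (I := (𝓡 n).tangent) (n := 6)
    (⟨p, 0⟩ : TangentBundle (𝓡 n) M)
  have h2 : ContMDiffOn 𝓘(ℝ, EuclideanSpace ℝ (Fin n) × EuclideanSpace ℝ (Fin n)) 𝓘(ℝ, ℝ) 6
      (localLagrangian L p) (localDomain A p) :=
    hL.comp (h1.mono inter_subset_left) inter_subset_right
  exact contMDiffOn_iff_contDiffOn.1 h2

/-- The chart is linear on fibres, so both derivatives are derivatives of ℓ along affine lines. The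
arguments appear in the order w, u because the inner derivative is the one in w; symmetry is applied
afterwards in `fundTensor_eq`. -/
theorem fundTensor_eq_aux (hA : IsOpen A) (hL : ContMDiffOn (𝓡 n).tangent 𝓘(ℝ, ℝ) 6 L A)
    {p q : M} (hq : q ∈ (extChartAt (𝓡 n) p).source) {v : TangentSpace (𝓡 n) q}
    (hv : (⟨q, v⟩ : TangentBundle (𝓡 n) M) ∈ A) (u w : TangentSpace (𝓡 n) q) :
    fundTensor L v u w = localForm (localLagrangian L p) (tangentCoord p ⟨q, v⟩)
      (tangentCoordChange (𝓡 n) q p q w) (tangentCoordChange (𝓡 n) q p q u) := by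
  set T : EuclideanSpace ℝ (Fin n) →L[ℝ] EuclideanSpace ℝ (Fin n) := tangentCoordChange (𝓡 n) q p q
    with hT
  set ℓ := localLagrangian L p with hℓ
  set z := tangentCoord p ⟨q, v⟩ with hzdef
  have hz : z ∈ localDomain A p := tangentCoord_mem_localDomain hq hv
  have hU := isOpen_localDomain hA p
  have hC := contDiffOn_localLagrangian hL p
  have hval : ∀ t s : ℝ, L (⟨q, v + t • u + s • w⟩ : TangentBundle (𝓡 n) M) =
      ℓ (z + t • (0, T u) + s • (0, T w)) := by
    intro t s
    rw [hℓ, ← localLagrangian_tangentCoord L hq, hzdef, tangentCoord_eq, tangentCoord_eq, ← hT]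
    congr 1
    refine Prod.ext ?_ ?_
    · simp
    · have h : ∀ a b c : EuclideanSpace ℝ (Fin n),
          T (a + t • b + s • c) = T a + t • T b + s • T c := fun a b c => by simp
      exact h v u w
  have hline : ∀ a b : EuclideanSpace ℝ (Fin n) × EuclideanSpace ℝ (Fin n),
      HasDerivAt (fun t : ℝ => a + t • b) b 0 := fun a b => by
    simpa using ((hasDerivAt_id (0 : ℝ)).smul_const b).const_add a
  have hcont : ContinuousAt (fun t : ℝ => z + t • ((0, T u) : EuclideanSpace ℝ (Fin n) × _)) 0 :=
    (hline z (0, T u)).continuousAt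
  have hev : ∀ᶠ t in 𝓝 (0 : ℝ), z + t • ((0, T u) : EuclideanSpace ℝ (Fin n) × _) ∈
      localDomain A p := by
    refine hcont.eventually_mem (hU.mem_nhds ?_)
    simpa using hz
  -- As A is open, the formula for the inner derivative holds for all t near 0, which suffices for
  -- the outer one.
  have hinner : (fun t : ℝ => deriv (fun s : ℝ =>
      L (⟨q, v + t • u + s • w⟩ : TangentBundle (𝓡 n) M)) 0) =ᶠ[𝓝 0]
      fun t => fderiv ℝ ℓ (z + t • (0, T u)) (0, T w) := by
    filter_upwards [hev] with t ht
    simp only [hval]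
    have hd : HasFDerivAt ℓ (fderiv ℝ ℓ (z + t • (0, T u)))
        (z + t • ((0, T u) : EuclideanSpace ℝ (Fin n) × _) + (0 : ℝ) • (0, T w)) := by
      rw [zero_smul, add_zero]
      exact ((hC.contDiffAt (hU.mem_nhds ht)).differentiableAt (by norm_num)).hasFDerivAt
    exact (hd.comp_hasDerivAt (0 : ℝ) (hline _ _)).deriv
  have hd2 : DifferentiableAt ℝ (fderiv ℝ ℓ) z :=
    ((hC.fderiv_of_isOpen hU (m := 1) (by norm_num)).contDiffAt
      (hU.mem_nhds hz)).differentiableAt (by norm_num)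
  have houter : HasDerivAt (fun t : ℝ => fderiv ℝ ℓ (z + t • (0, T u)) (0, T w))
      (fderiv ℝ (fun z => fderiv ℝ ℓ z (0, T w)) z (0, T u)) 0 := by
    have hd : HasFDerivAt (fun z => fderiv ℝ ℓ z (0, T w))
        (fderiv ℝ (fun z => fderiv ℝ ℓ z (0, T w)) z)
        (z + (0 : ℝ) • ((0, T u) : EuclideanSpace ℝ (Fin n) × _)) := by
      rw [zero_smul, add_zero]
      exact (hd2.clm_apply (differentiableAt_const _)).hasFDerivAt
    exact hd.comp_hasDerivAt (0 : ℝ) (hline _ _)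
  rw [fundTensor, hinner.deriv_eq, houter.deriv]
  have hdy : ∀ i, DifferentiableAt ℝ (dy ℓ i) z := fun i =>
    hd2.clm_apply (differentiableAt_const _)
  have hsum : (fun z => fderiv ℝ ℓ z (0, T w)) = fun z => ∑ i, (T w) i * dy ℓ i z :=
    funext fun z => fderiv_zero_snd _ _ _
  rw [hsum, fderiv_fun_sum (A := fun i z => (T w) i * dy ℓ i z) fun i _ => (hdy i).const_mul _,
    sum_apply, localForm, Finset.mul_sum]
  refine Finset.sum_congr rfl fun i _ => ?_
  rw [fderiv_const_mul (hdy i), smul_apply, fderiv_zero_snd, smul_eq_mul, Finset.mul_sum,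
    Finset.mul_sum]
  refine Finset.sum_congr rfl fun j _ => ?_
  rw [gLow]
  ring

/-- Homogeneity passes to the chart by fibrewise linearity. A null vector of the matrix (g_{ij})
would pull back to a nonzero vector in the kernel of the fundamental tensor. -/
theorem IsPseudoFinslerMetric.isLocalFinsler (hL : IsPseudoFinslerMetric A L) (p : M) :
    IsLocalFinsler (localLagrangian L p) (localDomain A p) where
  isOpen := isOpen_localDomain hL.isOpen p
  contDiffOn := contDiffOn_localLagrangian hL.contMDiffOn p
  homogeneous := by
    intro x y c hc hz
    obtain ⟨q, v, hq, hv, hxy⟩ := exists_of_mem_localDomain hz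
    have h : (x, c • y) = tangentCoord p ⟨q, c • v⟩ := by
      rw [tangentCoord_eq, Prod.mk.injEq] at hxy
      rw [tangentCoord_eq, hxy.1, hxy.2]
      refine Prod.ext rfl ?_
      exact ((tangentCoordChange (𝓡 n) q p q).map_smul c v).symm
    rw [h, hxy, localLagrangian_tangentCoord L hq, localLagrangian_tangentCoord L hq]
    exact hL.homogeneous q v c hc hv
  det_ne_zero := by
    intro z hz hdet
    obtain ⟨q, v, hq, hv, rfl⟩ := exists_of_mem_localDomain hz
    obtain ⟨a, ha0, ha⟩ := Matrix.exists_mulVec_eq_zero_iff.2 hdet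
    set a' : EuclideanSpace ℝ (Fin n) := WithLp.toLp 2 a with ha'
    obtain ⟨u, hu⟩ : ∃ u : TangentSpace (𝓡 n) q, tangentCoordChange (𝓡 n) q p q u = a' :=
      ⟨_, tangentCoordChange_cancel hq a'⟩
    have hu0 : u = 0 := hL.nondegenerate q v hv u fun w => by
      rw [fundTensor_eq_aux hL.isOpen hL.contMDiffOn hq hv, hu, localForm]
      refine Finset.sum_eq_zero fun i _ => ?_
      have h := congrFun ha i
      simp only [Matrix.mulVec, dotProduct, Matrix.of_apply, Pi.zero_apply] at h
      have h2 : ∀ j, gLow (localLagrangian L p) i j (tangentCoord p ⟨q, v⟩) *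
          (tangentCoordChange (𝓡 n) q p q w) i * a' j = (tangentCoordChange (𝓡 n) q p q w) i *
          (gLow (localLagrangian L p) i j (tangentCoord p ⟨q, v⟩) * a j) := fun j => by
        rw [ha']; ring
      rw [Finset.sum_congr rfl fun j _ => h2 j, ← Finset.mul_sum, h, mul_zero]
    rw [hu0] at hu
    have h0 : a' = 0 := hu.symm.trans (tangentCoordChange (𝓡 n) q p q).map_zero
    exact ha0 (funext fun i => congrArg (fun x : EuclideanSpace ℝ (Fin n) => x i) h0)

/-- The chart at p serves all nearby q: differentiating along a curve requires one fixed chart. -/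
theorem IsPseudoFinslerMetric.fundTensor_eq (hL : IsPseudoFinslerMetric A L)
    {p q : M} (hq : q ∈ (extChartAt (𝓡 n) p).source) {v : TangentSpace (𝓡 n) q}
    (hv : (⟨q, v⟩ : TangentBundle (𝓡 n) M) ∈ A) (u w : TangentSpace (𝓡 n) q) :
    fundTensor L v u w = localForm (localLagrangian L p) (tangentCoord p ⟨q, v⟩)
      (tangentCoord p ⟨q, u⟩).2 (tangentCoord p ⟨q, w⟩).2 := by
  rw [fundTensor_eq_aux hL.isOpen hL.contMDiffOn hq hv,
    (hL.isLocalFinsler p).localForm_symm (tangentCoord_mem_localDomain hq hv)]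
  rfl

theorem tangentCoord_self_snd (p : M) (v : TangentSpace (𝓡 n) p) :
    (tangentCoord p ⟨p, v⟩).2 = v :=
  congrArg Prod.snd (tangentCoord_self p v)

theorem IsPseudoFinslerMetric.fundTensor_eq_self (hL : IsPseudoFinslerMetric A L)
    {p : M} {v : TangentSpace (𝓡 n) p} (hv : (⟨p, v⟩ : TangentBundle (𝓡 n) M) ∈ A)
    (u w : TangentSpace (𝓡 n) p) :
    fundTensor L v u w = localForm (localLagrangian L p) (tangentCoord p ⟨p, v⟩) u w := by
  rw [hL.fundTensor_eq (mem_extChartAt_source p) hv, tangentCoord_self_snd, tangentCoord_self_snd]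

/-! ### Bilinearity and curvature identity at a single tangent space. -/

section Pointwise

variable (hL : IsPseudoFinslerMetric A L) {p : M} {v : TangentSpace (𝓡 n) p}
  (hv : (⟨p, v⟩ : TangentBundle (𝓡 n) M) ∈ A)
include hL hv

theorem IsPseudoFinslerMetric.fundTensor_symm (u w : TangentSpace (𝓡 n) p) :
    fundTensor L v u w = fundTensor L v w u := by
  rw [hL.fundTensor_eq_self hv, hL.fundTensor_eq_self hv]
  exact (hL.isLocalFinsler p).localForm_symm
    (tangentCoord_mem_localDomain (mem_extChartAt_source p) hv) _ _

theorem IsPseudoFinslerMetric.fundTensor_add_left (u u' w : TangentSpace (𝓡 n) p) :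
    fundTensor L v (u + u') w = fundTensor L v u w + fundTensor L v u' w := by
  rw [hL.fundTensor_eq_self hv, hL.fundTensor_eq_self hv, hL.fundTensor_eq_self hv]
  exact localForm_add_left _ _ _

theorem IsPseudoFinslerMetric.fundTensor_smul_left (c : ℝ) (u w : TangentSpace (𝓡 n) p) :
    fundTensor L v (c • u) w = c * fundTensor L v u w := by
  rw [hL.fundTensor_eq_self hv, hL.fundTensor_eq_self hv]
  exact localForm_smul_left _ _ _

theorem IsPseudoFinslerMetric.fundTensor_add_right (u w w' : TangentSpace (𝓡 n) p) :
    fundTensor L v u (w + w') = fundTensor L v u w + fundTensor L v u w' := by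
  rw [hL.fundTensor_symm hv, hL.fundTensor_add_left hv, hL.fundTensor_symm hv w,
    hL.fundTensor_symm hv w']

theorem IsPseudoFinslerMetric.fundTensor_smul_right (c : ℝ) (u w : TangentSpace (𝓡 n) p) :
    fundTensor L v u (c • w) = c * fundTensor L v u w := by
  rw [hL.fundTensor_symm hv, hL.fundTensor_smul_left hv, hL.fundTensor_symm hv w]

theorem IsPseudoFinslerMetric.fundTensor_self :
    fundTensor L v v v = L ⟨p, v⟩ := by
  have h := (hL.isLocalFinsler p).localForm_snd_snd
    (tangentCoord_mem_localDomain (mem_extChartAt_source p) hv)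
  rw [localLagrangian_tangentCoord L (mem_extChartAt_source p), tangentCoord_self_snd] at h
  rw [hL.fundTensor_eq_self hv, h]

theorem IsPseudoFinslerMetric.fundTensor_chernCurv (ξ η : TangentSpace (𝓡 n) p) :
    fundTensor L v (chernCurv L v ξ η v) v = 0 := by
  have h := (hL.isLocalFinsler p).localForm_chernCurvVec
    (tangentCoord_mem_localDomain (mem_extChartAt_source p) hv) ξ η
  rw [tangentCoord_self_snd] at h
  rw [hL.fundTensor_eq_self hv]
  exact h

end Pointwise

theorem chernCurv_add_mid {p : M} (v ξ η η' ζ : TangentSpace (𝓡 n) p) :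
    chernCurv L v ξ (η + η') ζ = chernCurv L v ξ η ζ + chernCurv L v ξ η' ζ :=
  chernCurvVec_add_mid ξ η η' ζ

theorem chernCurv_smul_self {p : M} (c : ℝ) (v ξ ζ : TangentSpace (𝓡 n) p) :
    chernCurv L v ξ (c • ξ) ζ = 0 :=
  chernCurvVec_smul_self c ξ ζ

end Charts

/-! ## Fields along a geodesic -/

section Geodesic

variable {n : ℕ} {M : Type*} [TopologicalSpace M] [ChartedSpace (EuclideanSpace ℝ (Fin n)) M]
  [IsManifold (𝓡 n) 7 M] {A : Set (TangentBundle (𝓡 n) M)} {L : TangentBundle (𝓡 n) M → ℝ}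
  {τ : ℝ} {γ : ℝ → M}

theorem fieldCoord_self (V : FieldAlong (n := n) γ) (t : ℝ) : fieldCoord V (γ t) t = V t :=
  tangentCoord_self_snd _ _

theorem fieldCoord_add (V W : FieldAlong (n := n) γ) (p : M) (s : ℝ) :
    fieldCoord (V + W) p s = fieldCoord V p s + fieldCoord W p s :=
  (tangentCoordChange (𝓡 n) (γ s) p (γ s)).map_add (V s) (W s)

theorem fieldCoord_sub (V W : FieldAlong (n := n) γ) (p : M) (s : ℝ) :
    fieldCoord (V - W) p s = fieldCoord V p s - fieldCoord W p s :=
  (tangentCoordChange (𝓡 n) (γ s) p (γ s)).map_sub (V s) (W s)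

theorem fieldCoord_smul (h : ℝ → ℝ) (V : FieldAlong (n := n) γ) (p : M) (s : ℝ) :
    fieldCoord (fun t => h t • V t : FieldAlong (n := n) γ) p s = h s • fieldCoord V p s :=
  (tangentCoordChange (𝓡 n) (γ s) p (γ s)).map_smul (h s) (V s)

theorem contDiffWithinAt_chart_comp (hγ : ContMDiffOn 𝓘(ℝ, ℝ) (𝓡 n) 2 γ (Icc 0 τ)) {p : M} {s : ℝ}
    (hs : s ∈ Icc 0 τ) (hp : γ s ∈ (extChartAt (𝓡 n) p).source) :
    ContDiffWithinAt ℝ 2 (fun r => extChartAt (𝓡 n) p (γ r)) (Icc 0 τ) s := by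
  have : IsManifold (𝓡 n) 2 M := IsManifold.of_le (n := 7) (by norm_num)
  rw [extChartAt_source] at hp
  exact contMDiffWithinAt_iff_contDiffWithinAt.1
    ((contMDiffAt_extChartAt' (n := 2) hp).comp_contMDiffWithinAt s (hγ s hs))

/-- Chain rule: the manifold derivative of the chart is the tangent coordinate change. -/
theorem fieldCoord_velocity (hτ : 0 < τ) (hγ : ContMDiffOn 𝓘(ℝ, ℝ) (𝓡 n) 2 γ (Icc 0 τ)) {p : M}
    {s : ℝ} (hs : s ∈ Icc 0 τ) (hp : γ s ∈ (extChartAt (𝓡 n) p).source) :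
    fieldCoord (velocity (n := n) τ γ) p s =
      derivWithin (fun r => extChartAt (𝓡 n) p (γ r)) (Icc 0 τ) s := by
  rw [extChartAt_source] at hp
  have h1 : HasMFDerivWithinAt 𝓘(ℝ, ℝ) (𝓡 n) γ (Icc 0 τ) s
      (mfderivWithin 𝓘(ℝ, ℝ) (𝓡 n) γ (Icc 0 τ) s) :=
    ((hγ s hs).mdifferentiableWithinAt (by norm_num)).hasMFDerivWithinAt
  have h2 : HasMFDerivAt (𝓡 n) (𝓡 n) (chartAt (EuclideanSpace ℝ (Fin n)) p) (γ s)
      (tangentCoordChange (𝓡 n) (γ s) p (γ s)) := by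
    rw [← mfderiv_chartAt_eq_tangentCoordChange hp]
    exact (mdifferentiableAt_atlas (ChartedSpace.chart_mem_atlas _) hp).hasMFDerivAt
  have h3 : HasFDerivWithinAt (fun r => extChartAt (𝓡 n) p (γ r))
      ((tangentCoordChange (𝓡 n) (γ s) p (γ s)).comp
        (mfderivWithin 𝓘(ℝ, ℝ) (𝓡 n) γ (Icc 0 τ) s :
          ℝ →L[ℝ] EuclideanSpace ℝ (Fin n))) (Icc 0 τ) s :=
    (h2.comp_hasMFDerivWithinAt s h1).hasFDerivWithinAt
  exact (h3.hasDerivWithinAt.derivWithin (uniqueDiffOn_Icc hτ s hs)).symm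

theorem contDiffWithinAt_velocity (hτ : 0 < τ) (hγ : ContMDiffOn 𝓘(ℝ, ℝ) (𝓡 n) 2 γ (Icc 0 τ))
    {p : M} {s : ℝ} (hs : s ∈ Icc 0 τ) (hp : γ s ∈ (extChartAt (𝓡 n) p).source) :
    ContDiffWithinAt ℝ 1 (fieldCoord (velocity (n := n) τ γ) p) (Icc 0 τ) s := by
  have h := (contDiffWithinAt_chart_comp hγ hs hp).fderivWithin_right_apply
    (m := 1) (k := fun _ => (1 : ℝ)) contDiffWithinAt_const (uniqueDiffOn_Icc hτ) (by norm_num) hs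
  have hev : ∀ᶠ r in 𝓝[Icc 0 τ] s, γ r ∈ (extChartAt (𝓡 n) p).source :=
    (hγ.continuousOn s hs).eventually_mem ((isOpen_extChartAt_source p).mem_nhds hp)
  refine h.congr_of_eventuallyEq ?_ (fieldCoord_velocity hτ hγ hs hp)
  filter_upwards [hev, self_mem_nhdsWithin] with r hr hr'
  exact fieldCoord_velocity hτ hγ hr' hr

namespace IsGeodesic

variable (hγ : IsGeodesic A L τ γ) (hτ : 0 < τ)
include hγ

theorem eventually_mem_source {s : ℝ} (hs : s ∈ Icc 0 τ) {p : M}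
    (hp : γ s ∈ (extChartAt (𝓡 n) p).source) :
    ∀ᶠ r in 𝓝[Icc 0 τ] s, γ r ∈ (extChartAt (𝓡 n) p).source :=
  (hγ.contMDiffOn.continuousOn s hs).eventually_mem ((isOpen_extChartAt_source p).mem_nhds hp)

include hτ

/-- The coordinates of the velocity are `C¹`. -/
theorem contDiffWithinAt_tangentCoord {p : M} {s : ℝ} (hs : s ∈ Icc 0 τ)
    (hp : γ s ∈ (extChartAt (𝓡 n) p).source) :
    ContDiffWithinAt ℝ 1 (fun r => tangentCoord (n := n) p ⟨γ r, velocity τ γ r⟩)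
      (Icc 0 τ) s := by
  have h := (contDiffWithinAt_chart_comp hγ.contMDiffOn hs hp).of_le (m := 1) (by norm_num)
  exact h.prodMk (contDiffWithinAt_velocity hτ hγ.contMDiffOn hs hp)

/-- The geodesic equation at t, rewritten as the first order system of the spray in the chart at γ
t. -/
theorem hasDerivWithinAt_tangentCoord {t : ℝ} (ht : t ∈ Icc 0 τ) :
    HasDerivWithinAt (fun r => tangentCoord (γ t) ⟨γ r, velocity τ γ r⟩)
      ((tangentCoord (γ t) ⟨γ t, velocity τ γ t⟩).2,
        -chernGammaVec (localLagrangian L (γ t)) (tangentCoord (γ t) ⟨γ t, velocity τ γ t⟩)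
          (tangentCoord (γ t) ⟨γ t, velocity τ γ t⟩).2
          (tangentCoord (γ t) ⟨γ t, velocity τ γ t⟩).2) (Icc 0 τ) t := by
  have hp := mem_extChartAt_source (I := 𝓡 n) (γ t)
  have h1 := ((contDiffWithinAt_chart_comp hγ.contMDiffOn ht hp).differentiableWithinAt
    (by norm_num)).hasDerivWithinAt
  rw [← fieldCoord_velocity hτ hγ.contMDiffOn ht hp] at h1
  have h2 := ((contDiffWithinAt_velocity hτ hγ.contMDiffOn ht hp).differentiableWithinAt
    (by norm_num)).hasDerivWithinAt
  have h3 : derivWithin (fieldCoord (velocity (n := n) τ γ) (γ t)) (Icc 0 τ) t =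
      -chernGammaVec (localLagrangian L (γ t)) (tangentCoord (γ t) ⟨γ t, velocity τ γ t⟩)
        (velocity τ γ t) (velocity τ γ t) :=
    eq_neg_of_add_eq_zero_left (hγ.parallel t ht)
  rw [h3] at h2
  rw [tangentCoord_self_snd]
  have h4 := h1.prodMk h2
  rw [fieldCoord_self] at h4
  exact h4

theorem differentiableWithinAt_velocity {t : ℝ} (ht : t ∈ Icc 0 τ) :
    DifferentiableWithinAt ℝ (fieldCoord (velocity (n := n) τ γ) (γ t)) (Icc 0 τ) t :=
  (contDiffWithinAt_velocity hτ hγ.contMDiffOn ht (mem_extChartAt_source _)).differentiableWithinAt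
    (by norm_num)

variable (hL : IsPseudoFinslerMetric A L)
include hL

/-- Transfers the local formula to the curve. Only differentiability at the single time t is
required, so it applies to Sobolev fields at almost every time. -/
theorem hasDerivWithinAt_fundTensor {V : FieldAlong (n := n) γ} {t : ℝ} (ht : t ∈ Icc 0 τ)
    (hV : DifferentiableWithinAt ℝ (fieldCoord V (γ t)) (Icc 0 τ) t) :
    HasDerivWithinAt (fun s => fundTensor L (velocity τ γ s) (V s) (velocity τ γ s))
      (fundTensor L (velocity τ γ t) (covDeriv L τ γ (velocity τ γ) V t) (velocity τ γ t))
      (Icc 0 τ) t := by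
  have hp := mem_extChartAt_source (I := 𝓡 n) (γ t)
  have h := (hL.isLocalFinsler (γ t)).hasDerivWithinAt_localForm
    (tangentCoord_mem_localDomain hp (hγ.admissible t ht))
    (hγ.hasDerivWithinAt_tangentCoord hτ ht) hV.hasDerivWithinAt
  have hval : ∀ s ∈ Icc 0 τ, γ s ∈ (extChartAt (𝓡 n) (γ t)).source →
      fundTensor L (velocity τ γ s) (V s) (velocity τ γ s) =
        localForm (localLagrangian L (γ t)) (tangentCoord (γ t) ⟨γ s, velocity τ γ s⟩)
          (fieldCoord V (γ t) s) (tangentCoord (γ t) ⟨γ s, velocity τ γ s⟩).2 := fun s hs hsp =>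
    hL.fundTensor_eq hsp (hγ.admissible s hs) _ _
  have hend := hL.fundTensor_eq_self (hγ.admissible t ht)
    (covDeriv L τ γ (velocity τ γ) V t) (velocity τ γ t)
  rw [hend]
  rw [tangentCoord_self_snd, fieldCoord_self] at h
  refine HasDerivWithinAt.congr_of_eventuallyEq h ?_ (hval t ht hp)
  · filter_upwards [hγ.eventually_mem_source ht hp, self_mem_nhdsWithin] with s hs hs'
    exact hval s hs' hs

/-- The derivative is g(Dγ̇, γ̇) = 0. -/
theorem fundTensor_velocity_eq {s t : ℝ} (hs : s ∈ Icc 0 τ) (ht : t ∈ Icc 0 τ) :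
    fundTensor L (velocity τ γ s) (velocity τ γ s) (velocity τ γ s) =
      fundTensor L (velocity τ γ t) (velocity τ γ t) (velocity τ γ t) := by
  have hd : ∀ t ∈ Icc 0 τ, HasDerivWithinAt
      (fun s => fundTensor L (velocity τ γ s) (velocity τ γ s) (velocity τ γ s)) 0 (Icc 0 τ) t := by
    intro t ht
    have h := hγ.hasDerivWithinAt_fundTensor hτ hL ht (hγ.differentiableWithinAt_velocity hτ ht)
    have h0 := hL.fundTensor_smul_left (hγ.admissible t ht) 0 0 (velocity τ γ t)
    rw [zero_smul, zero_mul] at h0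
    rwa [hγ.parallel t ht, h0] at h
  have hc := constant_of_derivWithin_zero (fun t ht => (hd t ht).differentiableWithinAt)
    (fun t ht => (hd t (Ico_subset_Icc_self ht)).derivWithin
      (uniqueDiffOn_Icc hτ t (Ico_subset_Icc_self ht)))
  exact (hc s hs).trans (hc t ht).symm

end IsGeodesic

theorem covDeriv_add {V W : FieldAlong (n := n) γ} {t : ℝ}
    (hV : DifferentiableWithinAt ℝ (fieldCoord V (γ t)) (Icc 0 τ) t)
    (hW : DifferentiableWithinAt ℝ (fieldCoord W (γ t)) (Icc 0 τ) t) (ξ : FieldAlong (n := n) γ) :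
    covDeriv L τ γ ξ (V + W) t = covDeriv L τ γ ξ V t + covDeriv L τ γ ξ W t := by
  have h : derivWithin (fieldCoord (V + W) (γ t)) (Icc 0 τ) t =
      derivWithin (fieldCoord V (γ t)) (Icc 0 τ) t +
        derivWithin (fieldCoord W (γ t)) (Icc 0 τ) t := by
    rw [← derivWithin_add hV hW]
    congr 1
    ext1 s
    exact fieldCoord_add V W _ s
  have h2 := chernGammaVec_add_left (ℓ := localLagrangian L (γ t))
    (z := tangentCoord (γ t) ⟨γ t, ξ t⟩) (V t) (W t) (velocity τ γ t)
  calc _ = _ := congrArg₂ (· + ·) h h2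
    _ = _ := add_add_add_comm _ _ _ _

theorem covDeriv_smul {h : ℝ → ℝ} {V : FieldAlong (n := n) γ} {t : ℝ} (hτ : 0 < τ)
    (ht : t ∈ Icc 0 τ) (hh : DifferentiableWithinAt ℝ h (Icc 0 τ) t)
    (hV : DifferentiableWithinAt ℝ (fieldCoord V (γ t)) (Icc 0 τ) t) (ξ : FieldAlong (n := n) γ) :
    covDeriv L τ γ ξ (fun t => h t • V t) t =
      derivWithin h (Icc 0 τ) t • V t + h t • covDeriv L τ γ ξ V t := by
  have h1 : derivWithin (fieldCoord (fun t => h t • V t : FieldAlong (n := n) γ) (γ t))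
      (Icc 0 τ) t = h t • derivWithin (fieldCoord V (γ t)) (Icc 0 τ) t +
        derivWithin h (Icc 0 τ) t • fieldCoord V (γ t) t := by
    rw [← (hh.hasDerivWithinAt.smul hV.hasDerivWithinAt).derivWithin (uniqueDiffOn_Icc hτ t ht)]
    congr 1
    ext1 s
    exact fieldCoord_smul h V _ s
  rw [fieldCoord_self] at h1
  have h2 := chernGammaVec_smul_left (ℓ := localLagrangian L (γ t))
    (z := tangentCoord (γ t) ⟨γ t, ξ t⟩) (h t) (V t) (velocity τ γ t)
  have h3 : ∀ (a c d : EuclideanSpace ℝ (Fin n)) (k : ℝ),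
      (k • a + c) + k • d = c + k • (a + d) := fun a c d k => by
    rw [smul_add]; abel
  calc _ = _ := congrArg₂ (· + ·) h1 h2
    _ = _ := h3 _ _ _ _

theorem IsGeodesic.covDeriv_smul_velocity (hγ : IsGeodesic A L τ γ) (hτ : 0 < τ) {h : ℝ → ℝ}
    {t : ℝ} (ht : t ∈ Icc 0 τ) (hh : DifferentiableWithinAt ℝ h (Icc 0 τ) t) :
    covDeriv L τ γ (velocity τ γ) (fun t => h t • velocity τ γ t) t =
      derivWithin h (Icc 0 τ) t • velocity τ γ t := by
  rw [covDeriv_smul hτ ht hh (hγ.differentiableWithinAt_velocity hτ ht), hγ.parallel t ht,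
    smul_zero, add_zero]

/-- The integrand of the index form. -/
def indexIntegrand (L : TangentBundle (𝓡 n) M → ℝ) (τ : ℝ) (γ : ℝ → M)
    (V W : FieldAlong (n := n) γ) (t : ℝ) : ℝ :=
  fundTensor L (velocity τ γ t)
      (chernCurv L (velocity τ γ t) (velocity τ γ t) (V t) (velocity τ γ t)) (W t) +
    fundTensor L (velocity τ γ t)
      (covDeriv L τ γ (velocity τ γ) V t) (covDeriv L τ γ (velocity τ γ) W t)

theorem indexForm_eq (k : ℕ) (P : Set M) [ChartedSpace (EuclideanSpace ℝ (Fin k)) P]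
    (l : ℕ) (Q : Set M) [ChartedSpace (EuclideanSpace ℝ (Fin l)) Q]
    (h₀ : γ 0 ∈ P) (h₁ : γ τ ∈ Q) (V W : FieldAlong (n := n) γ) :
    indexForm A L τ γ k P l Q h₀ h₁ V W = (∫ t in (0 : ℝ)..τ, indexIntegrand L τ γ V W t) +
      fundTensor L (velocity τ γ 0)
        (shapeOp k P A L ⟨γ 0, h₀⟩ (velocity τ γ 0) (V 0)) (W 0) -
      fundTensor L (velocity τ γ τ)
        (shapeOp l Q A L ⟨γ τ, h₁⟩ (velocity τ γ τ) (V τ)) (W τ) :=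
  rfl

namespace IsGeodesic

variable (hγ : IsGeodesic A L τ γ) (hτ : 0 < τ) (hL : IsPseudoFinslerMetric A L)
  {V W V' W' : FieldAlong (n := n) γ} {h k : ℝ → ℝ} {t : ℝ} (ht : t ∈ Icc 0 τ)
include hγ hL ht

theorem indexIntegrand_add_left
    (hV : DifferentiableWithinAt ℝ (fieldCoord V (γ t)) (Icc 0 τ) t)
    (hV' : DifferentiableWithinAt ℝ (fieldCoord V' (γ t)) (Icc 0 τ) t) :
    indexIntegrand L τ γ (V + V') W t =
      indexIntegrand L τ γ V W t + indexIntegrand L τ γ V' W t := by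
  have hA := hγ.admissible t ht
  rw [indexIntegrand, covDeriv_add hV hV', Pi.add_apply, chernCurv_add_mid,
    hL.fundTensor_add_left hA, hL.fundTensor_add_left hA, indexIntegrand, indexIntegrand]
  ring

theorem indexIntegrand_add_right
    (hW : DifferentiableWithinAt ℝ (fieldCoord W (γ t)) (Icc 0 τ) t)
    (hW' : DifferentiableWithinAt ℝ (fieldCoord W' (γ t)) (Icc 0 τ) t) :
    indexIntegrand L τ γ V (W + W') t =
      indexIntegrand L τ γ V W t + indexIntegrand L τ γ V W' t := by
  have hA := hγ.admissible t ht
  rw [indexIntegrand, covDeriv_add hW hW', Pi.add_apply,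
    hL.fundTensor_add_right hA, hL.fundTensor_add_right hA, indexIntegrand, indexIntegrand]
  ring

include hτ

/-- g(DV, γ̇) is the derivative of g(V, γ̇), which is identically zero. -/
theorem fundTensor_covDeriv_eq_zero
    (hV : DifferentiableWithinAt ℝ (fieldCoord V (γ t)) (Icc 0 τ) t)
    (hperp : ∀ s ∈ Icc 0 τ, fundTensor L (velocity τ γ s) (V s) (velocity τ γ s) = 0) :
    fundTensor L (velocity τ γ t) (covDeriv L τ γ (velocity τ γ) V t) (velocity τ γ t) = 0 := by
  have h1 := (hγ.hasDerivWithinAt_fundTensor hτ hL ht hV).congr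
    (fun s hs => (hperp s hs).symm) (hperp t ht).symm
  exact (uniqueDiffOn_Icc hτ t ht).eq_deriv _ h1 (hasDerivWithinAt_const _ _ _)

/-- The curvature term is h g(R(γ̇, V)γ̇, γ̇) = 0 and the derivative term is h' g(DV, γ̇) = 0. -/
theorem indexIntegrand_smul_velocity_right
    (hV : DifferentiableWithinAt ℝ (fieldCoord V (γ t)) (Icc 0 τ) t)
    (hperp : ∀ s ∈ Icc 0 τ, fundTensor L (velocity τ γ s) (V s) (velocity τ γ s) = 0)
    (hh : DifferentiableWithinAt ℝ h (Icc 0 τ) t) :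
    indexIntegrand L τ γ V (fun t => h t • velocity τ γ t) t = 0 := by
  have hA := hγ.admissible t ht
  rw [indexIntegrand, hγ.covDeriv_smul_velocity hτ ht hh, hL.fundTensor_smul_right hA,
    hL.fundTensor_smul_right hA, hL.fundTensor_chernCurv hA,
    hγ.fundTensor_covDeriv_eq_zero hτ hL ht hV hperp]
  ring

/-- Here the curvature term vanishes by antisymmetry, R(γ̇, hγ̇) = 0; symmetry of the index form
does not have to be established. -/
theorem indexIntegrand_smul_velocity_left
    (hV : DifferentiableWithinAt ℝ (fieldCoord V (γ t)) (Icc 0 τ) t)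
    (hperp : ∀ s ∈ Icc 0 τ, fundTensor L (velocity τ γ s) (V s) (velocity τ γ s) = 0)
    (hh : DifferentiableWithinAt ℝ h (Icc 0 τ) t) :
    indexIntegrand L τ γ (fun t => h t • velocity τ γ t) V t = 0 := by
  have hA := hγ.admissible t ht
  have h0 := hL.fundTensor_smul_left hA 0 0 (V t)
  rw [zero_smul, zero_mul] at h0
  rw [indexIntegrand, hγ.covDeriv_smul_velocity hτ ht hh, hL.fundTensor_smul_left hA,
    chernCurv_smul_self, hL.fundTensor_symm hA (velocity τ γ t),
    hγ.fundTensor_covDeriv_eq_zero hτ hL ht hV hperp, h0]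
  ring

theorem indexIntegrand_smul_velocity_smul_velocity
    (hh : DifferentiableWithinAt ℝ h (Icc 0 τ) t) (hk : DifferentiableWithinAt ℝ k (Icc 0 τ) t) :
    indexIntegrand L τ γ (fun t => h t • velocity τ γ t) (fun t => k t • velocity τ γ t) t =
      fundTensor L (velocity τ γ t) (velocity τ γ t) (velocity τ γ t) *
        (derivWithin h (Icc 0 τ) t * derivWithin k (Icc 0 τ) t) := by
  have hA := hγ.admissible t ht
  have h0 := hL.fundTensor_smul_left hA 0 0 (velocity τ γ t)
  rw [zero_smul, zero_mul] at h0
  rw [indexIntegrand, hγ.covDeriv_smul_velocity hτ ht hh,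
    hγ.covDeriv_smul_velocity hτ ht hk, hL.fundTensor_smul_left hA,
    hL.fundTensor_smul_right hA, hL.fundTensor_smul_right hA, chernCurv_smul_self, h0]
  ring

end IsGeodesic

end Geodesic

/-! ## Local primitives of square integrable functions -/

section Primitive

variable {E F : Type*} [NormedAddCommGroup E] [NormedSpace ℝ E]
  [NormedAddCommGroup F] [NormedSpace ℝ F] {τ t₀ : ℝ}

/-- On `[0, τ]` near `t₀`, the function `u` is the indefinite integral of a square integrable
function. -/
def IsLocalPrimitive (τ t₀ : ℝ) (u : ℝ → E) : Prop :=
  ∃ f : ℝ → E, MemLp f 2 volume ∧ ∀ᶠ s in 𝓝[Icc 0 τ] t₀, u s = u t₀ + ∫ r in t₀..s, f r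

theorem locallyIntegrable_of_memLp_two {E : Type*} [NormedAddCommGroup E] {f : ℝ → E} (hf : MemLp f 2 volume) :
    LocallyIntegrable f volume :=
  hf.locallyIntegrable (by norm_num)

theorem intervalIntegrable_of_memLp_two {E : Type*} [NormedAddCommGroup E] {f : ℝ → E} (hf : MemLp f 2 volume) (a b : ℝ) :
    IntervalIntegrable f volume a b :=
  intervalIntegrable_iff.mpr (((locallyIntegrable_of_memLp_two hf).integrableOn_isCompact
    isCompact_uIcc).mono_set uIoc_subset_uIcc)

theorem IsLocalPrimitive.clm_comp [CompleteSpace E] [CompleteSpace F] {u : ℝ → E} (hu : IsLocalPrimitive τ t₀ u) (T : E →L[ℝ] F) :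
    IsLocalPrimitive τ t₀ (fun s => T (u s)) := by
  obtain ⟨f, hf, h⟩ := hu
  refine ⟨fun r => T (f r), T.comp_memLp' hf, ?_⟩
  filter_upwards [h] with s hs
  rw [hs, map_add, T.intervalIntegral_comp_comm (intervalIntegrable_of_memLp_two hf _ _)]

theorem IsLocalPrimitive.add {u v : ℝ → E} (hu : IsLocalPrimitive τ t₀ u)
    (hv : IsLocalPrimitive τ t₀ v) : IsLocalPrimitive τ t₀ (fun s => u s + v s) := by
  obtain ⟨f, hf, h⟩ := hu
  obtain ⟨g, hg, h'⟩ := hv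
  refine ⟨fun r => f r + g r, hf.add hg, ?_⟩
  filter_upwards [h, h'] with s hs hs'
  rw [hs, hs', intervalIntegral.integral_add (intervalIntegrable_of_memLp_two hf _ _)
    (intervalIntegrable_of_memLp_two hg _ _)]
  abel

theorem IsLocalPrimitive.sub [CompleteSpace E] {u v : ℝ → E} (hu : IsLocalPrimitive τ t₀ u)
    (hv : IsLocalPrimitive τ t₀ v) : IsLocalPrimitive τ t₀ (fun s => u s - v s) := by
  have h := hu.add (hv.clm_comp (-ContinuousLinearMap.id ℝ E))
  simpa [sub_eq_add_neg] using h

theorem isLocalPrimitive_zero : IsLocalPrimitive τ t₀ (fun _ => (0 : E)) :=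
  ⟨fun _ => 0, MemLp.zero, by simp⟩

theorem IsLocalPrimitive.sum {ι : Type*} {s : Finset ι} {u : ι → ℝ → E}
    (hu : ∀ i ∈ s, IsLocalPrimitive τ t₀ (u i)) :
    IsLocalPrimitive τ t₀ (fun r => ∑ i ∈ s, u i r) := by
  classical
  induction s using Finset.induction_on with
  | empty => simpa using isLocalPrimitive_zero
  | insert a s ha ih =>
    simp only [Finset.sum_insert ha]
    exact (hu a (Finset.mem_insert_self a s)).add
      (ih fun i hi => hu i (Finset.mem_insert_of_mem hi))

theorem IsLocalPrimitive.congr {u v : ℝ → E} (hu : IsLocalPrimitive τ t₀ u)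
    (h : v =ᶠ[𝓝[Icc 0 τ] t₀] u) (h₀ : v t₀ = u t₀) : IsLocalPrimitive τ t₀ v := by
  obtain ⟨f, hf, hfu⟩ := hu
  refine ⟨f, hf, ?_⟩
  filter_upwards [hfu, h] with s hs hs'
  rw [hs', hs, h₀]

/-- A relative neighbourhood contains a nondegenerate closed interval, one-sided when t₀ is an
endpoint of [0, τ]. -/
theorem exists_Icc_of_eventually (hτ : 0 < τ) (ht : t₀ ∈ Icc 0 τ) {p : ℝ → Prop}
    (h : ∀ᶠ s in 𝓝[Icc 0 τ] t₀, p s) :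
    ∃ α β, α < β ∧ t₀ ∈ Icc α β ∧ Icc α β ⊆ Icc 0 τ ∧ Icc α β ∈ 𝓝[Icc 0 τ] t₀ ∧
      ∀ s ∈ Icc α β, p s := by
  obtain ⟨ε, hε, hp⟩ := Metric.mem_nhdsWithin_iff.1 h
  have hsub : Icc (max 0 (t₀ - ε / 2)) (min τ (t₀ + ε / 2)) ⊆ Icc 0 τ := fun s hs =>
    ⟨(le_max_left _ _).trans hs.1, hs.2.trans (min_le_left _ _)⟩
  refine ⟨max 0 (t₀ - ε / 2), min τ (t₀ + ε / 2), ?_, ⟨?_, ?_⟩, hsub, ?_, ?_⟩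
  · exact max_lt (lt_min hτ (by linarith [ht.1])) (lt_min (by linarith [ht.2]) (by linarith))
  · exact max_le ht.1 (by linarith)
  · exact le_min ht.2 (by linarith)
  · refine Metric.mem_nhdsWithin_iff.2 ⟨ε / 2, by positivity, fun s hs => ?_⟩
    have h1 := abs_lt.1 (Real.dist_eq s t₀ ▸ Metric.mem_ball.1 hs.1)
    exact ⟨max_le hs.2.1 (by linarith), le_min hs.2.2 (by linarith)⟩
  · intro s hs
    refine hp ⟨Metric.mem_ball.2 ?_, hsub hs⟩
    rw [Real.dist_eq, abs_lt]
    have h1 := (le_max_right _ _).trans hs.1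
    have h2 := hs.2.trans (min_le_right _ _)
    constructor <;> linarith

/-- The product of a local primitive with a `C¹` function is a local primitive. -/
theorem IsLocalPrimitive.mul_contDiff (hτ : 0 < τ) (ht : t₀ ∈ Icc 0 τ) {u a : ℝ → ℝ}
    (hu : IsLocalPrimitive τ t₀ u) (ha : ContDiffWithinAt ℝ 1 a (Icc 0 τ) t₀) :
    IsLocalPrimitive τ t₀ (fun s => a s * u s) := by
  obtain ⟨f, hf, hfu⟩ := hu
  have ha' := ha.eventually (by norm_num)
  rw [insert_eq_of_mem ht] at ha'
  obtain ⟨α, β, hαβ, ht', hsub, hnhds, hI⟩ := exists_Icc_of_eventually hτ ht (hfu.and ha')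
  have haC : ContDiffOn ℝ 1 a (Icc α β) := fun s hs => (hI s hs).2.mono hsub
  -- g agrees with u on [α, β] and is defined, continuous and absolutely continuous everywhere.
  set g : ℝ → ℝ := fun s => u t₀ + ∫ r in t₀..s, f r with hg
  have hgac : ∀ s, AbsolutelyContinuousOnInterval g t₀ s := fun s =>
    ((LipschitzWith.const (u t₀)).lipschitzOnWith).absolutelyContinuousOnInterval.fun_add
      ((intervalIntegrable_of_memLp_two hf t₀ s).absolutelyContinuousOnInterval_intervalIntegral
        left_mem_uIcc)
  have hgcont : ContinuousOn g (Icc α β) :=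
    ((continuous_const.add (intervalIntegral.continuous_primitive
      (fun a b => intervalIntegrable_of_memLp_two hf a b) t₀))).continuousOn
  have ha'cont : ContinuousOn (derivWithin a (Icc α β)) (Icc α β) :=
    haC.continuousOn_derivWithin (uniqueDiffOn_Icc hαβ) le_rfl
  -- The density given by the product rule. After cutting off to [α, β] it is globally in L²: a'g is
  -- bounded there, and a f is a bounded function times an L² function.
  refine ⟨(Icc α β).indicator fun r => derivWithin a (Icc α β) r * g r + a r * f r, ?_, ?_⟩
  · rw [memLp_indicator_iff_restrict measurableSet_Icc]
    refine MemLp.add ?_ ?_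
    · obtain ⟨C, hC⟩ := isCompact_Icc.exists_bound_of_continuousOn (ha'cont.mul hgcont)
      refine MemLp.of_bound ((ha'cont.mul hgcont).aestronglyMeasurable measurableSet_Icc) C ?_
      filter_upwards [ae_restrict_mem measurableSet_Icc] with r hr using hC r hr
    · obtain ⟨C, hC⟩ := isCompact_Icc.exists_bound_of_continuousOn haC.continuousOn
      refine MemLp.of_le_mul (c := C) (hf.restrict (Icc α β))
        ((haC.continuousOn.aestronglyMeasurable measurableSet_Icc).mul
          hf.aestronglyMeasurable.restrict) ?_
      filter_upwards [ae_restrict_mem measurableSet_Icc] with r hr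
      rw [norm_mul]
      exact mul_le_mul_of_nonneg_right (hC r hr) (norm_nonneg _)
  · filter_upwards [hnhds] with s hs
    have hss : uIcc t₀ s ⊆ Icc α β := uIcc_subset_Icc ht' hs
    have key := AbsolutelyContinuousOnInterval.integral_deriv_mul_eq_sub
      ((haC.mono hss).absolutelyContinuousOnInterval) (hgac s)
    have hg0 : g t₀ = u t₀ := by simp [hg]
    rw [hg0] at key
    have hus : u s = g s := (hI s hs).1
    have hint : ∫ r in t₀..s, (Icc α β).indicator
        (fun r => derivWithin a (Icc α β) r * g r + a r * f r) r =
        ∫ r in t₀..s, (deriv a r * g r + a r * deriv g r) := by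
      refine intervalIntegral.integral_congr_ae ?_
      -- At α and β the one-sided and two-sided derivatives may differ, so these two points are
      -- discarded.
      filter_upwards [LocallyIntegrable.ae_hasDerivAt_integral (locallyIntegrable_of_memLp_two hf),
        compl_mem_ae_iff.2 (measure_singleton α), compl_mem_ae_iff.2 (measure_singleton β)]
        with r hr hrα hrβ hrs
      have hrI : r ∈ Icc α β := hss (uIoc_subset_uIcc hrs)
      have hrn : Icc α β ∈ 𝓝 r :=
        Icc_mem_nhds (lt_of_le_of_ne hrI.1 (Ne.symm hrα)) (lt_of_le_of_ne hrI.2 hrβ)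
      rw [indicator_of_mem hrI, derivWithin_of_mem_nhds hrn,
        ((hr t₀).const_add (u t₀)).deriv]
    rw [hint, key, hus]
    ring

theorem IsLocalPrimitive.smul_contDiff {n : ℕ} (hτ : 0 < τ) (ht : t₀ ∈ Icc 0 τ) {u : ℝ → ℝ}
    {a : ℝ → EuclideanSpace ℝ (Fin n)}
    (hu : IsLocalPrimitive τ t₀ u) (ha : ContDiffWithinAt ℝ 1 a (Icc 0 τ) t₀) :
    IsLocalPrimitive τ t₀ (fun s => u s • a s) := by
  have h : ∀ i, IsLocalPrimitive τ t₀ (fun s => a s i * u s) := fun i =>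
    hu.mul_contDiff hτ ht
      ((EuclideanSpace.proj (𝕜 := ℝ) i).contDiff.contDiffAt.comp_contDiffWithinAt t₀ ha)
  have h2 := IsLocalPrimitive.sum (s := Finset.univ) fun i _ =>
    (h i).clm_comp (ContinuousLinearMap.toSpanSingleton ℝ (stdVec i))
  have h3 : ∀ s, u s • a s =
      ∑ i, ContinuousLinearMap.toSpanSingleton ℝ (stdVec i) (a s i * u s) := fun s => by
    conv_lhs => rw [← sum_smul_stdVec (a s)]
    simp only [ContinuousLinearMap.toSpanSingleton_apply, Finset.smul_sum, smul_smul, mul_comm]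
  exact h2.congr (Eventually.of_forall h3) (h3 t₀)

/-- Lebesgue differentiation: the derivative is almost everywhere the density in the integral
representation. -/
theorem IsLocalPrimitive.exists_ae_hasDerivWithinAt [CompleteSpace E] (hτ : 0 < τ) (ht : t₀ ∈ Icc 0 τ) {u : ℝ → E}
    (hu : IsLocalPrimitive τ t₀ u) :
    ∃ f : ℝ → E, MemLp f 2 volume ∧ ∃ α β, Icc α β ∈ 𝓝[Icc 0 τ] t₀ ∧ t₀ ∈ Icc α β ∧
      (∀ s ∈ Icc α β, u s = u t₀ + ∫ r in t₀..s, f r) ∧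
      ∀ᵐ s, s ∈ Icc α β → HasDerivWithinAt u (f s) (Icc 0 τ) s := by
  obtain ⟨f, hf, hfu⟩ := hu
  obtain ⟨α, β, -, ht', -, hnhds, hI⟩ := exists_Icc_of_eventually hτ ht hfu
  refine ⟨f, hf, α, β, hnhds, ht', hI, ?_⟩
  filter_upwards [LocallyIntegrable.ae_hasDerivAt_integral (locallyIntegrable_of_memLp_two hf),
    compl_mem_ae_iff.2 (measure_singleton α), compl_mem_ae_iff.2 (measure_singleton β)]
    with r hr hrα hrβ hrI
  have hrn : Icc α β ∈ 𝓝 r :=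
    Icc_mem_nhds (lt_of_le_of_ne hrI.1 (Ne.symm hrα)) (lt_of_le_of_ne hrI.2 hrβ)
  exact (((hr t₀).const_add (u t₀)).congr_of_eventuallyEq
    (Filter.eventuallyEq_of_mem hrn hI)).hasDerivWithinAt

/-- A finite subcover leaves a finite union of null sets. -/
theorem ae_of_forall_nhdsWithin {K : Set ℝ} (hK : IsCompact K) {p : ℝ → Prop}
    (h : ∀ t ∈ K, ∃ V ∈ 𝓝[K] t, ∀ᵐ s, s ∈ V → p s) : ∀ᵐ s, s ∈ K → p s := by
  refine hK.induction_on (p := fun V => ∀ᵐ s, s ∈ V → p s) (by simp) ?_ ?_ h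
  · intro s t hst ht
    filter_upwards [ht] with r hr hrs using hr (hst hrs)
  · intro s t hs ht
    filter_upwards [hs, ht] with r hr hr' hrs using hrs.elim hr hr'

/-! ### Scalar local primitives on the whole interval. -/

section Scalar

variable {h : ℝ → ℝ} (hτ : 0 < τ) (hh : ∀ t ∈ Icc 0 τ, IsLocalPrimitive τ t h)
include hτ hh

theorem ae_differentiableWithinAt_of_isLocalPrimitive :
    ∀ᵐ t, t ∈ Icc 0 τ → DifferentiableWithinAt ℝ h (Icc 0 τ) t := by
  refine ae_of_forall_nhdsWithin isCompact_Icc fun t ht => ?_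
  obtain ⟨f, -, α, β, hV, -, -, hd⟩ := (hh t ht).exists_ae_hasDerivWithinAt hτ ht
  refine ⟨_, hV, ?_⟩
  filter_upwards [hd] with s hs hsV using (hs hsV).differentiableWithinAt

theorem integrableOn_derivWithin_sq :
    IntegrableOn (fun t => derivWithin h (Icc 0 τ) t ^ 2) (Icc 0 τ) volume := by
  have hloc : ∀ t ∈ Icc 0 τ, ∃ V ∈ 𝓝[Icc 0 τ] t,
      IntegrableOn (fun t => derivWithin h (Icc 0 τ) t ^ 2) (V ∩ Icc 0 τ) volume := by
    intro t ht
    obtain ⟨f, hf, α, β, hV, -, -, hd⟩ := (hh t ht).exists_ae_hasDerivWithinAt hτ ht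
    refine ⟨_, hV, ?_⟩
    refine IntegrableOn.congr_fun_ae (f := fun t => f t ^ 2) hf.integrable_sq.integrableOn ?_
    rw [EventuallyEq, ae_restrict_iff' (measurableSet_Icc.inter measurableSet_Icc)]
    filter_upwards [hd] with s hs hsV
    rw [(hs hsV.1).derivWithin (uniqueDiffOn_Icc hτ s hsV.2)]
  have := isCompact_Icc.induction_on
    (p := fun V => IntegrableOn (fun t => derivWithin h (Icc 0 τ) t ^ 2) (V ∩ Icc 0 τ) volume)
    (by simp) (fun s t hst ht => ht.mono_set (inter_subset_inter_left _ hst))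
    (fun s t hs ht => by rw [union_inter_distrib_right]; exact hs.union ht) hloc
  rwa [inter_self] at this

theorem intervalIntegrable_derivWithin_sq :
    IntervalIntegrable (fun t => derivWithin h (Icc 0 τ) t ^ 2) volume 0 τ := by
  rw [intervalIntegrable_iff, uIoc_of_le hτ.le]
  exact (integrableOn_derivWithin_sq hτ hh).mono_set Ioc_subset_Icc_self

/-- A derivative vanishing almost everywhere would not suffice for constancy. The integral
representation makes h locally constant, so its derivative vanishes everywhere. -/
theorem eq_of_integral_derivWithin_sq_eq_zero
    (h0 : ∫ t in (0 : ℝ)..τ, derivWithin h (Icc 0 τ) t ^ 2 = 0) :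
    ∀ t ∈ Icc 0 τ, h t = h 0 := by
  have hae : ∀ᵐ t, t ∈ Icc 0 τ → derivWithin h (Icc 0 τ) t = 0 := by
    rw [intervalIntegral.integral_of_le hτ.le, ← integral_Icc_eq_integral_Ioc,
      setIntegral_eq_zero_iff_of_nonneg_ae (Eventually.of_forall fun t => sq_nonneg _)
        (integrableOn_derivWithin_sq hτ hh), EventuallyEq,
      ae_restrict_iff' measurableSet_Icc] at h0
    filter_upwards [h0] with t ht ht' using pow_eq_zero_iff two_ne_zero |>.1 (ht ht')
  have hd : ∀ t ∈ Icc 0 τ, HasDerivWithinAt h 0 (Icc 0 τ) t := by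
    intro t ht
    obtain ⟨f, hf, α, β, hV, htV, hfu, hd⟩ := (hh t ht).exists_ae_hasDerivWithinAt hτ ht
    refine (hasDerivWithinAt_const t (Icc 0 τ) (h t)).congr_of_eventuallyEq ?_ rfl
    filter_upwards [hV, self_mem_nhdsWithin] with s hs hs'
    rw [hfu s hs, add_eq_left]
    refine intervalIntegral.integral_zero_ae ?_
    filter_upwards [hae, hd] with r hr hr' hrs
    have hrV := uIcc_subset_Icc htV hs (uIoc_subset_uIcc hrs)
    have hrI := uIcc_subset_Icc ht hs' (uIoc_subset_uIcc hrs)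
    rw [← (hr' hrV).derivWithin (uniqueDiffOn_Icc hτ r hrI), hr hrI]
  exact constant_of_derivWithin_zero (fun t ht => (hd t ht).differentiableWithinAt)
    (fun t ht => (hd t (Ico_subset_Icc_self ht)).derivWithin
      (uniqueDiffOn_Icc hτ t (Ico_subset_Icc_self ht)))

end Scalar

end Primitive

/-! ## Sobolev fields along a geodesic -/

section TangentialPart

variable {n : ℕ} {M : Type*} [TopologicalSpace M] [ChartedSpace (EuclideanSpace ℝ (Fin n)) M]
  {L : TangentBundle (𝓡 n) M → ℝ} {τ : ℝ} {γ : ℝ → M}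

/-- The coefficient of the tangential part of a field along `γ`. -/
def tanCoeff (L : TangentBundle (𝓡 n) M → ℝ) (τ : ℝ) (γ : ℝ → M) (X : FieldAlong (n := n) γ)
    (t : ℝ) : ℝ :=
  fundTensor L (velocity τ γ t) (X t) (velocity τ γ t) /
    fundTensor L (velocity τ γ t) (velocity τ γ t) (velocity τ γ t)

theorem tanPart_eq (X : FieldAlong (n := n) γ) :
    tanPart L τ γ X = fun t => tanCoeff L τ γ X t • velocity τ γ t :=
  rfl

theorem norPart_eq (X : FieldAlong (n := n) γ) : norPart L τ γ X = X - tanPart L τ γ X :=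
  rfl

theorem norPart_add_tanPart (X : FieldAlong (n := n) γ) :
    norPart L τ γ X + tanPart L τ γ X = X := by
  rw [norPart_eq, sub_add_cancel]

/-- Requires no admissibility of v, as one of the two parameters disappears; hence it can be applied
outside [0, τ], where bilinearity is not available. -/
theorem fundTensor_zero_left {p : M} (v w : TangentSpace (𝓡 n) p) : fundTensor L v 0 w = 0 := by
  simp [fundTensor]

theorem fundTensor_zero_right {p : M} (v u : TangentSpace (𝓡 n) p) : fundTensor L v u 0 = 0 := by
  simp [fundTensor]

theorem tanPart_eq_zero {X : FieldAlong (n := n) γ} {t : ℝ}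
    (h : fundTensor L (velocity τ γ t) (X t) (velocity τ γ t) = 0) : tanPart L τ γ X t = 0 := by
  rw [tanPart, h, zero_div, zero_smul]

theorem norPart_apply_of_tanPart_eq_zero {V : FieldAlong (n := n) γ} {t : ℝ}
    (h : tanPart L τ γ V t = 0) :
    norPart L τ γ V t = V t := by
  have h1 : norPart L τ γ V t = V t - tanPart L τ γ V t := rfl
  rw [h1, h, sub_zero]

end TangentialPart

section SobolevFields

variable {n : ℕ} {M : Type*} [TopologicalSpace M] [ChartedSpace (EuclideanSpace ℝ (Fin n)) M]
  [IsManifold (𝓡 n) 7 M] {A : Set (TangentBundle (𝓡 n) M)} {L : TangentBundle (𝓡 n) M → ℝ}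
  {τ : ℝ} {γ : ℝ → M}

theorem mem_W12_iff {V : FieldAlong (n := n) γ} : V ∈ W12 τ γ ↔ (∀ t, t ∉ Icc 0 τ → V t = 0) ∧
    ∀ t₀ ∈ Icc 0 τ, IsLocalPrimitive τ t₀ (fieldCoord V (γ t₀)) :=
  Iff.rfl

theorem isLocalPrimitive_fieldCoord {V : FieldAlong (n := n) γ} (hV : V ∈ W12 τ γ) {t₀ : ℝ}
    (ht₀ : t₀ ∈ Icc 0 τ) : IsLocalPrimitive τ t₀ (fieldCoord V (γ t₀)) :=
  hV.2 t₀ ht₀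

theorem differentiableOn_tangentCoordChange_comp (hγ : ContMDiffOn 𝓘(ℝ, ℝ) (𝓡 n) 2 γ (Icc 0 τ))
    {p q : M} {s : ℝ} (hs : s ∈ Icc 0 τ) (hp : γ s ∈ (extChartAt (𝓡 n) p).source)
    (hq : γ s ∈ (extChartAt (𝓡 n) q).source) :
    DifferentiableWithinAt ℝ (fun r => tangentCoordChange (𝓡 n) p q (γ r)) (Icc 0 τ) s := by
  have : IsManifold (𝓡 n) (1 + 1) M := IsManifold.of_le (n := 7) (by norm_num)
  have : (tangentBundleCore (𝓡 n) M).IsContMDiff (𝓡 n) 1 := tangentBundleCore.isContMDiff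
  rw [extChartAt_source] at hp hq
  have h1 := (tangentBundleCore (𝓡 n) M).contMDiffOn_coordChange (𝓡 n) (n := 1)
    (achart _ p) (achart _ q)
  have hopen : IsOpen ((chartAt (EuclideanSpace ℝ (Fin n)) p).source ∩
    (chartAt (EuclideanSpace ℝ (Fin n)) q).source) :=
    (chartAt _ p).open_source.inter (chartAt _ q).open_source
  have h2 := (h1.contMDiffAt (hopen.mem_nhds ⟨hp, hq⟩)).comp_contMDiffWithinAt s
    ((hγ s hs).of_le (by norm_num))
  exact (contMDiffWithinAt_iff_contDiffWithinAt.1 h2).differentiableWithinAt (by norm_num)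

namespace IsGeodesic

variable (hγ : IsGeodesic A L τ γ)
include hγ

theorem differentiableWithinAt_fieldCoord_change {V : FieldAlong (n := n) γ} {p q : M} {s : ℝ}
    (hs : s ∈ Icc 0 τ) (hp : γ s ∈ (extChartAt (𝓡 n) p).source)
    (hq : γ s ∈ (extChartAt (𝓡 n) q).source)
    (hV : DifferentiableWithinAt ℝ (fieldCoord V p) (Icc 0 τ) s) :
    DifferentiableWithinAt ℝ (fieldCoord V q) (Icc 0 τ) s := by
  have h := (differentiableOn_tangentCoordChange_comp hγ.contMDiffOn hs hp hq).clm_apply hV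
  have hval : ∀ r, γ r ∈ (extChartAt (𝓡 n) p).source → γ r ∈ (extChartAt (𝓡 n) q).source →
      fieldCoord V q r = tangentCoordChange (𝓡 n) p q (γ r) (fieldCoord V p r) := fun r hrp hrq =>
    (tangentCoordChange_comp ⟨⟨mem_extChartAt_source (γ r), hrp⟩, hrq⟩).symm
  refine h.congr_of_eventuallyEq ?_ (hval s hp hq)
  filter_upwards [hγ.eventually_mem_source hs hp, hγ.eventually_mem_source hs hq] with r hrp hrq
  exact hval r hrp hrq

variable (hτ : 0 < τ)
include hτ

/-- The integral representation lives in the chart at γ t₀, whereas `covDeriv` at s uses the chart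
at γ s. The transition maps are differentiable along γ, and compactness finishes. -/
theorem ae_differentiableWithinAt {V : FieldAlong (n := n) γ} (hV : V ∈ W12 τ γ) :
    ∀ᵐ t, t ∈ Icc 0 τ → DifferentiableWithinAt ℝ (fieldCoord V (γ t)) (Icc 0 τ) t := by
  refine ae_of_forall_nhdsWithin isCompact_Icc fun t₀ ht₀ => ?_
  obtain ⟨f, -, α, β, hS, -, -, hd⟩ :=
    (isLocalPrimitive_fieldCoord hV ht₀).exists_ae_hasDerivWithinAt hτ ht₀
  refine ⟨_, Filter.inter_mem (Filter.inter_mem hS self_mem_nhdsWithin)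
    (hγ.eventually_mem_source ht₀ (mem_extChartAt_source (γ t₀))), ?_⟩
  filter_upwards [hd] with s hs hsS
  exact hγ.differentiableWithinAt_fieldCoord_change hsS.1.2 hsS.2 (mem_extChartAt_source (γ s))
    (hs hsS.1.1).differentiableWithinAt

end IsGeodesic

namespace IsGeodesic

variable (hγ : IsGeodesic A L τ γ) (hτ : 0 < τ) (hL : IsPseudoFinslerMetric A L)
  {V : FieldAlong (n := n) γ}
include hγ hτ hL

/-- The denominator is constant, and g(V, γ̇) = ½ ∑ ℓ_{yⁱ}Vⁱ has coefficients that are C¹ along γ.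
-/
theorem isLocalPrimitive_tanCoeff (hV : V ∈ W12 τ γ) {t₀ : ℝ} (ht₀ : t₀ ∈ Icc 0 τ) :
    IsLocalPrimitive τ t₀ (tanCoeff L τ γ V) := by
  have hp := mem_extChartAt_source (I := 𝓡 n) (γ t₀)
  have H := hL.isLocalFinsler (γ t₀)
  have hz : tangentCoord (γ t₀) (⟨γ t₀, velocity τ γ t₀⟩ : TangentBundle (𝓡 n) M) ∈
    localDomain A (γ t₀) := tangentCoord_mem_localDomain hp (hγ.admissible t₀ ht₀)
  have ha : ∀ i, ContDiffWithinAt ℝ 1 (fun s => dy (localLagrangian L (γ t₀)) i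
      (tangentCoord (γ t₀) (⟨γ s, velocity τ γ s⟩ : TangentBundle (𝓡 n) M))) (Icc 0 τ) t₀ :=
    fun i => by
      have h := ((H.contDiffOn_dy_lagrangian i).contDiffAt (H.isOpen.mem_nhds hz)).of_le
        (m := 1) (by norm_num)
      exact h.comp_contDiffWithinAt t₀ (hγ.contDiffWithinAt_tangentCoord hτ ht₀ hp)
  have hprim : ∀ i, IsLocalPrimitive τ t₀ (fun s => fieldCoord V (γ t₀) s i) := fun i =>
    (isLocalPrimitive_fieldCoord hV ht₀).clm_comp
      (EuclideanSpace.proj (𝕜 := ℝ) i)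
  have hsum := (IsLocalPrimitive.sum (s := Finset.univ) fun i _ =>
    (hprim i).mul_contDiff hτ ht₀ (ha i)).clm_comp (ContinuousLinearMap.mul ℝ ℝ
      ((1 / 2) / fundTensor L (velocity τ γ t₀) (velocity τ γ t₀) (velocity τ γ t₀)))
  have hval : ∀ s ∈ Icc 0 τ, γ s ∈ (extChartAt (𝓡 n) (γ t₀)).source →
      tanCoeff L τ γ V s = ContinuousLinearMap.mul ℝ ℝ
        ((1 / 2) / fundTensor L (velocity τ γ t₀) (velocity τ γ t₀) (velocity τ γ t₀))
        (∑ i, dy (localLagrangian L (γ t₀)) i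
          (tangentCoord (γ t₀) (⟨γ s, velocity τ γ s⟩ : TangentBundle (𝓡 n) M)) *
            fieldCoord V (γ t₀) s i) := by
    intro s hs hsp
    have hA := hγ.admissible s hs
    have h1 := H.localForm_snd (tangentCoord_mem_localDomain hsp hA) (fieldCoord V (γ t₀) s)
    have h2 := (hL.fundTensor_eq hsp hA (V s) (velocity τ γ s)).trans h1
    rw [tanCoeff, hγ.fundTensor_velocity_eq hτ hL hs ht₀, h2, ContinuousLinearMap.mul_apply',
      Finset.sum_congr rfl fun i _ => mul_comm (fieldCoord V (γ t₀) s i) _]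
    ring
  refine hsum.congr ?_ (hval t₀ ht₀ hp)
  filter_upwards [hγ.eventually_mem_source ht₀ hp, self_mem_nhdsWithin] with s hs hs'
  exact hval s hs' hs

theorem tanPart_mem_W12 (hV : V ∈ W12 τ γ) : tanPart L τ γ V ∈ W12 τ γ := by
  refine mem_W12_iff.2 ⟨fun t ht => ?_, fun t₀ ht₀ => ?_⟩
  · exact tanPart_eq_zero (by rw [hV.1 t ht, fundTensor_zero_left])
  · have h := (hγ.isLocalPrimitive_tanCoeff hτ hL hV ht₀).smul_contDiff hτ ht₀
      (contDiffWithinAt_velocity hτ hγ.contMDiffOn ht₀ (mem_extChartAt_source (γ t₀)))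
    have h2 : fieldCoord (tanPart L τ γ V) (γ t₀) = fun s => tanCoeff L τ γ V s •
        fieldCoord (velocity (n := n) τ γ) (γ t₀) s := funext fun s => fieldCoord_smul _ _ _ _
    rwa [h2]

theorem norPart_mem_W12 (hV : V ∈ W12 τ γ) : norPart L τ γ V ∈ W12 τ γ := by
  have ht := hγ.tanPart_mem_W12 hτ hL hV
  refine mem_W12_iff.2 ⟨fun t h => ?_, fun t₀ ht₀ => ?_⟩
  · rw [norPart, hV.1 t h, ht.1 t h, sub_zero]
  · have h := (isLocalPrimitive_fieldCoord hV ht₀).sub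
      (isLocalPrimitive_fieldCoord ht ht₀)
    have h2 : fieldCoord (norPart L τ γ V) (γ t₀) = fun s => fieldCoord V (γ t₀) s -
        fieldCoord (tanPart L τ γ V) (γ t₀) s := funext fun s => fieldCoord_sub _ _ _ _
    rwa [h2]

end IsGeodesic

theorem fundTensor_norPart (hγ : IsGeodesic A L τ γ) (hL : IsPseudoFinslerMetric A L)
    {t : ℝ} (ht : t ∈ Icc 0 τ)
    (hc : fundTensor L (velocity τ γ t) (velocity τ γ t) (velocity τ γ t) ≠ 0)
    (V : FieldAlong (n := n) γ) :
    fundTensor L (velocity τ γ t) (norPart L τ γ V t) (velocity τ γ t) = 0 := by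
  have hA := hγ.admissible t ht
  have h : norPart L τ γ V t = V t + (-tanCoeff L τ γ V t) • velocity τ γ t := by
    rw [neg_smul, ← sub_eq_add_neg]
    rfl
  rw [h, hL.fundTensor_add_left hA, hL.fundTensor_smul_left hA, tanCoeff]
  field_simp
  ring

end SobolevFields

/-! ## Positive definiteness along a geodesic -/

section PositiveDefinite

variable {n : ℕ}

theorem localForm_smul_smul (ℓ : EuclideanSpace ℝ (Fin n) × EuclideanSpace ℝ (Fin n) → ℝ)
    (z : EuclideanSpace ℝ (Fin n) × EuclideanSpace ℝ (Fin n)) (c : ℝ)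
    (a : EuclideanSpace ℝ (Fin n)) :
    localForm ℓ z (c • a) (c • a) = c ^ 2 * localForm ℓ z a a := by
  simp only [localForm, PiLp.smul_apply, smul_eq_mul, Finset.mul_sum]
  exact Finset.sum_congr rfl fun _ _ => Finset.sum_congr rfl fun _ _ => by ring

namespace IsLocalFinsler

variable {ℓ : EuclideanSpace ℝ (Fin n) × EuclideanSpace ℝ (Fin n) → ℝ}
  {U : Set (EuclideanSpace ℝ (Fin n) × EuclideanSpace ℝ (Fin n))}
  {z : EuclideanSpace ℝ (Fin n) × EuclideanSpace ℝ (Fin n)} (H : IsLocalFinsler ℓ U) (hz : z ∈ U)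
include H hz

theorem continuousAt_localForm (a : EuclideanSpace ℝ (Fin n)) :
    ContinuousAt (fun x : (EuclideanSpace ℝ (Fin n) × EuclideanSpace ℝ (Fin n)) ×
      EuclideanSpace ℝ (Fin n) => localForm ℓ x.1 x.2 x.2) (z, a) := by
  refine tendsto_finsetSum _ fun i _ => tendsto_finsetSum _ fun j _ => ?_
  have hg : ContinuousAt (fun x : (EuclideanSpace ℝ (Fin n) × EuclideanSpace ℝ (Fin n)) ×
      EuclideanSpace ℝ (Fin n) => gLow ℓ i j x.1) (z, a) :=
    ContinuousAt.comp (g := gLow ℓ i j) (f := Prod.fst) (x := (z, a))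
      (H.differentiableAt_gLow hz i j).continuousAt
      continuousAt_fst
  have ha : ∀ i, ContinuousAt (fun x : (EuclideanSpace ℝ (Fin n) × EuclideanSpace ℝ (Fin n)) ×
      EuclideanSpace ℝ (Fin n) => x.2 i) (z, a) := fun i =>
    ((EuclideanSpace.proj (𝕜 := ℝ) i).continuous.comp continuous_snd).continuousAt
  exact (hg.mul (ha i)).mul (ha j)

theorem eq_zero_of_localForm_eq_zero {a : EuclideanSpace ℝ (Fin n)}
    (ha : ∀ w, localForm ℓ z w a = 0) : a = 0 := by
  by_contra hne
  refine H.det_ne_zero z hz (Matrix.exists_mulVec_eq_zero_iff.1 ⟨a, fun h => hne ?_, ?_⟩)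
  · ext i
    exact congrFun h i
  · ext i
    have h := ha (stdVec i)
    simpa [localForm, stdVec_apply, Matrix.mulVec, dotProduct, Finset.sum_ite_eq] using h

/-- For a semidefinite form, a null vector lies in the kernel, which is trivial by nondegeneracy. -/
theorem exists_localForm_neg (hnot : ¬ ∀ a, a ≠ 0 → 0 < localForm ℓ z a a) :
    ∃ a, localForm ℓ z a a < 0 := by
  by_contra! hpos
  push Not at hnot
  obtain ⟨a, ha0, ha⟩ := hnot
  have haa : localForm ℓ z a a = 0 := le_antisymm ha (hpos a)
  refine ha0 (H.eq_zero_of_localForm_eq_zero hz fun w => ?_)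
  have hexp : ∀ t : ℝ, localForm ℓ z (w + t • a) (w + t • a) =
      localForm ℓ z w w + 2 * t * localForm ℓ z w a := by
    intro t
    rw [localForm_add_left, localForm_smul_left, H.localForm_symm hz w, H.localForm_symm hz a,
      localForm_add_left, localForm_smul_left, localForm_add_left, localForm_smul_left, haa,
      H.localForm_symm hz a w]
    ring
  by_contra hne
  -- With a null, the form at w + t a is affine in t; this t gives it the value -1.
  have h := hpos (w + (-(localForm ℓ z w w + 1) / (2 * localForm ℓ z w a)) • a)
  rw [hexp] at h
  have : 2 * (-(localForm ℓ z w w + 1) / (2 * localForm ℓ z w a)) * localForm ℓ z w a =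
      -(localForm ℓ z w w + 1) := by
    field_simp
  linarith

/-- Positivity is open by compactness of the unit sphere. Its failure is open because it is
witnessed by a strictly negative vector. -/
theorem eventually_posDef_iff : ∀ᶠ z' in 𝓝 z,
    ((∀ a, a ≠ 0 → 0 < localForm ℓ z' a a) ↔ ∀ a, a ≠ 0 → 0 < localForm ℓ z a a) := by
  by_cases hpos : ∀ a, a ≠ 0 → 0 < localForm ℓ z a a
  · have hK : IsCompact (Metric.sphere (0 : EuclideanSpace ℝ (Fin n)) 1) := isCompact_sphere 0 1
    have h := hK.eventually_forall_of_forall_eventually (x₀ := z)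
      (P := fun z a => 0 < localForm ℓ z a a) fun a ha => by
        refine (H.continuousAt_localForm hz a).eventually (lt_mem_nhds (hpos a ?_))
        rintro rfl
        simp at ha
    filter_upwards [h] with z' hz'
    refine iff_of_true (fun a ha => ?_) hpos
    have hn : ‖a‖ ≠ 0 := norm_ne_zero_iff.2 ha
    have h1 := hz' (‖a‖⁻¹ • a) (by simp [norm_smul, hn])
    rw [localForm_smul_smul] at h1
    exact pos_of_mul_pos_right h1 (sq_nonneg _)
  · obtain ⟨a, ha⟩ := H.exists_localForm_neg hz hpos
    have hc : ContinuousAt (fun z' => localForm ℓ z' a a) z :=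
      ContinuousAt.comp (f := fun z' => (z', a)) (H.continuousAt_localForm hz a)
        (by fun_prop)
    filter_upwards [hc.eventually (gt_mem_nhds ha)] with z' hz'
    refine iff_of_false (fun h => ?_) hpos
    refine lt_asymm hz' (h a ?_)
    rintro rfl
    simp [localForm] at ha

end IsLocalFinsler

variable {M : Type*} [TopologicalSpace M] [ChartedSpace (EuclideanSpace ℝ (Fin n)) M]
  [IsManifold (𝓡 n) 7 M] {A : Set (TangentBundle (𝓡 n) M)} {L : TangentBundle (𝓡 n) M → ℝ}
  {τ : ℝ} {γ : ℝ → M}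

theorem IsPseudoFinslerMetric.posDef_iff (hL : IsPseudoFinslerMetric A L) {p q : M}
    (hq : q ∈ (extChartAt (𝓡 n) p).source) {v : TangentSpace (𝓡 n) q}
    (hv : (⟨q, v⟩ : TangentBundle (𝓡 n) M) ∈ A) :
    (∀ u : TangentSpace (𝓡 n) q, u ≠ 0 → 0 < fundTensor L v u u) ↔
      ∀ a, a ≠ 0 → 0 < localForm (localLagrangian L p) (tangentCoord p ⟨q, v⟩) a a := by
  constructor
  · intro h a ha
    obtain ⟨u, rfl⟩ : ∃ u : TangentSpace (𝓡 n) q, (tangentCoord p ⟨q, u⟩).2 = a :=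
      ⟨_, tangentCoordChange_cancel hq a⟩
    rw [← hL.fundTensor_eq hq hv]
    refine h u ?_
    rintro rfl
    exact ha (tangentCoordChange (𝓡 n) q p q).map_zero
  · intro h u hu
    rw [hL.fundTensor_eq hq hv]
    refine h _ fun h0 => hu ?_
    have h1 := tangentCoordChange_cancel' hq u
    rw [show tangentCoordChange (𝓡 n) q p q u = 0 from h0, map_zero] at h1
    exact h1.symm

/-- Along a geodesic, the fundamental tensor is positive definite at all times or at none. -/
theorem IsGeodesic.posDef_of_posDef (hγ : IsGeodesic A L τ γ) (hτ : 0 < τ)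
    (hL : IsPseudoFinslerMetric A L) {s t : ℝ} (hs : s ∈ Icc 0 τ) (ht : t ∈ Icc 0 τ)
    (h : ∀ u : TangentSpace (𝓡 n) (γ s), u ≠ 0 → 0 < fundTensor L (velocity τ γ s) u u) :
    ∀ u : TangentSpace (𝓡 n) (γ t), u ≠ 0 → 0 < fundTensor L (velocity τ γ t) u u := by
  refine (isPreconnected_Icc.induction₂ (fun s t =>
    (∀ u : TangentSpace (𝓡 n) (γ s), u ≠ 0 → 0 < fundTensor L (velocity τ γ s) u u) ↔
      ∀ u : TangentSpace (𝓡 n) (γ t), u ≠ 0 → 0 < fundTensor L (velocity τ γ t) u u)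
    (fun t ht => ?_) (fun _ _ _ _ _ _ => Iff.trans) (fun _ _ _ _ => Iff.symm) hs ht).1 h
  have hp := mem_extChartAt_source (I := 𝓡 n) (γ t)
  have hev := (hγ.contDiffWithinAt_tangentCoord hτ ht hp).continuousWithinAt.eventually
    ((hL.isLocalFinsler (γ t)).eventually_posDef_iff
      (tangentCoord_mem_localDomain hp (hγ.admissible t ht)))
  filter_upwards [hev, hγ.eventually_mem_source ht hp, self_mem_nhdsWithin] with r hr hr' hr''
  rw [hL.posDef_iff hp (hγ.admissible t ht), hL.posDef_iff hr' (hγ.admissible r hr'')]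
  exact hr.symm

end PositiveDefinite

/-! ## The index form on tangential and normal fields -/

section IndexForm

/-- Adding a nonnegative integrable function does not decrease an integral; `f` need not be
integrable, since then `f + g` is not integrable either. -/
theorem integral_le_integral_add {f g : ℝ → ℝ} {a b : ℝ} (hab : a ≤ b)
    (hg : IntervalIntegrable g volume a b) (hg0 : ∀ t, 0 ≤ g t) :
    ∫ t in a..b, f t ≤ ∫ t in a..b, (f t + g t) := by
  by_cases hf : IntervalIntegrable f volume a b
  · rw [intervalIntegral.integral_add hf hg]
    linarith [intervalIntegral.integral_nonneg_of_forall (μ := volume) hab hg0]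
  · have hfg : ¬ IntervalIntegrable (fun t => f t + g t) volume a b := fun h => hf (by
      simpa using h.sub hg)
    rw [intervalIntegral.integral_undef hf, intervalIntegral.integral_undef hfg]

variable {n : ℕ} {M : Type*} [TopologicalSpace M] [ChartedSpace (EuclideanSpace ℝ (Fin n)) M]
  [IsManifold (𝓡 n) 7 M] {A : Set (TangentBundle (𝓡 n) M)} {L : TangentBundle (𝓡 n) M → ℝ}
  {τ : ℝ} {γ : ℝ → M} {V W : FieldAlong (n := n) γ}

/-- The map `X ↦ nor_γ(X)` on fields that vanish outside `[0, τ]`, extended by the identity to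
a linear map on all fields. -/
def norLinear (hγ : IsGeodesic A L τ γ) (hL : IsPseudoFinslerMetric A L) :
    FieldAlong (n := n) γ →ₗ[ℝ] FieldAlong (n := n) γ := by
  classical
  exact
  -- Off [0, τ] the velocity need not lie in A, so linearity of nor is only available on [0, τ].
  { toFun := fun X t => if t ∈ Icc 0 τ then norPart L τ γ X t else X t
    map_add' := fun X Y => by
      funext t
      by_cases ht : t ∈ Icc 0 τ
      · simp only [ht, if_true, Pi.add_apply, norPart, tanPart,
          hL.fundTensor_add_left (hγ.admissible t ht), add_div, add_smul]
        abel
      · simp only [ht, if_false, Pi.add_apply]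
    map_smul' := fun c X => by
      funext t
      by_cases ht : t ∈ Icc 0 τ
      · simp only [ht, if_true, Pi.smul_apply, norPart, tanPart, RingHom.id_apply,
          hL.fundTensor_smul_left (hγ.admissible t ht), mul_div_assoc, mul_smul, smul_sub]
      · simp only [ht, if_false, Pi.smul_apply, RingHom.id_apply] }

theorem norLinear_apply (hγ : IsGeodesic A L τ γ) (hL : IsPseudoFinslerMetric A L)
    (hV : ∀ t, t ∉ Icc 0 τ → V t = 0) : norLinear hγ hL V = norPart L τ γ V := by
  funext t
  by_cases ht : t ∈ Icc 0 τ
  · exact if_pos ht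
  · have h0 : tanPart L τ γ V t = 0 :=
      tanPart_eq_zero (by rw [hV t ht, fundTensor_zero_left])
    rw [norPart_apply_of_tanPart_eq_zero h0]
    exact if_neg ht

namespace IsGeodesic

variable (hγ : IsGeodesic A L τ γ) (hτ : 0 < τ) (hL : IsPseudoFinslerMetric A L)
  (hc : ∀ t ∈ Icc 0 τ, fundTensor L (velocity τ γ t) (velocity τ γ t) (velocity τ γ t) ≠ 0)
include hγ hτ hL hc

theorem ae_indexIntegrand_norPart_tanPart (hV : V ∈ W12 τ γ) (hW : W ∈ W12 τ γ) :
    ∀ᵐ t, t ∈ Icc 0 τ → indexIntegrand L τ γ (norPart L τ γ V) (tanPart L τ γ W) t = 0 := by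
  filter_upwards [hγ.ae_differentiableWithinAt hτ (hγ.norPart_mem_W12 hτ hL hV),
    ae_differentiableWithinAt_of_isLocalPrimitive hτ
      fun t ht => hγ.isLocalPrimitive_tanCoeff hτ hL hW ht] with t h1 h2 ht
  exact hγ.indexIntegrand_smul_velocity_right hτ hL ht (h1 ht)
    (fun s hs => fundTensor_norPart hγ hL hs (hc s hs) V) (h2 ht)

theorem ae_indexIntegrand_tanPart_norPart (hV : V ∈ W12 τ γ) (hW : W ∈ W12 τ γ) :
    ∀ᵐ t, t ∈ Icc 0 τ → indexIntegrand L τ γ (tanPart L τ γ V) (norPart L τ γ W) t = 0 := by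
  filter_upwards [hγ.ae_differentiableWithinAt hτ (hγ.norPart_mem_W12 hτ hL hW),
    ae_differentiableWithinAt_of_isLocalPrimitive hτ
      fun t ht => hγ.isLocalPrimitive_tanCoeff hτ hL hV ht] with t h1 h2 ht
  exact hγ.indexIntegrand_smul_velocity_left hτ hL ht (h1 ht)
    (fun s hs => fundTensor_norPart hγ hL hs (hc s hs) W) (h2 ht)

theorem ae_indexIntegrand_norPart_right (hV : V ∈ W12 τ γ) (hW : W ∈ W12 τ γ) :
    ∀ᵐ t, t ∈ Icc 0 τ → indexIntegrand L τ γ (norPart L τ γ V) W t =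
      indexIntegrand L τ γ (norPart L τ γ V) (norPart L τ γ W) t := by
  filter_upwards [hγ.ae_indexIntegrand_norPart_tanPart hτ hL hc hV hW,
    hγ.ae_differentiableWithinAt hτ (hγ.norPart_mem_W12 hτ hL hW),
    hγ.ae_differentiableWithinAt hτ (hγ.tanPart_mem_W12 hτ hL hW)] with t h1 h2 h3 ht
  conv_lhs => rw [← norPart_add_tanPart (L := L) (τ := τ) W]
  rw [hγ.indexIntegrand_add_right hL ht (h2 ht) (h3 ht), h1 ht, add_zero]

theorem ae_indexIntegrand_tanPart_right (hV : V ∈ W12 τ γ) (hW : W ∈ W12 τ γ) :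
    ∀ᵐ t, t ∈ Icc 0 τ → indexIntegrand L τ γ V (tanPart L τ γ W) t =
      fundTensor L (velocity τ γ 0) (velocity τ γ 0) (velocity τ γ 0) *
        (derivWithin (tanCoeff L τ γ V) (Icc 0 τ) t *
          derivWithin (tanCoeff L τ γ W) (Icc 0 τ) t) := by
  filter_upwards [hγ.ae_indexIntegrand_norPart_tanPart hτ hL hc hV hW,
    hγ.ae_differentiableWithinAt hτ (hγ.norPart_mem_W12 hτ hL hV),
    hγ.ae_differentiableWithinAt hτ (hγ.tanPart_mem_W12 hτ hL hV),
    ae_differentiableWithinAt_of_isLocalPrimitive hτ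
      fun t ht => hγ.isLocalPrimitive_tanCoeff hτ hL hV ht,
    ae_differentiableWithinAt_of_isLocalPrimitive hτ
      fun t ht => hγ.isLocalPrimitive_tanCoeff hτ hL hW ht] with t h1 h2 h3 h4 h5 ht
  conv_lhs => rw [← norPart_add_tanPart (L := L) (τ := τ) V]
  rw [hγ.indexIntegrand_add_left hL ht (h2 ht) (h3 ht), h1 ht, zero_add, tanPart_eq, tanPart_eq,
    hγ.indexIntegrand_smul_velocity_smul_velocity hτ hL ht (h4 ht) (h5 ht),
    hγ.fundTensor_velocity_eq hτ hL ht (left_mem_Icc.2 hτ.le)]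

theorem ae_indexIntegrand_self (hV : V ∈ W12 τ γ) :
    ∀ᵐ t, t ∈ Icc 0 τ → indexIntegrand L τ γ V V t =
      indexIntegrand L τ γ (norPart L τ γ V) (norPart L τ γ V) t +
        fundTensor L (velocity τ γ 0) (velocity τ γ 0) (velocity τ γ 0) *
          derivWithin (tanCoeff L τ γ V) (Icc 0 τ) t ^ 2 := by
  filter_upwards [hγ.ae_indexIntegrand_tanPart_right hτ hL hc hV hV,
    hγ.ae_indexIntegrand_tanPart_norPart hτ hL hc hV hV,
    hγ.ae_differentiableWithinAt hτ (hγ.norPart_mem_W12 hτ hL hV),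
    hγ.ae_differentiableWithinAt hτ (hγ.tanPart_mem_W12 hτ hL hV)] with t h1 h2 h3 h4 ht
  have e1 := hγ.indexIntegrand_add_right (V := V) hL ht (h3 ht) (h4 ht)
  have e2 := hγ.indexIntegrand_add_left (W := norPart L τ γ V) hL ht (h3 ht) (h4 ht)
  rw [norPart_add_tanPart] at e1 e2
  rw [e1, e2, h1 ht, h2 ht]
  ring

end IsGeodesic

theorem intervalIntegral_congr_of_ae_Icc {f g : ℝ → ℝ} (hτ : 0 ≤ τ)
    (h : ∀ᵐ t, t ∈ Icc 0 τ → f t = g t) : ∫ t in (0 : ℝ)..τ, f t = ∫ t in (0 : ℝ)..τ, g t := by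
  refine intervalIntegral.integral_congr_ae ?_
  filter_upwards [h] with t ht hts
  rw [uIoc_of_le hτ] at hts
  exact ht (Ioc_subset_Icc_self hts)

end IndexForm

/-! ### Kernel and Morse index for a perpendicular, nonnull geodesic. -/

section Splitting

variable {n : ℕ} {M : Type*} [TopologicalSpace M] [ChartedSpace (EuclideanSpace ℝ (Fin n)) M]
  [IsManifold (𝓡 n) 7 M] {A : Set (TangentBundle (𝓡 n) M)} {L : TangentBundle (𝓡 n) M → ℝ}
  {τ : ℝ} {γ : ℝ → M} {V W : FieldAlong (n := n) γ}
  {k : ℕ} {P : Set M} [ChartedSpace (EuclideanSpace ℝ (Fin k)) P]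
  {l : ℕ} {Q : Set M} [ChartedSpace (EuclideanSpace ℝ (Fin l)) Q]
  {h₀ : γ 0 ∈ P} {h₁ : γ τ ∈ Q}

theorem indexForm_eq_integral_of_eq_zero (hW₀ : W 0 = 0) (hW₁ : W τ = 0) :
    indexForm A L τ γ k P l Q h₀ h₁ V W = ∫ t in (0 : ℝ)..τ, indexIntegrand L τ γ V W t := by
  rw [indexForm_eq, hW₀, hW₁, fundTensor_zero_right, fundTensor_zero_right, add_zero, sub_zero]

/-- Data for the splitting of the index form of a nonnull geodesic that is perpendicular to `P`
and `Q`. -/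
structure IsPerpGeodesic (A : Set (TangentBundle (𝓡 n) M)) (L : TangentBundle (𝓡 n) M → ℝ)
    (τ : ℝ) (γ : ℝ → M) (k : ℕ) (P : Set M) [ChartedSpace (EuclideanSpace ℝ (Fin k)) P]
    (l : ℕ) (Q : Set M) [ChartedSpace (EuclideanSpace ℝ (Fin l)) Q]
    (h₀ : γ 0 ∈ P) (h₁ : γ τ ∈ Q) : Prop where
  metric : IsPseudoFinslerMetric A L
  pos : 0 < τ
  geodesic : IsGeodesic A L τ γ
  perp_left : ∀ u ∈ subTangent k P ⟨γ 0, h₀⟩, fundTensor L (velocity τ γ 0) u (velocity τ γ 0) = 0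
  perp_right : ∀ u ∈ subTangent l Q ⟨γ τ, h₁⟩,
    fundTensor L (velocity τ γ τ) u (velocity τ γ τ) = 0
  nonnull : ∀ t ∈ Icc 0 τ, fundTensor L (velocity τ γ t) (velocity τ γ t) (velocity τ γ t) ≠ 0

namespace IsPerpGeodesic

variable (H : IsPerpGeodesic A L τ γ k P l Q h₀ h₁)
include H

theorem tanPart_left (hV : V ∈ W12PQ τ γ k P l Q h₀ h₁) : tanPart L τ γ V 0 = 0 :=
  tanPart_eq_zero (H.perp_left _ hV.2.1)

theorem tanPart_right (hV : V ∈ W12PQ τ γ k P l Q h₀ h₁) : tanPart L τ γ V τ = 0 :=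
  tanPart_eq_zero (H.perp_right _ hV.2.2)

theorem norPart_left (hV : V ∈ W12PQ τ γ k P l Q h₀ h₁) : norPart L τ γ V 0 = V 0 :=
  norPart_apply_of_tanPart_eq_zero (H.tanPart_left hV)

theorem norPart_right (hV : V ∈ W12PQ τ γ k P l Q h₀ h₁) : norPart L τ γ V τ = V τ :=
  norPart_apply_of_tanPart_eq_zero (H.tanPart_right hV)

theorem tanPart_mem (hV : V ∈ W12PQ τ γ k P l Q h₀ h₁) :
    tanPart L τ γ V ∈ W12PQ τ γ k P l Q h₀ h₁ := by
  refine ⟨H.geodesic.tanPart_mem_W12 H.pos H.metric hV.1, ?_, ?_⟩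
  · rw [H.tanPart_left hV]
    exact Submodule.zero_mem _
  · rw [H.tanPart_right hV]
    exact Submodule.zero_mem _

theorem norPart_mem (hV : V ∈ W12PQ τ γ k P l Q h₀ h₁) :
    norPart L τ γ V ∈ W12PQ τ γ k P l Q h₀ h₁ := by
  refine ⟨H.geodesic.norPart_mem_W12 H.pos H.metric hV.1, ?_, ?_⟩
  · rw [H.norPart_left hV]
    exact hV.2.1
  · rw [H.norPart_right hV]
    exact hV.2.2

theorem normal_subset : W12PQNormal L τ γ k P l Q h₀ h₁ ⊆ W12PQ τ γ k P l Q h₀ h₁ := by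
  rintro _ ⟨X, hX, rfl⟩
  exact H.norPart_mem hX

theorem indexForm_norPart_tanPart (hV : V ∈ W12PQ τ γ k P l Q h₀ h₁)
    (hW : W ∈ W12PQ τ γ k P l Q h₀ h₁) :
    indexForm A L τ γ k P l Q h₀ h₁ (norPart L τ γ V) (tanPart L τ γ W) = 0 := by
  rw [indexForm_eq_integral_of_eq_zero (H.tanPart_left hW) (H.tanPart_right hW),
    intervalIntegral_congr_of_ae_Icc H.pos.le
      (H.geodesic.ae_indexIntegrand_norPart_tanPart H.pos H.metric H.nonnull hV.1 hW.1),
    intervalIntegral.integral_zero]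

/-- W and nor W have the same endpoint values, and their integrands against nor V agree almost
everywhere. -/
theorem indexForm_norPart_right (hV : V ∈ W12PQ τ γ k P l Q h₀ h₁)
    (hW : W ∈ W12PQ τ γ k P l Q h₀ h₁) :
    indexForm A L τ γ k P l Q h₀ h₁ (norPart L τ γ V) (norPart L τ γ W) =
      indexForm A L τ γ k P l Q h₀ h₁ (norPart L τ γ V) W := by
  rw [indexForm_eq, indexForm_eq, H.norPart_left hW, H.norPart_right hW,
    intervalIntegral_congr_of_ae_Icc H.pos.le
      (H.geodesic.ae_indexIntegrand_norPart_right H.pos H.metric H.nonnull hV.1 hW.1)]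

/-- tan V is the test field that detects the tangential part of a kernel element. -/
theorem indexForm_tanPart_self (hV : V ∈ W12PQ τ γ k P l Q h₀ h₁) :
    indexForm A L τ γ k P l Q h₀ h₁ V (tanPart L τ γ V) =
      fundTensor L (velocity τ γ 0) (velocity τ γ 0) (velocity τ γ 0) *
        ∫ t in (0 : ℝ)..τ, derivWithin (tanCoeff L τ γ V) (Icc 0 τ) t ^ 2 := by
  rw [indexForm_eq_integral_of_eq_zero (H.tanPart_left hV) (H.tanPart_right hV),
    intervalIntegral_congr_of_ae_Icc H.pos.le
      (H.geodesic.ae_indexIntegrand_tanPart_right H.pos H.metric H.nonnull hV.1 hV.1),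
    intervalIntegral.integral_const_mul]
  simp only [sq]

theorem norPart_eq_self_of_indexForm_eq_zero (hV : V ∈ W12PQ τ γ k P l Q h₀ h₁)
    (h : indexForm A L τ γ k P l Q h₀ h₁ V (tanPart L τ γ V) = 0) : norPart L τ γ V = V := by
  rw [H.indexForm_tanPart_self hV, mul_eq_zero,
    or_iff_right (H.nonnull 0 (left_mem_Icc.2 H.pos.le))] at h
  have hconst := eq_of_integral_derivWithin_sq_eq_zero H.pos
    (fun t ht => H.geodesic.isLocalPrimitive_tanCoeff H.pos H.metric hV.1 ht) h
  funext t
  refine norPart_apply_of_tanPart_eq_zero ?_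
  by_cases ht : t ∈ Icc 0 τ
  · have h0 : tanCoeff L τ γ V 0 = 0 := by
      rw [tanCoeff, H.perp_left _ hV.2.1, zero_div]
    rw [tanPart_eq]
    simp only [hconst t ht, h0, zero_smul]
  · exact tanPart_eq_zero (by rw [hV.1.1 t ht, fundTensor_zero_left])

theorem formKer_eq : formKer (indexForm A L τ γ k P l Q h₀ h₁) (W12PQNormal L τ γ k P l Q h₀ h₁) =
    formKer (indexForm A L τ γ k P l Q h₀ h₁) (W12PQ τ γ k P l Q h₀ h₁) := by
  ext V
  constructor
  · rintro ⟨⟨X, hX, rfl⟩, hker⟩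
    refine ⟨H.norPart_mem hX, fun W hW => ?_⟩
    rw [← H.indexForm_norPart_right hX hW]
    exact hker _ (mem_image_of_mem _ hW)
  · rintro ⟨hV, hker⟩
    exact ⟨⟨V, hV, H.norPart_eq_self_of_indexForm_eq_zero hV (hker _ (H.tanPart_mem hV))⟩,
      fun W hW => hker W (H.normal_subset hW)⟩

theorem indexForm_norPart_le (hV : V ∈ W12PQ τ γ k P l Q h₀ h₁)
    (hpos : 0 ≤ fundTensor L (velocity τ γ 0) (velocity τ γ 0) (velocity τ γ 0)) :
    indexForm A L τ γ k P l Q h₀ h₁ (norPart L τ γ V) (norPart L τ γ V) ≤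
      indexForm A L τ γ k P l Q h₀ h₁ V V := by
  rw [indexForm_eq, indexForm_eq, H.norPart_left hV, H.norPart_right hV,
    intervalIntegral_congr_of_ae_Icc H.pos.le
      (H.geodesic.ae_indexIntegrand_self H.pos H.metric H.nonnull hV.1)]
  gcongr
  exact integral_le_integral_add H.pos.le
    ((intervalIntegrable_derivWithin_sq H.pos fun t ht =>
      H.geodesic.isLocalPrimitive_tanCoeff H.pos H.metric hV.1 ht).const_mul _)
    fun t => mul_nonneg hpos (sq_nonneg _)

/-- Checked directly on the integrand, since bilinearity of the index form is not at hand. -/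
theorem indexForm_zero_zero : indexForm A L τ γ k P l Q h₀ h₁ 0 0 = 0 := by
  rw [indexForm_eq_integral_of_eq_zero rfl rfl,
    intervalIntegral_congr_of_ae_Icc (g := fun _ => 0) H.pos.le
      (Eventually.of_forall fun t ht => ?_), intervalIntegral.integral_zero]
  have h := H.geodesic.indexIntegrand_smul_velocity_smul_velocity H.pos H.metric ht
    (h := fun _ => 0) (k := fun _ => 0) (differentiableWithinAt_const _)
    (differentiableWithinAt_const _)
  have h0 : (fun t => (0 : ℝ) • velocity τ γ t : FieldAlong (n := n) γ) = 0 :=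
    funext fun t => zero_smul _ _
  rw [h0] at h
  rw [h]
  simp

/-- One inequality is inclusion of spaces. For the other, nor maps a negative definite subspace to
one of the same dimension: nor Y = 0 with Y ≠ 0 would give 0 = I(nor Y, nor Y) ≤ I(Y, Y) < 0. -/
theorem formIndex_eq
    (hpos : 0 ≤ fundTensor L (velocity τ γ 0) (velocity τ γ 0) (velocity τ γ 0)) :
    formIndex (indexForm A L τ γ k P l Q h₀ h₁) (W12PQNormal L τ γ k P l Q h₀ h₁) =
      formIndex (indexForm A L τ γ k P l Q h₀ h₁) (W12PQ τ γ k P l Q h₀ h₁) := by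
  refine le_antisymm ?_ ?_
  · refine iSup_mono fun N => iSup_mono fun _ => ?_
    exact iSup_le fun hN => le_iSup_of_le (hN.trans H.normal_subset) le_rfl
  · refine iSup_le fun N => iSup_le fun hfin => iSup_le fun hN => iSup_le fun hneg => ?_
    set Φ := norLinear H.geodesic H.metric with hΦ
    have hΦN : ∀ Y ∈ N, Φ Y = norPart L τ γ Y := fun Y hY =>
      norLinear_apply H.geodesic H.metric (hN hY).1.1
    have hneg' : ∀ Y ∈ N, Y ≠ 0 →
        indexForm A L τ γ k P l Q h₀ h₁ (Φ Y) (Φ Y) < 0 := fun Y hY hY0 => by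
      rw [hΦN Y hY]
      exact (H.indexForm_norPart_le (hN hY) hpos).trans_lt (hneg Y hY hY0)
    have hinj : Function.Injective (Φ.domRestrict N) := by
      rw [← LinearMap.ker_eq_bot, LinearMap.ker_eq_bot']
      rintro ⟨Y, hY⟩ h0
      by_contra hne
      have hlt := hneg' Y hY fun h => hne (Subtype.ext h)
      rw [show Φ Y = 0 from h0, H.indexForm_zero_zero] at hlt
      exact lt_irrefl _ hlt
    have hrank : Module.finrank ℝ (N.map Φ) = Module.finrank ℝ N := by
      rw [← LinearMap.range_domRestrict]
      exact LinearMap.finrank_range_of_inj hinj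
    rw [← hrank]
    refine le_iSup_of_le (N.map Φ) (le_iSup_of_le inferInstance (le_iSup_of_le ?_
      (le_iSup_of_le ?_ le_rfl)))
    · rintro _ ⟨Y, hY, rfl⟩
      exact ⟨Y, hN hY, (hΦN Y hY).symm⟩
    · rintro _ ⟨Y, hY, rfl⟩ hne
      refine hneg' Y hY ?_
      rintro rfl
      exact hne (map_zero Φ)

end IsPerpGeodesic

end Splitting

end PseudoFinsler

end

open PseudoFinsler in
theorem propositionB {n : ℕ} {M : Type*} [TopologicalSpace M]
    [ChartedSpace (EuclideanSpace ℝ (Fin n)) M] [IsManifold (𝓡 n) 7 M]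
    [T2Space M] [SecondCountableTopology M] [ConnectedSpace M]
    (A : Set (TangentBundle (𝓡 n) M)) (L : TangentBundle (𝓡 n) M → ℝ)
    (hL : IsPseudoFinslerMetric A L)
    -- the submanifolds `P` and `Q`
    (k : ℕ) (hk : k < n) (P : Set M) [ChartedSpace (EuclideanSpace ℝ (Fin k)) P]
    [IsManifold (𝓡 k) 7 P] [ConnectedSpace P]
    (hP : IsSmoothEmbedding (𝓡 k) (𝓡 n) 7 (Subtype.val : P → M))
    (l : ℕ) (hl : l < n) (Q : Set M) [ChartedSpace (EuclideanSpace ℝ (Fin l)) Q]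
    [IsManifold (𝓡 l) 7 Q] [ConnectedSpace Q]
    (hQ : IsSmoothEmbedding (𝓡 l) (𝓡 n) 7 (Subtype.val : Q → M))
    -- the geodesic, perpendicular to `P` and `Q`
    (τ : ℝ) (hτ : 0 < τ) (γ : ℝ → M) (hγ : IsGeodesic A L τ γ)
    (h₀ : γ 0 ∈ P) (h₁ : γ τ ∈ Q)
    (hperp₀ : ∀ u ∈ subTangent k P ⟨γ 0, h₀⟩,
      fundTensor L (velocity τ γ 0) u (velocity τ γ 0) = 0)
    (hperp₁ : ∀ u ∈ subTangent l Q ⟨γ τ, h₁⟩,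
      fundTensor L (velocity τ γ τ) u (velocity τ γ τ) = 0)
    (hnd₀ : NondegenerateOn k P L ⟨γ 0, h₀⟩ (velocity τ γ 0))
    (hnd₁ : NondegenerateOn l Q L ⟨γ τ, h₁⟩ (velocity τ γ τ))
    (hne : ∃ t ∈ Icc 0 τ, L (⟨γ t, velocity τ γ t⟩ : TangentBundle (𝓡 n) M) ≠ 0) :
    (∀ V ∈ W12PQ τ γ k P l Q h₀ h₁, ∀ W ∈ W12PQ τ γ k P l Q h₀ h₁,
      indexForm A L τ γ k P l Q h₀ h₁ (norPart L τ γ V) (tanPart L τ γ W) = 0) ∧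
    formKer (indexForm A L τ γ k P l Q h₀ h₁) (W12PQNormal L τ γ k P l Q h₀ h₁) =
      formKer (indexForm A L τ γ k P l Q h₀ h₁) (W12PQ τ γ k P l Q h₀ h₁) ∧
    ((∃ t ∈ Icc 0 τ, ∀ u : TangentSpace (𝓡 n) (γ t), u ≠ 0 →
        0 < fundTensor L (velocity τ γ t) u u) →
      (∀ t ∈ Icc 0 τ, ∀ u : TangentSpace (𝓡 n) (γ t), u ≠ 0 →
        0 < fundTensor L (velocity τ γ t) u u) ∧
      formIndex (indexForm A L τ γ k P l Q h₀ h₁) (W12PQNormal L τ γ k P l Q h₀ h₁) =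
        formIndex (indexForm A L τ γ k P l Q h₀ h₁) (W12PQ τ γ k P l Q h₀ h₁)) := by
  have hperp : IsPerpGeodesic A L τ γ k P l Q h₀ h₁ :=
    { metric := hL
      pos := hτ
      geodesic := hγ
      perp_left := hperp₀
      perp_right := hperp₁
      nonnull := by
        intro t ht
        obtain ⟨s, hs, hne⟩ := hne
        rwa [hγ.fundTensor_velocity_eq hτ hL ht hs, hL.fundTensor_self (hγ.admissible s hs)] }
  refine ⟨fun V hV W hW => hperp.indexForm_norPart_tanPart hV hW, hperp.formKer_eq, ?_⟩
  rintro ⟨s, hs, hpos⟩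
  have hall : ∀ t ∈ Icc 0 τ, ∀ u : TangentSpace (𝓡 n) (γ t), u ≠ 0 →
      0 < fundTensor L (velocity τ γ t) u u := fun t ht => hγ.posDef_of_posDef hτ hL hs ht hpos
  have h0 : (0 : ℝ) ∈ Icc 0 τ := left_mem_Icc.2 hτ.le
  -- Since γ̇(0) ≠ 0, definiteness at time 0 gives c > 0.
  exact ⟨hall, hperp.formIndex_eq
    (hall 0 h0 _ (hL.ne_zero _ _ (hγ.admissible 0 h0))).le⟩
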